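/- Fix an integer $k\ge 3$ and $\delta\in(0,1)$. For $x\in(0,1]$ let $\mathrm{type}_k(x)=q$, $f_k(x)=1/q$ if $x\in(\frac1{q+1},\frac1q]$ with $q\in\{1,\dots,k-1\}$, and $\mathrm{type}_k(x)=k$, $f_k(x)=\frac{k}{k-2}x$ if $x\le \frac1k$. Let $I$ be a non-empty finite family of $d$-dimensional items, $d\ge2$, where item $i$ has lengths $\ell_1(i),\dots,\ell_d(i)\in(0,1]$. The base type of $i$ is $(\mathrm{type}_k(\ell_1(i)),\dots,\mathrm{type}_k(\ell_{d-1}(i)))$, and $\mathrm{round}(i)$ is the rectangle of width $\prod_{j=1}^{d-1}f_k(\ell_j(i))$ and height $\ell_d(i)$. Let $Q$ be the number of distinct base types of the items of $I$. A shelf-based $\delta$-fractional packing $P$ of $\mathrm{round}(I)=\{\mathrm{round}(i):i\in I\}$ consists of $|P|$ unit-square bins, in which there are shelves (rectangles of width $1$ and height more than $\delta$, possibly empty) and slices of the rectangles of $\mathrm{round}(I)$: each rectangle of height more than $\delta$ is sliced recursively by (finitely many) vertical cuts, and its slices lie in shelves with their bottom edges on the bottom edge of the shelf; each other rectangle is sliced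 recursively by (finitely many) vertical and horizontal cuts, and its slices lie outside of the shelves; nothing overlaps. Let $t$ be the number of distinct heights of shelves in $P$. Let $\mathrm{inflate}$ be the following algorithm. If $|P|\ge|I|$, it packs every item into a bin of its own. Otherwise: (1) It repacks the rectangles higher than $\delta$ greedily, by decreasing height and with vertical slicing, into the shelves of $P$ taken by decreasing height; then, for each shelf height and each base type, it repacks the slices of this base type in the shelves of this height into as few shelves of this height as possible. These new shelves take the places of the old ones of the same height, and where these do not suffice, each further shelf goes into a new bin. (2) It packs the other rectangles of each base type greedily, by decreasing height and with vertical slicing, into shelves of width $1$, each as high as its first piece, and packs these shelves by Next-Fit into the space outside of the shelves in the bins of $P$, and then into new bins. (3) For each base type, it repacks all its rectangles greedily, as in (2), into shelves, puts these in order of decreasing height into the places of the shelves of this base type from (1) and (2), and packs the items whose rectangle lies in a shelf unsliced or with its first slice into a $d$-dimensional shelf (a cuboid with base $[0,1]^{d-1}$ of the same height), in this order, by Caprara's procedure HDH-unit-pack for the first $d-1$ dimensions. (That procedure packs a sequence of $j$-dimensional items of one type into a unit cube: for $j=1$ it places them side by side; for $j\ge 2$ it sorts them by decreasing $\ell_j$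 if these lengths have type $k$, cuts the sequence into shortest prefixes with $\sum_i\prod_{c<j}f_k(\ell_c(i))\ge1$ (the last one may have less), packs each prefix recursively by its first $j-1$ dimensions, and stacks the resulting shelves in dimension $j$.) Then for all such $d$, $I$ and $P$, $\mathrm{inflate}(P)$ returns a packing of the $d$-dimensional items $I$ themselves (unsliced, unrotated, without overlap) into unit cubes, the number of which is less than \[ \frac{|P|}{1-\delta}+t(Q-1)+1+\frac{\delta Q}{1-\delta}, \] and it takes $O(|I|\,d\log(|I|+1))$ steps on a real RAM (unit cost for arithmetic operations, comparisons and memory accesses), where the constant depends only on $k$ and $\delta$. -/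

import Mathlib

namespace HarmonicPacking

noncomputable section

/-! ## Items, types, the harmonic function, rounding -/

/-- The `j`-th entry (counted from `0`) of a vector, read as from an array; `0` outside the array. -/
def coord {d : ℕ} (x : Fin d → ℝ) (j : ℕ) : ℝ :=
  if h : j < d then x ⟨j, h⟩ else 0

/-- `type_k`: the type of a length `x ∈ (0, 1]` is `k` if `x ≤ 1/k`, and otherwise the
`q ∈ {1, …, k-1}` with `1/(q+1) < x ≤ 1/q`, which is `⌊1/x⌋`. -/
def typeK (k : ℕ) (x : ℝ) : ℕ :=
  if x ≤ 1 / (k : ℝ) then k else ⌊1 / x⌋₊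

/-- The harmonic function `f_k`: it is `k x/(k-2)` if `x ≤ 1/k`, and `1/q` if `x > 1/k` has
type `q`. -/
def fK (k : ℕ) (x : ℝ) : ℝ :=
  if x ≤ 1 / (k : ℝ) then (k : ℝ) / ((k : ℝ) - 2) * x else 1 / (typeK k x : ℝ)

/-- The height of a `d`-dimensional item: its last length. -/
def height {d : ℕ} (x : Fin d → ℝ) : ℝ := coord x (d - 1)

/-- The width of the rounded item: the product of `f_k` over the `d - 1` base lengths. -/
def width (k : ℕ) {d : ℕ} (x : Fin d → ℝ) : ℝ :=
  ∏ j ∈ Finset.range (d - 1), fK k (coord x j)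

/-- The base type of an item: the vector of types of its `d - 1` base lengths. -/
def baseType (k : ℕ) {d : ℕ} (x : Fin d → ℝ) : Fin (d - 1) → ℕ :=
  fun j => typeK k (coord x j)

/-- The number of distinct base types in a family of items. -/
def numBaseTypes (k : ℕ) {n d : ℕ} (I : Fin n → Fin d → ℝ) : ℕ :=
  (Finset.univ.image fun i => baseType k (I i)).card

/-- (The dimensions of) a rectangle. -/
structure Rect where
  w : ℝ
  h : ℝ

/-- `round(i)`: the rectangle of width `w(i)` and height `h(i)`. -/
def roundItem (k : ℕ) {d : ℕ} (x : Fin d → ℝ) : Rect := ⟨width k x, height x⟩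

/-- `round(I)`, as a family. -/
def round (k : ℕ) {n d : ℕ} (I : Fin n → Fin d → ℝ) : Fin n → Rect :=
  fun i => roundItem k (I i)

/-! ## Shelf-based fractional packings of rectangles -/

/-- `Slicing hor r S`: the rectangle `r` can be cut recursively into the rectangles `S`, by vertical
cuts and, if `hor` holds, also by horizontal cuts. -/
inductive Slicing (hor : Prop) : Rect → Multiset Rect → Prop
  | whole (r : Rect) : Slicing hor r {r}
  | vertical (w₁ w₂ h : ℝ) (S₁ S₂ : Multiset Rect) (hw₁ : 0 < w₁) (hw₂ : 0 < w₂)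
      (s₁ : Slicing hor ⟨w₁, h⟩ S₁) (s₂ : Slicing hor ⟨w₂, h⟩ S₂) :
      Slicing hor ⟨w₁ + w₂, h⟩ (S₁ + S₂)
  | horizontal (w h₁ h₂ : ℝ) (S₁ S₂ : Multiset Rect) (allowed : hor)
      (hh₁ : 0 < h₁) (hh₂ : 0 < h₂)
      (s₁ : Slicing hor ⟨w, h₁⟩ S₁) (s₂ : Slicing hor ⟨w, h₂⟩ S₂) :
      Slicing hor ⟨w, h₁ + h₂⟩ (S₁ + S₂)

/-- A rectangle with its position: lower left corner `(x, y)`, width `w`, height `h`. -/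
structure Placed where
  x : ℝ
  y : ℝ
  w : ℝ
  h : ℝ

/-- The rectangle lies in the unit square. -/
def Placed.InUnit (p : Placed) : Prop :=
  0 ≤ p.x ∧ p.x + p.w ≤ 1 ∧ 0 ≤ p.y ∧ p.y + p.h ≤ 1

/-- The two rectangles do not overlap (they may touch). -/
def Placed.Apart (p q : Placed) : Prop :=
  p.x + p.w ≤ q.x ∨ q.x + q.w ≤ p.x ∨ p.y + p.h ≤ q.y ∨ q.y + q.h ≤ p.y

/-- A placed slice of one of the items `0, …, n-1`. -/
structure Slice (n : ℕ) where
  item : Fin n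
  pos : Placed

/-- A shelf: a rectangle of width `1`, with lower left corner `(0, y)`, and the slices packed
into it. -/
structure Shelf (n : ℕ) where
  y : ℝ
  ht : ℝ
  slices : List (Slice n)

/-- The rectangle that a shelf covers. -/
def Shelf.rect {n : ℕ} (s : Shelf n) : Placed := ⟨0, s.y, 1, s.ht⟩

/-- The slices lie in the shelf, with their bottom edges on the bottom edge of the shelf, and do
not overlap. -/
def Shelf.Valid {n : ℕ} (s : Shelf n) : Prop :=
  (∀ p ∈ s.slices, 0 ≤ p.pos.x ∧ p.pos.x + p.pos.w ≤ 1 ∧ p.pos.y = s.y ∧ p.pos.h ≤ s.ht) ∧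
  s.slices.Pairwise fun p q => p.pos.Apart q.pos

/-- A bin: shelves, and slices outside of the shelves. -/
structure Bin (n : ℕ) where
  shelves : List (Shelf n)
  free : List (Slice n)

/-- Shelves and slices lie in the unit square, and there is no overlap. -/
def Bin.Valid {n : ℕ} (B : Bin n) : Prop :=
  (∀ s ∈ B.shelves, s.rect.InUnit ∧ s.Valid) ∧
  (B.shelves.Pairwise fun s s' => s.rect.Apart s'.rect) ∧
  (∀ p ∈ B.free, p.pos.InUnit) ∧
  (B.free.Pairwise fun p q => p.pos.Apart q.pos) ∧
  (∀ p ∈ B.free, ∀ s ∈ B.shelves, p.pos.Apart s.rect)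

/-- All slices in a bin. -/
def Bin.slices {n : ℕ} (B : Bin n) : List (Slice n) :=
  B.shelves.flatMap Shelf.slices ++ B.free

/-- A list of bins; the number `|P|` of bins is the length of the list. -/
abbrev FracPacking (n : ℕ) := List (Bin n)

/-- The dimensions of all the slices of item `i`. -/
def FracPacking.slicesOf {n : ℕ} (P : FracPacking n) (i : Fin n) : Multiset Rect :=
  (((P.flatMap Bin.slices).filter fun p => p.item = i).map
    fun p => (⟨p.pos.w, p.pos.h⟩ : Rect) : List Rect)

/-- `P` is a shelf-based `δ`-fractional packing of the rectangles `K`: every item is cut into the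
slices that `P` contains, with horizontal cuts only for items of height at most `δ`; slices of items
higher than `δ` are in shelves, all other slices are outside of the shelves. Shelves (which may be
empty) are there for the items higher than `δ`, so they are themselves higher than `δ`. -/
structure FracPacking.IsShelfBased {n : ℕ} (P : FracPacking n) (δ : ℝ) (K : Fin n → Rect) :
    Prop where
  slicing : ∀ i, Slicing ((K i).h ≤ δ) (K i) (P.slicesOf i)
  valid : ∀ B ∈ P, B.Valid
  large : ∀ B ∈ P, ∀ s ∈ B.shelves, ∀ p ∈ s.slices, δ < (K p.item).h
  small : ∀ B ∈ P, ∀ p ∈ B.free, (K p.item).h ≤ δ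
  shelf_ht : ∀ B ∈ P, ∀ s ∈ B.shelves, δ < s.ht

/-- The number of distinct heights of shelves. -/
def FracPacking.numShelfHeights {n : ℕ} (P : FracPacking n) : ℕ :=
  ((P.flatMap Bin.shelves).map Shelf.ht).toFinset.card

/-! ## Bin packings of `d`-dimensional items -/

/-- Item `item` is put into bin number `bin`, with its minimal corner at `pos`. -/
structure Placement (n d : ℕ) where
  item : Fin n
  bin : ℕ
  pos : Fin d → ℝ

/-- A number of bins, and a list of placements of items into the bins `0, …, numBins - 1`. -/
structure Packing (n d : ℕ) where
  numBins : ℕ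
  places : List (Placement n d)

/-- Every item is placed exactly once, unsliced and unrotated, in a bin that is a unit cube, and the
items in a bin do not overlap. -/
structure Packing.IsPackingOf {n d : ℕ} (R : Packing n d) (I : Fin n → Fin d → ℝ) : Prop where
  once : (R.places.map Placement.item).Perm (List.finRange n)
  bin_lt : ∀ p ∈ R.places, p.bin < R.numBins
  inside : ∀ p ∈ R.places, ∀ j, 0 ≤ p.pos j ∧ p.pos j + I p.item j ≤ 1
  apart : R.places.Pairwise fun p q => p.bin = q.bin →
    ∃ j, p.pos j + I p.item j ≤ q.pos j ∨ q.pos j + I q.item j ≤ p.pos j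

/-! ## Step counting

Programs run on a real RAM. Each of the following costs one step: an arithmetic operation or a
comparison (of reals or of natural numbers), reading or writing an array cell, and a call of a
recursive routine (which pays for inspecting and for building a bounded number of list cells and
records). Lists are linked lists: only the head is accessible. -/

/-- A result, together with the number of steps of its computation. -/
structure Timed (α : Type) where
  val : α
  steps : ℕ

instance : Monad Timed where
  pure a := ⟨a, 0⟩
  bind x f := ⟨(f x.val).val, x.steps + (f x.val).steps⟩

/-- Pay for `c` steps. -/
def tick (c : ℕ) : Timed Unit := ⟨(), c⟩

/-- `a + b`. -/
def addT (a b : ℝ) : Timed ℝ := ⟨a + b, 1⟩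

/-- `a - b`. -/
def subT (a b : ℝ) : Timed ℝ := ⟨a - b, 1⟩

/-- `a * b`. -/
def mulT (a b : ℝ) : Timed ℝ := ⟨a * b, 1⟩

/-- `a / b`. -/
def divT (a b : ℝ) : Timed ℝ := ⟨a / b, 1⟩

/-- Is `a ≤ b`? -/
def leT (a b : ℝ) : Timed Bool := ⟨decide (a ≤ b), 1⟩

/-- Is `a < b`? -/
def ltT (a b : ℝ) : Timed Bool := ⟨decide (a < b), 1⟩

/-- Is `a < b`, for natural numbers? -/
def ltNatT (a b : ℕ) : Timed Bool := ⟨decide (a < b), 1⟩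

/-- `b + 1`, for a natural number. -/
def succT (b : ℕ) : Timed ℕ := ⟨b + 1, 1⟩

/-- Read cell `j` of an array. -/
def readT {α : Type} (a : ℕ → α) (j : ℕ) : Timed α := ⟨a j, 1⟩

/-- Write `v` into cell `j` of an array. -/
def writeT {α : Type} (a : ℕ → α) (j : ℕ) (v : α) : Timed (ℕ → α) :=
  ⟨Function.update a j v, 1⟩

/-! ### Lists -/

/-- The length of a list. -/
def lengthT {α : Type} : List α → Timed ℕ
  | [] => do tick 1; pure 0
  | _ :: l => do
      tick 1
      let m ← lengthT l
      succT m

/-- Does the list have at least so many entries? -/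
def longT {α : Type} : List α → ℕ → Timed Bool
  | _, 0 => do tick 1; pure true
  | [], _ + 1 => do tick 1; pure false
  | _ :: l, m + 1 => do tick 1; longT l m

/-- Concatenation. -/
def appendT {α : Type} : List α → List α → Timed (List α)
  | [], l' => do tick 1; pure l'
  | a :: l, l' => do
      tick 1
      let r ← appendT l l'
      pure (a :: r)

/-- The entries that pass a test. -/
def filterT {α : Type} (test : α → Timed Bool) : List α → Timed (List α)
  | [] => do tick 1; pure []
  | a :: l => do
      tick 1
      let b ← test a
      let r ← filterT test l
      pure (if b then a :: r else r)

/-- Merge two sorted lists. -/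
def mergeT {α : Type} (le : α → α → Timed Bool) : List α → List α → Timed (List α)
  | [], l' => do tick 1; pure l'
  | a :: l, [] => do tick 1; pure (a :: l)
  | a :: l, b :: l' => do
      tick 1
      let c ← le a b
      if c then do
        let r ← mergeT le l (b :: l')
        pure (a :: r)
      else do
        let r ← mergeT le (a :: l) l'
        pure (b :: r)
termination_by l l' => l.length + l'.length

/-- Sort the first `m` entries of a list by merge sort; return them and the remaining entries. -/
def sortFirstT {α : Type} (le : α → α → Timed Bool) : ℕ → List α → Timed (List α × List α)
  | 0, l => do tick 1; pure ([], l)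
  | 1, [] => do tick 1; pure ([], [])
  | 1, a :: l => do tick 1; pure ([a], l)
  | m + 2, l => do
      tick 3
      let r ← sortFirstT le ((m + 2) / 2) l
      let s ← sortFirstT le ((m + 2) - (m + 2) / 2) r.2
      let t ← mergeT le r.1 s.1
      pure (t, s.2)
termination_by m => m
decreasing_by all_goals omega

/-- Merge sort. -/
def sortT {α : Type} (le : α → α → Timed Bool) (l : List α) : Timed (List α) := do
  let m ← lengthT l
  let r ← sortFirstT le m l
  pure r.1

/-! ### Preparing the items -/

/-- An item with the arrays that are computed for it: `len` holds its lengths, `typ` the types of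
its base lengths, and `vol c` is the product of `f_k` over its first `c` lengths (`c ≤ d - 1`). -/
structure Prep (n : ℕ) where
  idx : Fin n
  len : ℕ → ℝ
  typ : ℕ → ℕ
  vol : ℕ → ℝ

/-- (A vertical slice of) a rounded item, with the height that it counts for, and its width. -/
structure Piece (n : ℕ) where
  src : Prep n
  ht : ℝ
  wd : ℝ

/-- The first `q' ≥ q` with `1/(q'+1) < x`, trying the given number of values. -/
def typeSearchT (x : ℝ) : ℕ → ℕ → Timed ℕ
  | 0, q => do tick 1; pure q
  | r + 1, q => do
      tick 1
      let q' ← succT q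
      let u ← divT 1 (q' : ℝ)
      let b ← ltT u x
      if b then pure q else typeSearchT x r q'

/-- The value of `f_k` at `x`, which has type `q`. -/
def fKT (k : ℕ) (x : ℝ) (q : ℕ) : Timed ℝ := do
  let b ← ltNatT q k
  if b then divT 1 (q : ℝ)
  else do
    let u ← subT (k : ℝ) 2
    let v ← divT (k : ℝ) u
    mulT v x

/-- The cells `0, …, c-1` of `typ` and the cells `0, …, c` of `vol`. -/
def prepArraysT (k : ℕ) (len : ℕ → ℝ) : ℕ → Timed ((ℕ → ℕ) × (ℕ → ℝ))
  | 0 => do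
      tick 1
      let v ← writeT (fun _ => (0 : ℝ)) 0 1
      pure (fun _ => 0, v)
  | c + 1 => do
      tick 1
      let a ← prepArraysT k len c
      let x ← readT len c
      let q ← typeSearchT x (k - 1) 1
      let f ← fKT k x q
      let v ← readT a.2 c
      let v' ← mulT v f
      let t ← writeT a.1 c q
      let u ← writeT a.2 (c + 1) v'
      pure (t, u)

/-- Prepare and round the items with the given indices. -/
def prepT (k : ℕ) {n d : ℕ} (I : Fin n → Fin d → ℝ) : List (Fin n) → Timed (List (Piece n))
  | [] => do tick 1; pure []
  | i :: l => do
      tick 1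
      let a ← prepArraysT k (coord (I i)) (d - 1)
      let h ← readT (coord (I i)) (d - 1)
      let w ← readT a.2 (d - 1)
      let r ← prepT k I l
      pure (⟨⟨i, coord (I i), a.1, a.2⟩, h, w⟩ :: r)

/-- Compare the first `c` cells of two arrays lexicographically, the last of these cells first. -/
def cmpArrayT (a b : ℕ → ℕ) : ℕ → Timed Ordering
  | 0 => do tick 1; pure Ordering.eq
  | c + 1 => do
      tick 1
      let u ← readT a c
      let v ← readT b c
      let lt ← ltNatT u v
      let gt ← ltNatT v u
      if lt then pure Ordering.lt
      else if gt then pure Ordering.gt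
      else cmpArrayT a b c

/-- Are the base types equal? Here and below, `D` is the number of base dimensions. -/
def sameTypeT {n : ℕ} (D : ℕ) (a b : Piece n) : Timed Bool := do
  let o ← cmpArrayT a.src.typ b.src.typ D
  pure (o == Ordering.eq)

/-- Are the base types equal, and also the heights? -/
def sameTypeHtT {n : ℕ} (D : ℕ) (a b : Piece n) : Timed Bool := do
  let s ← sameTypeT D a b
  let u ← leT a.ht b.ht
  let v ← leT b.ht a.ht
  pure (s && u && v)

/-- Order by decreasing height. -/
def leHtT {n : ℕ} (a b : Piece n) : Timed Bool := leT b.ht a.ht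

/-- Order by base type, and then by decreasing height. -/
def leTypeHtT {n : ℕ} (D : ℕ) (a b : Piece n) : Timed Bool := do
  let o ← cmpArrayT a.src.typ b.src.typ D
  match o with
  | Ordering.lt => pure true
  | Ordering.gt => pure false
  | Ordering.eq => leT b.ht a.ht

/-! ### Packing a shelf: items of one type into a unit cube -/

/-- Place the items along the first dimension, starting at `x`; `acc` holds the other coordinates,
which are common to all of them. -/
def lineT {n : ℕ} : List (Piece n) → ℝ → List ℝ → Timed (List (Fin n × List ℝ))
  | [], _, _ => do tick 1; pure []
  | a :: l, x, acc => do
      tick 1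
      let u ← readT a.src.len 0
      let x' ← addT x u
      let r ← lineT l x' acc
      pure ((a.src.idx, x :: acc) :: r)

/-- Cut a sequence into shortest prefixes with total `vol c` at least `1` (the last one may have
less); `s` is the total of the part of the first prefix that has already been read. -/
def prefixesT {n : ℕ} (c : ℕ) : List (Piece n) → ℝ → Timed (List (List (Piece n)))
  | [], _ => do tick 1; pure []
  | a :: l, s => do
      tick 1
      let v ← readT a.src.vol c
      let s' ← addT s v
      let b ← leT 1 s'
      if b then do
        let r ← prefixesT c l 0
        pure ([a] :: r)
      else do
        let r ← prefixesT c l s'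
        match r with
        | [] => pure [[a]]
        | J :: S => pure ((a :: J) :: S)

/-- The largest of `m` and the lengths in dimension `c`. -/
def maxLenT {n : ℕ} (c : ℕ) : List (Piece n) → ℝ → Timed ℝ
  | [], m => do tick 1; pure m
  | a :: l, m => do
      tick 1
      let u ← readT a.src.len c
      let b ← leT u m
      maxLenT c l (if b then m else u)

/-- Pack each of the sequences by `sub` into a shelf, and put the shelves on top of each other in
dimension `c`, starting at `y`. -/
def stackShelvesT {n : ℕ} (c : ℕ)
    (sub : List (Piece n) → List ℝ → Timed (List (Fin n × List ℝ))) :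
    List (List (Piece n)) → ℝ → List ℝ → Timed (List (Fin n × List ℝ))
  | [], _, _ => do tick 1; pure []
  | J :: S, y, acc => do
      tick 1
      let p ← sub J (y :: acc)
      let h ← maxLenT c J 0
      let y' ← addT y h
      let r ← stackShelvesT c sub S y' acc
      appendT p r

/-- If the first item has type `k` in dimension `c`, sort by decreasing length in dimension `c`. -/
def sortSmallT (k c : ℕ) {n : ℕ} : List (Piece n) → Timed (List (Piece n))
  | [] => do tick 1; pure []
  | a :: l => do
      tick 1
      let q ← readT a.src.typ c
      let b ← ltNatT q k
      if b then pure (a :: l)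
      else sortT (fun p q => do
        let u ← readT p.src.len c
        let v ← readT q.src.len c
        leT v u) (a :: l)

/-- `HDH-unit-pack`: pack a sequence of items, all of the same type, by their dimensions
`0, …, j` into a unit cube; `acc` holds the other coordinates. -/
def unitPackT (k : ℕ) {n : ℕ} : ℕ → List (Piece n) → List ℝ → Timed (List (Fin n × List ℝ))
  | 0, l, acc => lineT l 0 acc
  | j + 1, l, acc => do
      let l' ← sortSmallT k (j + 1) l
      let S ← prefixesT (j + 1) l' 0
      stackShelvesT (j + 1) (unitPackT k j) S 0 acc

/-! ### Canonical shelving -/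

/-- A tight shelf, higher than or as high as everything in it: `rep` is the first (and highest)
piece in it, so the height of the shelf is `rep.ht`; `items` are the pieces that lie in the shelf
unsliced or with their first part, a sliced one being the last. -/
structure TightShelf (n : ℕ) where
  rep : Piece n
  items : List (Piece n)

/-- Continue greedy shelving, in a shelf that has `room` left, after the piece `prev`; `same` tells
whether a piece may share a shelf with the previous one. Returns the further items of the
current shelf, and the shelves after it. -/
def shelveFromT {n : ℕ} (same : Piece n → Piece n → Timed Bool) :
    List (Piece n) → Piece n → ℝ → Timed (List (Piece n) × List (TightShelf n))
  | [], _, _ => do tick 1; pure ([], [])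
  | a :: l, prev, room => do
      tick 1
      let s ← same prev a
      let pos ← ltT 0 room
      if s && pos then do
        let fits ← leT a.wd room
        if fits then do
          let room' ← subT room a.wd
          let r ← shelveFromT same l a room'
          pure (a :: r.1, r.2)
        else do
          let rest ← subT a.wd room
          let room' ← subT 1 rest
          let r ← shelveFromT same l a room'
          pure ([a], ⟨a, r.1⟩ :: r.2)
      else do
        let room' ← subT 1 a.wd
        let r ← shelveFromT same l a room'
        pure ([], ⟨a, a :: r.1⟩ :: r.2)

/-- The canonical shelving of a sorted sequence, separately for each run of `same` pieces. -/
def shelveT {n : ℕ} (same : Piece n → Piece n → Timed Bool) :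
    List (Piece n) → Timed (List (TightShelf n))
  | [] => do tick 1; pure []
  | a :: l => do
      tick 1
      let room ← subT 1 a.wd
      let r ← shelveFromT same l a room
      pure (⟨a, a :: r.1⟩ :: r.2)

/-! ### Space for shelves -/

/-- Space for a shelf of height `ht`, in bin number `bin`, with bottom at `y`. -/
structure Space where
  bin : ℕ
  y : ℝ
  ht : ℝ

/-- A bin that is filled up to height `top`. -/
structure OpenBin where
  bin : ℕ
  top : ℝ

/-- A shelf in its bin; `rep` gives its height and its base type. -/
structure PlacedShelf (n : ℕ) where
  rep : Piece n
  bin : ℕ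
  y : ℝ

/-- Push the shelves of bin number `b` down onto `y`; also return the height reached. -/
def stackBinT {n : ℕ} (b : ℕ) : List (Shelf n) → ℝ → Timed (List Space × ℝ)
  | [], y => do tick 1; pure ([], y)
  | s :: l, y => do
      tick 1
      let y' ← addT y s.ht
      let r ← stackBinT b l y'
      pure (⟨b, y, s.ht⟩ :: r.1, r.2)

/-- Push the shelves down in all bins, numbered from `b` on. -/
def stackBinsT {n : ℕ} : List (Bin n) → ℕ → Timed (List Space × List OpenBin)
  | [], _ => do tick 1; pure ([], [])
  | B :: l, b => do
      tick 1
      let p ← stackBinT b B.shelves 0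
      let b' ← succT b
      let r ← stackBinsT l b'
      let q ← appendT p.1 r.1
      pure (q, ⟨b, p.2⟩ :: r.2)

/-- Fill the pieces into the shelf spaces one after the other, slicing vertically; the first space
has `room` left. Every slice gets the height of the shelf that it lies in. -/
def fillT {n : ℕ} : List (Piece n) → List Space → ℝ → Timed (List (Piece n))
  | [], _, _ => do tick 1; pure []
  | _ :: _, [], _ => do tick 1; pure []
  | a :: l, s :: ss, room => do
      tick 1
      let stay ← ltT a.wd room
      if stay then do
        let room' ← subT room a.wd
        let r ← fillT l (s :: ss) room'
        pure (⟨a.src, s.ht, a.wd⟩ :: r)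
      else do
        let rest ← subT a.wd room
        let sliced ← ltT 0 rest
        if sliced then
          match ss with
          | [] => pure [⟨a.src, s.ht, room⟩]
          | s' :: ss' => do
              let room' ← subT 1 rest
              let r ← fillT l (s' :: ss') room'
              pure (⟨a.src, s.ht, room⟩ :: ⟨a.src, s'.ht, rest⟩ :: r)
        else do
          let r ← fillT l ss 1
          pure (⟨a.src, s.ht, room⟩ :: r)

/-- Drop the spaces higher than `h` from the front. -/
def dropHigherT (h : ℝ) : List Space → Timed (List Space)
  | [] => do tick 1; pure []
  | s :: l => do
      tick 1
      let b ← ltT h s.ht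
      if b then dropHigherT h l else pure (s :: l)

/-- Put each shelf into a space of exactly its height, as long as there is one, and otherwise onto
the base of a new bin; `b` is the number of the next new bin. Both lists are sorted by decreasing
height. -/
def reuseT {n : ℕ} : List (TightShelf n) → List Space → ℕ → Timed (List (PlacedShelf n) × ℕ)
  | [], _, b => do tick 1; pure ([], b)
  | s :: l, sp, b => do
      tick 1
      let sp' ← dropHigherT s.rep.ht sp
      match sp' with
      | [] => do
          let b' ← succT b
          let r ← reuseT l [] b'
          pure (⟨s.rep, b, 0⟩ :: r.1, r.2)
      | t :: ts => do
          let c ← leT s.rep.ht t.ht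
          if c then do
            let r ← reuseT l ts b
            pure (⟨s.rep, t.bin, t.y⟩ :: r.1, r.2)
          else do
            let b' ← succT b
            let r ← reuseT l (t :: ts) b'
            pure (⟨s.rep, b, 0⟩ :: r.1, r.2)

/-- Drop the bins that have no room for height `h` from the front. -/
def dropFullT (h : ℝ) : List OpenBin → Timed (List OpenBin)
  | [] => do tick 1; pure []
  | o :: l => do
      tick 1
      let u ← addT o.top h
      let b ← leT u 1
      if b then pure (o :: l) else dropFullT h l

/-- Next-Fit: put the shelves into the open bins, and then into new bins; `b` is the number of the
next new bin. -/
def nextFitT {n : ℕ} :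
    List (TightShelf n) → List OpenBin → ℕ → Timed (List (PlacedShelf n) × ℕ)
  | [], _, b => do tick 1; pure ([], b)
  | s :: l, os, b => do
      tick 1
      let os' ← dropFullT s.rep.ht os
      match os' with
      | [] => do
          let b' ← succT b
          let r ← nextFitT l [⟨b, s.rep.ht⟩] b'
          pure (⟨s.rep, b, 0⟩ :: r.1, r.2)
      | o :: os'' => do
          let u ← addT o.top s.rep.ht
          let r ← nextFitT l (⟨o.bin, u⟩ :: os'') b
          pure (⟨s.rep, o.bin, o.top⟩ :: r.1, r.2)

/-! ### The final packing -/

/-- Drop the shelves of another base type from the front. -/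
def dropOtherTypeT {n : ℕ} (D : ℕ) (a : Piece n) :
    List (PlacedShelf n) → Timed (List (PlacedShelf n))
  | [] => do tick 1; pure []
  | s :: l => do
      tick 1
      let b ← sameTypeT D a s.rep
      if b then pure (s :: l) else dropOtherTypeT D a l

/-- Write down the placements that are given by coordinate lists. -/
def writeOutT {n : ℕ} (d b : ℕ) : List (Fin n × List ℝ) → Timed (List (Placement n d))
  | [] => do tick 1; pure []
  | p :: l => do
      tick (1 + d)
      let r ← writeOutT d b l
      pure (⟨p.1, b, fun j => p.2.getD j 0⟩ :: r)

/-- Pack the items of each canonical shelf into the next placed shelf of the same base type. -/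
def packShelvesT (k : ℕ) {n : ℕ} (d : ℕ) :
    List (TightShelf n) → List (PlacedShelf n) → Timed (List (Placement n d))
  | [], _ => do tick 1; pure []
  | s :: l, ps => do
      tick 1
      let ps' ← dropOtherTypeT (d - 1) s.rep ps
      match ps' with
      | [] => pure []
      | t :: ts => do
          let p ← unitPackT k (d - 2) s.items [t.y]
          let out ← writeOutT d t.bin p
          let r ← packShelvesT k d l ts
          appendT out r

/-- Every item in a bin of its own, numbered from `b` on. -/
def onePerBinT {n : ℕ} (d : ℕ) : List (Fin n) → ℕ → Timed (List (Placement n d))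
  | [], _ => do tick 1; pure []
  | i :: l, b => do
      tick (1 + d)
      let b' ← succT b
      let r ← onePerBinT d l b'
      pure (⟨i, b, fun _ => 0⟩ :: r)

/-- The algorithm `inflate`. Of the packing `P` it only reads the heights of the shelves in each
bin. -/
def inflate (k : ℕ) (δ : ℝ) {n d : ℕ} (I : Fin n → Fin d → ℝ) (P : FracPacking n) :
    Timed (Packing n d) := do
  -- If there are as many bins as items, one bin per item is good enough.
  let many ← longT P n
  if many then do
    let out ← onePerBinT d (List.finRange n) 0
    pure ⟨n, out⟩
  else do
    let m ← lengthT P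
    let items ← prepT k I (List.finRange n)
    let large ← filterT (fun a => ltT δ a.ht) items
    let small ← filterT (fun a => leT a.ht δ) items
    -- Separate the base types of the large items: repack the slices in the shelves of each height,
    -- one base type after the other.
    let st ← stackBinsT P 0
    let spaces ← sortT (fun s t => leT t.ht s.ht) st.1
    let large' ← sortT leHtT large
    let slices ← fillT large' spaces 1
    let slices' ← sortT (leTypeHtT (d - 1)) slices
    let shelvesL ← shelveT (sameTypeHtT (d - 1)) slices'
    let shelvesL' ← sortT (fun s t => leHtT s.rep t.rep) shelvesL
    let A ← reuseT shelvesL' spaces m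
    -- Forbid horizontal cuts: pack the small items into shelves, and these by Next-Fit.
    let small' ← sortT (leTypeHtT (d - 1)) small
    let shelvesS ← shelveT (sameTypeT (d - 1)) small'
    let B ← nextFitT shelvesS st.2 A.2
    -- Repack every base type by canonical shelving, and turn the shelves into `d`-dimensional ones.
    let placed ← appendT A.1 B.1
    let placed' ← sortT (fun s t => leTypeHtT (d - 1) s.rep t.rep) placed
    let items' ← sortT (leTypeHtT (d - 1)) items
    let shelves ← shelveT (sameTypeT (d - 1)) items'
    let out ← packShelvesT k d shelves placed'
    pure ⟨B.2, out⟩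

end

end HarmonicPacking

namespace HarmonicPacking

/-! ## Step counting -/

/-! Correctness rests on counting shelves by ceilings. If the pieces of one base type are shelved
greedily by decreasing height, then for every `h` the number of shelves of height at least `h` is
the total width of the pieces of height at least `h`, rounded up (`cnt_shelveT`). Hence two families
of shelves can be compared through widths alone. The packing `P` shows that the large rectangles of
height at least `h` are together no wider than the number of shelves of height at least `h`, since
these rectangles are cut only vertically (`FracPacking.IsShelfBased.sum_width_le`). So greedy
filling by decreasing height puts every slice into a shelf that is high enough (`wt_le_wt_fillT`).
Separating slices by base type and height, and shelving the small items, can only round widths up.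
As the ceiling is subadditive, for each base type and each `h` there are at least as many placed
shelves of height at least `h` as canonical ones (`cnt_allShelves_le`). Matching both by decreasing
height gives every canonical shelf a place (`packShelvesT_spec`).

A canonical shelf receives the items that lie in it whole or with their first slice. All of them but
the last have total width less than `1`, and this is just what HDH-unit-pack needs. The reason, by
induction on the dimension (`unitPackT_spec`), is that the heights of the stacked shelves add up to
at most `1` (`sum_maxLenT_le_one`). For a type `q < k` there are at most `q` shelves of height at
most `1/q`. For type `k`, the usual argument for decreasing heights bounds the stack by `1/k` plus
the weighted lengths of the items, and the factor `k/(k-2)` in `f_k` leaves room both for this `1/k`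
and for the last item.

For the number of bins, fix a shelf height with `c` shelves in `P`. The slices of this height have
total width at most `c`, and rounding up per base type gives fewer than `c + Q` shelves, thus at
most `Q - 1` new bins (`largePlaces_bins`). The small shelves have total height at most the area of
the small items plus `δ Q`, because each shelf except the first of its base type is paid for by the
full shelf before it (`sum_ht_shelveT`). Next-Fit leaves a bin only if it is filled to more than `1
- δ` (`nextFitT_bins`). If Next-Fit opens bins, compare with the area bound for `P`: shelf heights
plus small area are at most `|P|`. Then all bins of `P` together with the bins of Next-Fit number
less than `1 + (|P| + δ Q)/(1 - δ)`; adding the at most `t (Q - 1)` bins of the first stage gives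
the claim.

For the time, the early exit allows `|P| < n`, and each bin has at most `1/δ` shelves, so all lists
have length `O(n)` for fixed `δ`. Every stage is linear or a merge sort, with `O(d)` steps per
comparison; skipping in sorted lists is amortized, and HDH-unit-pack sorts each item at most once
per dimension. -/

@[simp] theorem Timed.val_bind {α β : Type} (x : Timed α) (f : α → Timed β) :
    (x >>= f).val = (f x.val).val := rfl

@[simp] theorem Timed.steps_bind {α β : Type} (x : Timed α) (f : α → Timed β) :
    (x >>= f).steps = x.steps + (f x.val).steps := rfl

@[simp] theorem Timed.val_pure {α : Type} (a : α) : (pure a : Timed α).val = a := rfl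

@[simp] theorem Timed.steps_pure {α : Type} (a : α) : (pure a : Timed α).steps = 0 := rfl

@[simp] theorem steps_tick (c : ℕ) : (tick c).steps = c := rfl

attribute [simp] addT subT mulT divT leT ltT ltNatT succT readT writeT

/-! ### Lists -/

@[simp] theorem val_lengthT {α : Type} (l : List α) : (lengthT l).val = l.length := by
  induction l with
  | nil => simp [lengthT]
  | cons a l ih => simp [lengthT, ih]

theorem steps_lengthT {α : Type} (l : List α) : (lengthT l).steps = 2 * l.length + 1 := by
  induction l with
  | nil => simp [lengthT]
  | cons a l ih => simp [lengthT, ih]; ring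

@[simp] theorem val_longT {α : Type} (l : List α) (m : ℕ) :
    (longT l m).val = decide (m ≤ l.length) := by
  induction l generalizing m with
  | nil => cases m <;> simp [longT]
  | cons a l ih => cases m <;> simp [longT, ih]

theorem steps_longT {α : Type} (l : List α) (m : ℕ) : (longT l m).steps ≤ m + 1 := by
  induction m generalizing l with
  | zero => cases l <;> simp [longT]
  | succ m ih =>
    cases l with
    | nil => simp [longT]
    | cons a l => have := ih l; simp [longT]; omega

@[simp] theorem val_appendT {α : Type} (l l' : List α) : (appendT l l').val = l ++ l' := by
  induction l with
  | nil => simp [appendT]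
  | cons a l ih => simp [appendT, ih]

theorem steps_appendT {α : Type} (l l' : List α) : (appendT l l').steps = l.length + 1 := by
  induction l with
  | nil => simp [appendT]
  | cons a l ih => simp [appendT, ih]; ring

@[simp] theorem val_filterT {α : Type} (test : α → Timed Bool) (l : List α) :
    (filterT test l).val = l.filter fun a => (test a).val := by
  induction l with
  | nil => simp [filterT]
  | cons a l ih => simp [filterT, ih, List.filter_cons]

theorem steps_filterT {α : Type} (test : α → Timed Bool) (K : ℕ) (hK : ∀ a, (test a).steps ≤ K)
    (l : List α) : (filterT test l).steps ≤ (K + 1) * l.length + 1 := by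
  induction l with
  | nil => simp [filterT]
  | cons a l ih => have := hK a; simp [filterT]; nlinarith

/-! ### Sorting -/

theorem val_mergeT {α : Type} (le : α → α → Timed Bool) (l l' : List α) :
    (mergeT le l l').val = l.merge l' fun a b => (le a b).val := by
  fun_induction mergeT le l l' with
  | case1 l' => simp
  | case2 a l => simp
  | case3 a l b l' ih1 ih2 =>
    by_cases h : (le a b).val = true <;> simp [h, ih1, ih2]

theorem steps_mergeT {α : Type} (le : α → α → Timed Bool) (K : ℕ)
    (hK : ∀ a b, (le a b).steps ≤ K) (l l' : List α) :
    (mergeT le l l').steps ≤ (K + 1) * (l.length + l'.length) + 1 := by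
  fun_induction mergeT le l l' with
  | case1 l' => simp
  | case2 a l => simp
  | case3 a l b l' ih1 ih2 =>
    have := hK a b
    by_cases h : (le a b).val = true <;> simp [h] at * <;> nlinarith

theorem val_sortFirstT {α : Type} (le : α → α → Timed Bool) (m : ℕ) (l : List α) :
    ((sortFirstT le m l).val.1).Perm (l.take m) ∧ (sortFirstT le m l).val.2 = l.drop m := by
  fun_induction sortFirstT le m l with
  | case1 l => simp
  | case2 => simp
  | case3 a l => simp
  | case4 m l ih1 ih2 =>
    obtain ⟨p1, d1⟩ := ih1
    obtain ⟨p2, d2⟩ := ih2 (sortFirstT le ((m + 2) / 2) l).val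
    have hm : (m + 2) / 2 + (m + 2 - (m + 2) / 2) = m + 2 := by omega
    rw [d1] at p2 d2
    constructor
    · simp only [Timed.val_bind, Timed.val_pure, val_mergeT]
      refine (List.merge_perm_append _).trans ?_
      rw [d1]
      rw [show m.succ.succ = _ from hm.symm, List.take_add]
      exact p1.append p2
    · simp only [Timed.val_bind, Timed.val_pure]
      rw [d1, d2, List.drop_drop, hm]

theorem pairwise_sortFirstT {α : Type} (le : α → α → Timed Bool)
    (htrans : ∀ a b c, (le a b).val = true → (le b c).val = true → (le a c).val = true)
    (htot : ∀ a b, ((le a b).val || (le b a).val) = true) (m : ℕ) (l : List α) :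
    ((sortFirstT le m l).val.1).Pairwise fun a b => (le a b).val = true := by
  fun_induction sortFirstT le m l with
  | case1 l => simp
  | case2 => simp
  | case3 a l => simp
  | case4 m l ih1 ih2 =>
    simp only [Timed.val_bind, Timed.val_pure, val_mergeT]
    exact List.pairwise_merge htrans htot _ _ ih1 (ih2 _)

/-- Each level of the recursion costs `K + 1` per entry for merging and a constant of `5`, which `3
(m + 2)` covers since at least two entries are sorted; hence the factor `K + 4`. -/
theorem steps_sortFirstT {α : Type} (le : α → α → Timed Bool) (K : ℕ)
    (hK : ∀ a b, (le a b).steps ≤ K) (m : ℕ) (l : List α) :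
    (sortFirstT le m l).steps ≤ (K + 4) * (m * Nat.clog 2 m) + 1 := by
  fun_induction sortFirstT le m l with
  | case1 l => simp
  | case2 => simp
  | case3 a l => simp
  | case4 m l ih1 ih2 =>
    have ih2 := ih2 (sortFirstT le ((m + 2) / 2) l).val
    simp only [Timed.steps_bind, Timed.steps_pure, steps_tick]
    have h3 := steps_mergeT le K hK (sortFirstT le ((m + 2) / 2) l).val.1
      (sortFirstT le (m + 2 - (m + 2) / 2) (sortFirstT le ((m + 2) / 2) l).val.2).val.1
    have l1 := (val_sortFirstT le ((m + 2) / 2) l).1.length_eq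
    have l2 := (val_sortFirstT le (m + 2 - (m + 2) / 2)
      (sortFirstT le ((m + 2) / 2) l).val.2).1.length_eq
    rw [l1, l2, List.length_take, List.length_take] at h3
    -- The larger half has `⌈(m + 2)/2⌉` entries, and its `clog` is exactly one less than that of `m
    -- + 2`. The smaller half is bounded by the same value.
    have e : Nat.clog 2 (m + 2) = Nat.clog 2 ((m + 2 + 2 - 1) / 2) + 1 :=
      Nat.clog_of_two_le (by norm_num) (by omega)
    have c1 : Nat.clog 2 ((m + 2) / 2) ≤ Nat.clog 2 ((m + 2 + 2 - 1) / 2) :=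
      Nat.clog_mono_right 2 (by omega)
    have c2 : Nat.clog 2 (m + 2 - (m + 2) / 2) ≤ Nat.clog 2 ((m + 2 + 2 - 1) / 2) :=
      Nat.clog_mono_right 2 (by omega)
    rw [e]
    generalize Nat.clog 2 ((m + 2 + 2 - 1) / 2) = c at *
    have i1 : (m + 2) / 2 * Nat.clog 2 ((m + 2) / 2) ≤ (m + 2) / 2 * c := Nat.mul_le_mul_left _ c1
    have i2 : (m + 2 - (m + 2) / 2) * Nat.clog 2 (m + 2 - (m + 2) / 2) ≤
      (m + 2 - (m + 2) / 2) * c := Nat.mul_le_mul_left _ c2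
    have i3 : (m + 2) / 2 * c + (m + 2 - (m + 2) / 2) * c = (m + 2) * c := by
      rw [← add_mul]; congr 1; omega
    have i4 := Nat.mul_le_mul_left (K + 4) (Nat.add_le_add i1 i2)
    rw [i3] at i4
    have i5 : (K + 1) * (min ((m + 2) / 2) l.length + min (m + 2 - (m + 2) / 2)
      (sortFirstT le ((m + 2) / 2) l).val.2.length) ≤ (K + 1) * (m + 2) :=
      Nat.mul_le_mul_left _ (by omega)
    nlinarith

theorem perm_sortT {α : Type} (le : α → α → Timed Bool) (l : List α) :
    (sortT le l).val.Perm l := by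
  have := (val_sortFirstT le l.length l).1
  simpa [sortT] using this

theorem pairwise_sortT {α : Type} (le : α → α → Timed Bool)
    (htrans : ∀ a b c, (le a b).val = true → (le b c).val = true → (le a c).val = true)
    (htot : ∀ a b, ((le a b).val || (le b a).val) = true) (l : List α) :
    ((sortT le l).val).Pairwise fun a b => (le a b).val = true := by
  have := pairwise_sortFirstT le htrans htot l.length l
  simpa [sortT] using this

theorem steps_sortT {α : Type} (le : α → α → Timed Bool) (K : ℕ)
    (hK : ∀ a b, (le a b).steps ≤ K) (l : List α) :
    (sortT le l).steps ≤ (K + 4) * (l.length * Nat.clog 2 l.length) + 2 * l.length + 2 := by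
  have := steps_sortFirstT le K hK l.length l
  simp [sortT, steps_lengthT]
  omega

/-! ### Comparing pieces -/

/-- The first `D` cells of an array, the last of these cells first. -/
def keyList (t : ℕ → ℕ) : ℕ → List ℕ
  | 0 => []
  | D + 1 => t D :: keyList t D

theorem keyList_eq_iff (a b : ℕ → ℕ) (D : ℕ) :
    keyList a D = keyList b D ↔ ∀ j < D, a j = b j := by
  induction D with
  | zero => simp [keyList]
  | succ D ih =>
    simp only [keyList, List.cons.injEq, ih]
    constructor
    · rintro ⟨h, h'⟩ j hj
      rcases Nat.lt_succ_iff_lt_or_eq.1 hj with h1 | rfl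
      · exact h' j h1
      · exact h
    · exact fun h => ⟨h D (by omega), fun j hj => h j (by omega)⟩

/-- The cells are read from the last to the first, so the comparison is the lexicographic order of
`keyList`. This makes the linear order on lists available for trichotomy and transitivity. -/
theorem val_cmpArrayT (a b : ℕ → ℕ) (D : ℕ) :
    (cmpArrayT a b D).val = if keyList a D < keyList b D then Ordering.lt
      else if keyList b D < keyList a D then Ordering.gt else Ordering.eq := by
  induction D with
  | zero => simp [cmpArrayT, keyList]
  | succ D ih =>
    rcases lt_trichotomy (a D) (b D) with h | h | h
    · simp [cmpArrayT, keyList, h, List.cons_lt_cons_iff]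
    · simp [cmpArrayT, keyList, h, ih]
    · simp [cmpArrayT, keyList, h, h.not_gt, h.ne', List.cons_lt_cons_iff]

theorem steps_cmpArrayT (a b : ℕ → ℕ) (D : ℕ) : (cmpArrayT a b D).steps ≤ 5 * D + 1 := by
  induction D with
  | zero => simp [cmpArrayT]
  | succ D ih =>
    simp only [cmpArrayT, Timed.steps_bind, steps_tick, readT, ltNatT]
    split_ifs <;> (try simp only [Timed.steps_pure]) <;> omega

/-- The base type of a piece. -/
def Piece.key {n : ℕ} (D : ℕ) (a : Piece n) : List ℕ := keyList a.src.typ D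

theorem val_sameTypeT {n : ℕ} (D : ℕ) (a b : Piece n) :
    (sameTypeT D a b).val = decide (a.key D = b.key D) := by
  simp only [sameTypeT, Timed.val_bind, Timed.val_pure, val_cmpArrayT, Piece.key]
  rcases lt_trichotomy (keyList a.src.typ D) (keyList b.src.typ D) with h | h | h
  · simp [h, h.ne]
  · simp [h]
  · simp [h, h.not_gt, h.ne']

theorem steps_sameTypeT {n : ℕ} (D : ℕ) (a b : Piece n) : (sameTypeT D a b).steps ≤ 5 * D + 1 := by
  simpa [sameTypeT] using steps_cmpArrayT a.src.typ b.src.typ D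

theorem val_sameTypeHtT {n : ℕ} (D : ℕ) (a b : Piece n) :
    (sameTypeHtT D a b).val = decide ((a.key D, a.ht) = (b.key D, b.ht)) := by
  simp only [sameTypeHtT, Timed.val_bind, Timed.val_pure, val_sameTypeT, leT]
  rw [Bool.eq_iff_iff]
  simp only [Bool.and_eq_true, decide_eq_true_eq, Prod.mk.injEq, le_antisymm_iff (a := a.ht),
    and_assoc]

theorem steps_sameTypeHtT {n : ℕ} (D : ℕ) (a b : Piece n) :
    (sameTypeHtT D a b).steps ≤ 5 * D + 3 := by
  have := steps_sameTypeT D a b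
  simp [sameTypeHtT]; omega

theorem val_leTypeHtT {n : ℕ} (D : ℕ) (a b : Piece n) :
    (leTypeHtT D a b).val = true ↔ a.key D < b.key D ∨ a.key D = b.key D ∧ b.ht ≤ a.ht := by
  simp only [leTypeHtT, Timed.val_bind, val_cmpArrayT, Piece.key]
  rcases lt_trichotomy (keyList a.src.typ D) (keyList b.src.typ D) with h | h | h
  · simp [h]
  · simp [h]
  · simp [h, h.not_gt, h.ne']

theorem steps_leTypeHtT {n : ℕ} (D : ℕ) (a b : Piece n) : (leTypeHtT D a b).steps ≤ 5 * D + 2 := by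
  have := steps_cmpArrayT a.src.typ b.src.typ D
  simp only [leTypeHtT, Timed.steps_bind]
  split <;> simp <;> omega

theorem leTypeHtT_trans {n : ℕ} (D : ℕ) (a b c : Piece n) (h : (leTypeHtT D a b).val = true)
    (h' : (leTypeHtT D b c).val = true) : (leTypeHtT D a c).val = true := by
  rw [val_leTypeHtT] at *
  rcases h with h | ⟨h, h1⟩ <;> rcases h' with h' | ⟨h', h1'⟩
  · exact Or.inl (h.trans h')
  · exact Or.inl (h' ▸ h)
  · exact Or.inl (h ▸ h')
  · exact Or.inr ⟨h.trans h', h1'.trans h1⟩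

theorem leTypeHtT_total {n : ℕ} (D : ℕ) (a b : Piece n) :
    ((leTypeHtT D a b).val || (leTypeHtT D b a).val) = true := by
  rw [Bool.or_eq_true, val_leTypeHtT, val_leTypeHtT]
  rcases lt_trichotomy (a.key D) (b.key D) with h | h | h
  · exact Or.inl (Or.inl h)
  · rcases le_total a.ht b.ht with h1 | h1
    · exact Or.inr (Or.inr ⟨h.symm, h1⟩)
    · exact Or.inl (Or.inr ⟨h, h1⟩)
  · exact Or.inr (Or.inl h)

/-- Sorted by base type, and then by decreasing height. -/
abbrev SortedTypeHt {n : ℕ} (D : ℕ) (l : List (Piece n)) : Prop :=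
  l.Pairwise fun a b => a.key D < b.key D ∨ a.key D = b.key D ∧ b.ht ≤ a.ht

theorem sortedTypeHt_sortT {n : ℕ} (D : ℕ) (l : List (Piece n)) :
    SortedTypeHt D (sortT (leTypeHtT D) l).val :=
  (pairwise_sortT _ (leTypeHtT_trans D) (leTypeHtT_total D) l).imp
    fun h => (val_leTypeHtT D _ _).1 h

theorem pairwise_sortT_desc {α : Type} (f : α → ℝ) (le : α → α → Timed Bool)
    (hle : ∀ a b, (le a b).val = decide (f b ≤ f a)) (l : List α) :
    (sortT le l).val.Pairwise fun a b => f b ≤ f a := by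
  refine (pairwise_sortT le ?_ ?_ l).imp fun {a b} h => ?_
  · simp only [hle, decide_eq_true_eq]
    exact fun a b c h h' => h'.trans h
  · simp only [hle, Bool.or_eq_true, decide_eq_true_eq]
    exact fun a b => le_total _ _
  · simpa [hle] using h

/-! ## Weights and counts -/

open Classical in
/-- The total of `f` over the entries with property `p`. -/
noncomputable def wt {α : Type} (f : α → ℝ) (p : α → Prop) (l : List α) : ℝ :=
  (l.map fun a => if p a then f a else 0).sum

open Classical in
/-- The number of entries with property `p`. -/
noncomputable def cnt {α : Type} (p : α → Prop) (l : List α) : ℕ :=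
  (l.map fun a => if p a then 1 else 0).sum

section Weights

variable {α β : Type} {f : α → ℝ} {p q : α → Prop} {l l' : List α} {a : α}

@[simp] theorem wt_nil : wt f p [] = 0 := by simp [wt]

@[simp] theorem cnt_nil : cnt p [] = 0 := by simp [cnt]

theorem wt_cons_pos (h : p a) : wt f p (a :: l) = f a + wt f p l := by simp [wt, h]

theorem wt_cons_neg (h : ¬ p a) : wt f p (a :: l) = wt f p l := by simp [wt, h]

theorem cnt_cons_pos (h : p a) : cnt p (a :: l) = 1 + cnt p l := by simp [cnt, h]

theorem cnt_cons_neg (h : ¬ p a) : cnt p (a :: l) = cnt p l := by simp [cnt, h]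

theorem wt_append : wt f p (l ++ l') = wt f p l + wt f p l' := by simp [wt]

theorem cnt_append : cnt p (l ++ l') = cnt p l + cnt p l' := by simp [cnt]

theorem wt_perm (h : l.Perm l') : wt f p l = wt f p l' := (h.map _).sum_eq

theorem cnt_perm (h : l.Perm l') : cnt p l = cnt p l' := (h.map _).sum_eq

theorem cnt_map (g : β → α) (l : List β) : cnt p (l.map g) = cnt (fun b => p (g b)) l := by
  simp [cnt, Function.comp_def]

theorem wt_nonneg (h : ∀ a ∈ l, 0 ≤ f a) : 0 ≤ wt f p l := by
  refine List.sum_nonneg fun x hx => ?_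
  obtain ⟨a, ha, rfl⟩ := List.mem_map.1 hx
  split_ifs
  exacts [h a ha, le_rfl]

theorem wt_eq_zero (h : ∀ a ∈ l, ¬ p a) : wt f p l = 0 := by
  refine List.sum_eq_zero fun x hx => ?_
  obtain ⟨a, ha, rfl⟩ := List.mem_map.1 hx
  simp [h a ha]

theorem cnt_eq_zero (h : ∀ a ∈ l, ¬ p a) : cnt p l = 0 := by
  refine List.sum_eq_zero fun x hx => ?_
  obtain ⟨a, ha, rfl⟩ := List.mem_map.1 hx
  simp [h a ha]

theorem exists_of_cnt_pos (h : 0 < cnt p l) : ∃ a ∈ l, p a := by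
  by_contra! hn
  exact h.ne' (cnt_eq_zero hn)

theorem wt_congr (h : ∀ a ∈ l, (p a ↔ q a)) : wt f p l = wt f q l := by
  unfold wt
  rw [List.map_congr_left fun a ha => ?_]
  by_cases hp : p a
  · rw [if_pos hp, if_pos ((h a ha).1 hp)]
  · rw [if_neg hp, if_neg fun hq => hp ((h a ha).2 hq)]

theorem cnt_congr (h : ∀ a ∈ l, (p a ↔ q a)) : cnt p l = cnt q l := by
  unfold cnt
  rw [List.map_congr_left fun a ha => ?_]
  by_cases hp : p a
  · rw [if_pos hp, if_pos ((h a ha).1 hp)]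
  · rw [if_neg hp, if_neg fun hq => hp ((h a ha).2 hq)]

theorem wt_true : wt f (fun _ => True) l = (l.map f).sum := by simp [wt]

theorem wt_filter (b : α → Bool) :
    wt f p (l.filter b) = wt f (fun a => b a = true ∧ p a) l := by
  induction l with
  | nil => simp
  | cons a l ih =>
    by_cases hb : b a = true
    · rw [List.filter_cons_of_pos hb]
      by_cases hp : p a
      · rw [wt_cons_pos hp, wt_cons_pos ⟨hb, hp⟩, ih]
      · rw [wt_cons_neg hp, wt_cons_neg (fun h => hp h.2), ih]
    · rw [List.filter_cons_of_neg hb, wt_cons_neg (fun h => hb h.1), ih]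

theorem wt_mono (h : ∀ a ∈ l, p a → q a) (hf : ∀ a ∈ l, 0 ≤ f a) : wt f p l ≤ wt f q l := by
  refine List.sum_le_sum fun a ha => ?_
  by_cases hp : p a
  · simp [hp, h a ha hp]
  · simp only [hp, if_false]
    split_ifs
    exacts [hf a ha, le_rfl]

end Weights

/-! ## Canonical shelving -/

section Shelving

variable {n : ℕ} {κ : Type} {key : Piece n → κ} {same : Piece n → Piece n → Timed Bool}
  {R : Piece n → Piece n → Prop}

/-- Shelving is analysed for any test `same` that decides equality of some `key`, because it is used
with two keys: the base type alone, and the base type together with the height. A new shelf starts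
when the key changes or no room is left. -/
theorem shelveFromT_new (hs : ∀ a b, (same a b).val = true ↔ key a = key b) {a prev : Piece n}
    {room : ℝ} (l : List (Piece n)) (h : ¬ (key prev = key a ∧ 0 < room)) :
    (shelveFromT same (a :: l) prev room).val =
      ([], ⟨a, a :: (shelveFromT same l a (1 - a.wd)).val.1⟩ ::
        (shelveFromT same l a (1 - a.wd)).val.2) := by
  rw [← hs] at h
  simp only [shelveFromT, Timed.val_bind, ltT]
  rw [if_neg (by simpa using h)]
  simp

theorem shelveFromT_fit (hs : ∀ a b, (same a b).val = true ↔ key a = key b) {a prev : Piece n}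
    {room : ℝ} (l : List (Piece n)) (h : key prev = key a ∧ 0 < room) (hw : a.wd ≤ room) :
    (shelveFromT same (a :: l) prev room).val =
      (a :: (shelveFromT same l a (room - a.wd)).val.1,
        (shelveFromT same l a (room - a.wd)).val.2) := by
  rw [← hs] at h
  simp [shelveFromT, h, hw]

theorem shelveFromT_cut (hs : ∀ a b, (same a b).val = true ↔ key a = key b) {a prev : Piece n}
    {room : ℝ} (l : List (Piece n)) (h : key prev = key a ∧ 0 < room) (hw : ¬ a.wd ≤ room) :
    (shelveFromT same (a :: l) prev room).val =
      ([a], ⟨a, (shelveFromT same l a (1 - (a.wd - room))).val.1⟩ ::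
        (shelveFromT same l a (1 - (a.wd - room))).val.2) := by
  rw [← hs] at h
  simp [shelveFromT, h, hw]

theorem shelveT_cons (a : Piece n) (l : List (Piece n)) :
    (shelveT same (a :: l)).val =
      ⟨a, a :: (shelveFromT same l a (1 - a.wd)).val.1⟩ ::
        (shelveFromT same l a (1 - a.wd)).val.2 := by
  simp [shelveT]

/-- What the steps of canonical shelving have in common. -/
theorem shelveFromT_induction (hs : ∀ a b, (same a b).val = true ↔ key a = key b)
    {motive : List (Piece n) → Piece n → ℝ → List (Piece n) × List (TightShelf n) → Prop}
    (nil : ∀ prev room, motive [] prev room ([], []))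
    (new : ∀ a l prev room r, ¬ (key prev = key a ∧ 0 < room) → motive l a (1 - a.wd) r →
      motive (a :: l) prev room ([], ⟨a, a :: r.1⟩ :: r.2))
    (fit : ∀ a l prev room r, key prev = key a → 0 < room → a.wd ≤ room →
      motive l a (room - a.wd) r → motive (a :: l) prev room (a :: r.1, r.2))
    (cut : ∀ a l prev room r, key prev = key a → 0 < room → room < a.wd →
      motive l a (1 - (a.wd - room)) r → motive (a :: l) prev room ([a], ⟨a, r.1⟩ :: r.2))
    (l : List (Piece n)) (prev : Piece n) (room : ℝ) :
    motive l prev room (shelveFromT same l prev room).val := by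
  induction l generalizing prev room with
  | nil => exact nil _ _
  | cons a l ih =>
    by_cases h : key prev = key a ∧ 0 < room
    · by_cases hw : a.wd ≤ room
      · rw [shelveFromT_fit hs l h hw]
        exact fit _ _ _ _ _ h.1 h.2 hw (ih _ _)
      · rw [shelveFromT_cut hs l h hw]
        exact cut _ _ _ _ _ h.1 h.2 (not_le.1 hw) (ih _ _)
    · rw [shelveFromT_new hs l h]
      exact new _ _ _ _ _ h (ih _ _)

/-- A cut piece is an item of the shelf with its first slice only. Its second slice becomes the
`rep` of the next shelf without entering `items`, so every piece is listed exactly once. -/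
theorem items_shelveT (hs : ∀ a b, (same a b).val = true ↔ key a = key b) (l : List (Piece n)) :
    (shelveT same l).val.flatMap TightShelf.items = l := by
  have H : ∀ (l : List (Piece n)) (prev : Piece n) (room : ℝ),
      (shelveFromT same l prev room).val.1 ++
        (shelveFromT same l prev room).val.2.flatMap TightShelf.items = l := by
    refine shelveFromT_induction
      (motive := fun l _ _ r => r.1 ++ r.2.flatMap TightShelf.items = l) hs ?_ ?_ ?_ ?_
    · simp
    · intro a l _ _ r _ ih
      simp [ih]
    · intro a l _ _ r _ _ _ ih
      simp [ih]
    · intro a l _ _ r _ _ _ ih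
      simp [ih]
  cases l with
  | nil => simp [shelveT]
  | cons a l => simp [shelveT_cons, H]

theorem length_shelveT (hs : ∀ a b, (same a b).val = true ↔ key a = key b) (l : List (Piece n)) :
    (shelveT same l).val.length ≤ l.length := by
  have H : ∀ (l : List (Piece n)) (prev : Piece n) (room : ℝ),
      (shelveFromT same l prev room).val.2.length ≤ l.length := by
    refine shelveFromT_induction
      (motive := fun l _ _ r => r.2.length ≤ l.length) hs ?_ ?_ ?_ ?_
    · simp
    · intro a l _ _ r _ ih
      simpa using ih
    · intro a l _ _ r _ _ _ ih
      simp; omega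
    · intro a l _ _ r _ _ _ ih
      simpa using ih
  cases l with
  | nil => simp [shelveT]
  | cons a l => simpa [shelveT_cons] using H l _ _

theorem rep_mem_shelveT (hs : ∀ a b, (same a b).val = true ↔ key a = key b) (l : List (Piece n)) :
    ∀ s ∈ (shelveT same l).val, s.rep ∈ l := by
  have H : ∀ (l : List (Piece n)) (prev : Piece n) (room : ℝ),
      ∀ s ∈ (shelveFromT same l prev room).val.2, s.rep ∈ l := by
    refine shelveFromT_induction
      (motive := fun l _ _ r => ∀ s ∈ r.2, s.rep ∈ l) hs ?_ ?_ ?_ ?_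
    · simp
    · intro a l _ _ r _ ih
      simpa using fun s hs => Or.inr (ih s hs)
    · intro a l _ _ r _ _ _ ih
      simpa using fun s hs => Or.inr (ih s hs)
    · intro a l _ _ r _ _ _ ih
      simpa using fun s hs => Or.inr (ih s hs)
  cases l with
  | nil => simp [shelveT]
  | cons a l => simpa [shelveT_cons] using fun s hs => Or.inr (H l _ _ s hs)

/-- The items of a tight shelf have the same key, are not higher than the shelf, and all but the
last of them have a total width of less than `1`. -/
structure TightShelf.Good (key : Piece n → κ) (s : TightShelf n) : Prop where
  key_eq : ∀ a ∈ s.items, key a = key s.rep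
  ht_le : ∀ a ∈ s.items, a.ht ≤ s.rep.ht
  width : (s.items.dropLast.map Piece.wd).sum < 1

theorem good_shelveT (hs : ∀ a b, (same a b).val = true ↔ key a = key b)
    (hht : ∀ a b, R a b → key a = key b → b.ht ≤ a.ht) (l : List (Piece n)) (hl : l.Pairwise R)
    (hw : ∀ a ∈ l, 0 < a.wd ∧ a.wd ≤ 1) :
    ∀ s ∈ (shelveT same l).val, s.Good key := by
  -- A further item enters the current shelf only while room is positive, so the further items
  -- before the last one have a total width of less than `room`. The last one may stick out, which
  -- is why `dropLast` appears.
  have H : ∀ (l : List (Piece n)) (prev : Piece n) (room : ℝ), (prev :: l).Pairwise R →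
      (∀ a ∈ l, 0 < a.wd ∧ a.wd ≤ 1) → room ≤ 1 →
      (∀ a ∈ (shelveFromT same l prev room).val.1, key a = key prev ∧ a.ht ≤ prev.ht) ∧
      ((shelveFromT same l prev room).val.1 = [] ∨
        (((shelveFromT same l prev room).val.1.dropLast.map Piece.wd).sum < room)) ∧
      ∀ s ∈ (shelveFromT same l prev room).val.2, s.Good key := by
    refine shelveFromT_induction
      (motive := fun l prev room r => (prev :: l).Pairwise R →
        (∀ a ∈ l, 0 < a.wd ∧ a.wd ≤ 1) → room ≤ 1 →
        (∀ a ∈ r.1, key a = key prev ∧ a.ht ≤ prev.ht) ∧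
        (r.1 = [] ∨ (r.1.dropLast.map Piece.wd).sum < room) ∧ ∀ s ∈ r.2, s.Good key) hs ?_ ?_ ?_ ?_
    · simp
    · intro a l prev room r _ ih hR hw _
      have ha := hw a (by simp)
      obtain ⟨h1, h2, h3⟩ := ih hR.of_cons (fun b hb => hw b (by simp [hb])) (by linarith)
      refine ⟨by simp, Or.inl rfl, ?_⟩
      simp only [List.mem_cons, forall_eq_or_imp]
      refine ⟨⟨?_, ?_, ?_⟩, h3⟩
      · simpa using fun b hb => (h1 b hb).1
      · simpa using fun b hb => (h1 b hb).2
      · rcases h2 with h2 | h2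
        · simp [h2]
        · rcases eq_or_ne r.1 [] with h4 | h4
          · simp [h4]
          · simp only [List.dropLast_cons_of_ne_nil h4, List.map_cons, List.sum_cons]
            linarith
    · intro a l prev room r hk hpos hfit ih hR hw hroom
      have ha := hw a (by simp)
      obtain ⟨h1, h2, h3⟩ := ih hR.of_cons (fun b hb => hw b (by simp [hb])) (by linarith)
      have hp := hht prev a (List.rel_of_pairwise_cons hR (by simp)) hk
      refine ⟨?_, Or.inr ?_, h3⟩
      · simp only [List.mem_cons, forall_eq_or_imp]
        exact ⟨⟨hk.symm, hp⟩, fun b hb => ⟨(h1 b hb).1.trans hk.symm, (h1 b hb).2.trans hp⟩⟩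
      · rcases eq_or_ne r.1 [] with h4 | h4
        · simpa [h4] using hpos
        · rcases h2 with h2 | h2
          · exact absurd h2 h4
          · simp only [List.dropLast_cons_of_ne_nil h4, List.map_cons, List.sum_cons]
            linarith
    · intro a l prev room r hk hpos hcut ih hR hw hroom
      have ha := hw a (by simp)
      obtain ⟨h1, h2, h3⟩ := ih hR.of_cons (fun b hb => hw b (by simp [hb])) (by linarith)
      have hp := hht prev a (List.rel_of_pairwise_cons hR (by simp)) hk
      refine ⟨by simpa using ⟨hk.symm, hp⟩, Or.inr (by simpa using hpos), ?_⟩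
      simp only [List.mem_cons, forall_eq_or_imp]
      refine ⟨⟨fun b hb => (h1 b hb).1, fun b hb => (h1 b hb).2, ?_⟩, h3⟩
      rcases h2 with h2 | h2
      · simp [h2]
      · linarith
  cases l with
  | nil => simp [shelveT]
  | cons a l =>
    have ha := hw a (by simp)
    obtain ⟨h1, h2, h3⟩ := H l a (1 - a.wd) hl (fun b hb => hw b (by simp [hb])) (by linarith)
    rw [shelveT_cons]
    simp only [List.mem_cons, forall_eq_or_imp]
    refine ⟨⟨?_, ?_, ?_⟩, h3⟩
    · simpa using fun b hb => (h1 b hb).1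
    · simpa using fun b hb => (h1 b hb).2
    · rcases eq_or_ne (shelveFromT same l a (1 - a.wd)).val.1 [] with h4 | h4
      · simp [h4]
      · rcases h2 with h2 | h2
        · exact absurd h2 h4
        · simp only [List.dropLast_cons_of_ne_nil h4, List.map_cons, List.sum_cons]
          linarith

/-- The representatives are entries of `l` in their original order, so any relation that holds along
`l` is inherited. -/
theorem pairwise_rep_shelveT (hs : ∀ a b, (same a b).val = true ↔ key a = key b)
    (l : List (Piece n)) (hl : l.Pairwise R) :
    (shelveT same l).val.Pairwise fun s t => R s.rep t.rep := by
  have H : ∀ (l : List (Piece n)) (prev : Piece n) (room : ℝ), l.Pairwise R →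
      ((shelveFromT same l prev room).val.2.Pairwise fun s t => R s.rep t.rep) ∧
      ∀ s ∈ (shelveFromT same l prev room).val.2, s.rep ∈ l := by
    refine shelveFromT_induction
      (motive := fun l _ _ r => l.Pairwise R →
        (r.2.Pairwise fun s t => R s.rep t.rep) ∧ ∀ s ∈ r.2, s.rep ∈ l) hs ?_ ?_ ?_ ?_
    · simp
    · intro a l _ _ r _ ih hR
      obtain ⟨h1, h2⟩ := ih hR.of_cons
      exact ⟨List.pairwise_cons.2 ⟨fun s hs => List.rel_of_pairwise_cons hR (h2 s hs), h1⟩,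
        by simpa using fun s hs => Or.inr (h2 s hs)⟩
    · intro a l _ _ r _ _ _ ih hR
      obtain ⟨h1, h2⟩ := ih hR.of_cons
      exact ⟨h1, by simpa using fun s hs => Or.inr (h2 s hs)⟩
    · intro a l _ _ r _ _ _ ih hR
      obtain ⟨h1, h2⟩ := ih hR.of_cons
      exact ⟨List.pairwise_cons.2 ⟨fun s hs => List.rel_of_pairwise_cons hR (h2 s hs), h1⟩,
        by simpa using fun s hs => Or.inr (h2 s hs)⟩
  cases l with
  | nil => simp [shelveT]
  | cons a l =>
    obtain ⟨h1, h2⟩ := H l a (1 - a.wd) hl.of_cons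
    rw [shelveT_cons]
    exact List.pairwise_cons.2 ⟨fun s hs => List.rel_of_pairwise_cons hl (h2 s hs), h1⟩

/-- This is the effect of opening one shelf. As `⌈·⌉₊` vanishes on negative numbers, it also covers
`x < 1`, where `y` is minus the room left. -/
theorem ceil_eq_one_add {x y : ℝ} (hx : 0 < x) (hy : y = x - 1) : ⌈x⌉₊ = 1 + ⌈y⌉₊ := by
  subst hy
  rcases le_total 0 (x - 1) with h | h
  · rw [add_comm, ← Nat.ceil_add_one h, sub_add_cancel]
  · rw [Nat.ceil_eq_zero.2 h, Nat.ceil_eq_iff (by norm_num)]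
    constructor <;> norm_num <;> linarith

open Classical in
/-- The number of shelves of one key that have at least a given height. -/
theorem cnt_shelveT (hs : ∀ a b, (same a b).val = true ↔ key a = key b)
    (hbet : ∀ a b c, R a b → R b c → key a = key c → key a = key b)
    (hht : ∀ a b, R a b → key a = key b → b.ht ≤ a.ht) (l : List (Piece n)) (hl : l.Pairwise R)
    (hw : ∀ a ∈ l, 0 < a.wd ∧ a.wd ≤ 1) (κ₀ : κ) (h : ℝ) :
    cnt (fun s : TightShelf n => key s.rep = κ₀ ∧ h ≤ s.rep.ht) (shelveT same l).val =
      ⌈wt Piece.wd (fun a => key a = κ₀ ∧ h ≤ a.ht) l⌉₊ := by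
  -- Once a piece with key `κ₀` is lower than `h`, all later ones with this key are too, and no
  -- further shelf counts.
  have Z : ∀ (a : Piece n) (l : List (Piece n)), (a :: l).Pairwise R → key a = κ₀ → ¬ h ≤ a.ht →
      wt Piece.wd (fun a => key a = κ₀ ∧ h ≤ a.ht) l = 0 := by
    intro a l hR hk hh
    refine wt_eq_zero fun b hb hp => hh (hp.2.trans ?_)
    exact hht a b (List.rel_of_pairwise_cons hR hb) (hk.trans hp.1.symm)
  have NN : ∀ l : List (Piece n), (∀ a ∈ l, 0 < a.wd ∧ a.wd ≤ 1) →
      0 ≤ wt Piece.wd (fun a => key a = κ₀ ∧ h ≤ a.ht) l :=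
    fun l hw => wt_nonneg fun b hb => (hw b hb).1.le
  -- The shelves still to be opened hold the remaining relevant width, less the room in the current
  -- shelf if that shelf has key `κ₀`.
  have H : ∀ (l : List (Piece n)) (prev : Piece n) (room : ℝ), (prev :: l).Pairwise R →
      (∀ a ∈ l, 0 < a.wd ∧ a.wd ≤ 1) → 0 ≤ room →
      cnt (fun s : TightShelf n => key s.rep = κ₀ ∧ h ≤ s.rep.ht)
        (shelveFromT same l prev room).val.2 =
          ⌈wt Piece.wd (fun a => key a = κ₀ ∧ h ≤ a.ht) l - if key prev = κ₀ then room else 0⌉₊ := by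
    refine shelveFromT_induction
      (motive := fun l prev room r => (prev :: l).Pairwise R →
        (∀ a ∈ l, 0 < a.wd ∧ a.wd ≤ 1) → 0 ≤ room →
        cnt (fun s : TightShelf n => key s.rep = κ₀ ∧ h ≤ s.rep.ht) r.2 =
          ⌈wt Piece.wd (fun a => key a = κ₀ ∧ h ≤ a.ht) l - if key prev = κ₀ then room else 0⌉₊)
      hs ?_ ?_ ?_ ?_
    · intro prev room _ _ hroom
      rw [cnt_nil, wt_nil, Nat.ceil_eq_zero.2]
      split_ifs <;> linarith
    · intro a l prev room r hn ih hR hw hroom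
      have ha := hw a (by simp)
      have ih := ih hR.of_cons (fun b hb => hw b (by simp [hb])) (by linarith)
      have nn := NN l fun b hb => hw b (by simp [hb])
      by_cases hka : key a = κ₀
      · have hroom0 : (if key prev = κ₀ then room else 0) = 0 := by
          split_ifs with hp
          · exact le_antisymm (not_lt.1 fun h0 => hn ⟨hp.trans hka.symm, h0⟩) hroom
          · rfl
        rw [if_pos hka] at ih
        rw [hroom0, sub_zero]
        by_cases hh : h ≤ a.ht
        · rw [cnt_cons_pos ⟨hka, hh⟩, wt_cons_pos ⟨hka, hh⟩, ih]
          exact (ceil_eq_one_add (by linarith) (by ring)).symm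
        · rw [cnt_cons_neg fun hc => hh hc.2, wt_cons_neg fun hc => hh hc.2, ih,
            Z a l hR.of_cons hka hh, Nat.ceil_zero, Nat.ceil_eq_zero]
          linarith
      · rw [if_neg hka] at ih
        rw [cnt_cons_neg fun hc => hka hc.1, wt_cons_neg fun hc => hka hc.1, ih]
        split_ifs with hp
        -- The run of `κ₀` has just ended at `a`, and by `hbet` this key does not return. The room
        -- left behind is wasted, but nothing needs it.
        · have hz : wt Piece.wd (fun a => key a = κ₀ ∧ h ≤ a.ht) l = 0 := by
            refine wt_eq_zero fun b hb hc => hka ?_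
            rw [← hbet prev a b (List.rel_of_pairwise_cons hR (by simp))
              (List.rel_of_pairwise_cons hR.of_cons hb) (hp.trans hc.1.symm), hp]
          rw [hz, sub_zero, Nat.ceil_zero, eq_comm, Nat.ceil_eq_zero]
          linarith
        · rfl
    · intro a l prev room r hk hpos hfit ih hR hw hroom
      have ih := ih hR.of_cons (fun b hb => hw b (by simp [hb])) (by linarith)
      rw [ih, hk]
      by_cases hka : key a = κ₀
      · rw [if_pos hka, if_pos hka]
        by_cases hh : h ≤ a.ht
        · rw [wt_cons_pos ⟨hka, hh⟩]
          congr 1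
          ring
        · rw [wt_cons_neg fun hc => hh hc.2, Z a l hR.of_cons hka hh,
            Nat.ceil_eq_zero.2 (by linarith), Nat.ceil_eq_zero.2 (by linarith)]
      · rw [if_neg hka, if_neg hka, wt_cons_neg fun hc => hka hc.1]
    · intro a l prev room r hk hpos hcut ih hR hw hroom
      have ha := hw a (by simp)
      have ih := ih hR.of_cons (fun b hb => hw b (by simp [hb])) (by linarith)
      have nn := NN l fun b hb => hw b (by simp [hb])
      rw [hk]
      by_cases hka : key a = κ₀
      · rw [if_pos hka] at ih ⊢
        by_cases hh : h ≤ a.ht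
        · rw [cnt_cons_pos ⟨hka, hh⟩, wt_cons_pos ⟨hka, hh⟩, ih]
          exact (ceil_eq_one_add (by linarith) (by ring)).symm
        · rw [cnt_cons_neg fun hc => hh hc.2, wt_cons_neg fun hc => hh hc.2, ih,
            Z a l hR.of_cons hka hh, Nat.ceil_eq_zero.2 (by linarith),
            Nat.ceil_eq_zero.2 (by linarith)]
      · rw [if_neg hka] at ih ⊢
        rw [cnt_cons_neg fun hc => hka hc.1, wt_cons_neg fun hc => hka hc.1, ih]
  cases l with
  | nil => simp [shelveT]
  | cons a l =>
    have ha := hw a (by simp)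
    have hH := H l a (1 - a.wd) hl (fun b hb => hw b (by simp [hb])) (by linarith)
    have nn := NN l fun b hb => hw b (by simp [hb])
    rw [shelveT_cons]
    by_cases hka : key a = κ₀
    · rw [if_pos hka] at hH
      by_cases hh : h ≤ a.ht
      · rw [cnt_cons_pos ⟨hka, hh⟩, wt_cons_pos ⟨hka, hh⟩, hH]
        exact (ceil_eq_one_add (by linarith) (by ring)).symm
      · rw [cnt_cons_neg fun hc => hh hc.2, wt_cons_neg fun hc => hh hc.2, hH,
          Z a l hl hka hh, Nat.ceil_zero, Nat.ceil_eq_zero]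
        linarith
    · rw [if_neg hka, sub_zero] at hH
      rw [cnt_cons_neg fun hc => hka hc.1, wt_cons_neg fun hc => hka hc.1, hH]

open Classical in
/-- The total height of the shelves. -/
theorem sum_ht_shelveT (hs : ∀ a b, (same a b).val = true ↔ key a = key b)
    (hbet : ∀ a b c, R a b → R b c → key a = key c → key a = key b)
    (hht : ∀ a b, R a b → key a = key b → b.ht ≤ a.ht) (l : List (Piece n)) (hl : l.Pairwise R)
    (hw : ∀ a ∈ l, 0 < a.wd ∧ a.wd ≤ 1) (δ : ℝ) (hδ : ∀ a ∈ l, 0 < a.ht ∧ a.ht ≤ δ) :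
    ((shelveT same l).val.map fun s => s.rep.ht).sum ≤
      (l.map fun a => a.wd * a.ht).sum + δ * (l.map key).toFinset.card := by
  -- Amortization: the filled part `1 - room` of the current shelf, counted at the height of its
  -- last piece, is credit for the next shelf of the same key. When that shelf opens, the current
  -- one is full and at least as high as the new one at its end. Each key not yet begun pays `δ` for
  -- its first shelf.
  have H : ∀ (l : List (Piece n)) (prev : Piece n) (room : ℝ), (prev :: l).Pairwise R →
      (∀ a ∈ l, 0 < a.wd ∧ a.wd ≤ 1) → (∀ a ∈ prev :: l, 0 < a.ht ∧ a.ht ≤ δ) → 0 ≤ room →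
      room ≤ 1 →
      ((shelveFromT same l prev room).val.2.map fun s => s.rep.ht).sum ≤
        (l.map fun a => a.wd * a.ht).sum + (1 - room) * prev.ht +
          δ * ((l.map key).toFinset.erase (key prev)).card := by
    refine shelveFromT_induction
      (motive := fun l prev room r => (prev :: l).Pairwise R →
      (∀ a ∈ l, 0 < a.wd ∧ a.wd ≤ 1) → (∀ a ∈ prev :: l, 0 < a.ht ∧ a.ht ≤ δ) → 0 ≤ room →
      room ≤ 1 →
      (r.2.map fun s => s.rep.ht).sum ≤
        (l.map fun a => a.wd * a.ht).sum + (1 - room) * prev.ht +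
          δ * ((l.map key).toFinset.erase (key prev)).card) hs ?_ ?_ ?_ ?_
    · intro prev room _ _ hδ h0 h1
      have := hδ prev (by simp)
      have : 0 ≤ (1 - room) * prev.ht := mul_nonneg (by linarith) this.1.le
      simpa using this
    · intro a l prev room r hn ih hR hw hδ h0 h1
      have ha := hw a (by simp)
      have da := hδ a (by simp)
      have dp := hδ prev (by simp)
      have ih := ih hR.of_cons (fun b hb => hw b (by simp [hb]))
        (fun b hb => hδ b (by simp at hb ⊢; tauto)) (by linarith) (by linarith)
      have hp := hht prev a (List.rel_of_pairwise_cons hR (by simp))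
      simp only [List.map_cons, List.sum_cons, List.toFinset_cons]
      by_cases hk : key prev = key a
      · have hroom : room = 0 := le_antisymm (not_lt.1 fun h0 => hn ⟨hk, h0⟩) h0
        have hp := hp hk
        rw [hk, Finset.erase_insert_eq_erase, hroom]
        linarith
      -- By `hbet` the key that is left does not return, so erasing it removes nothing, and the new
      -- key is counted once: its `δ` pays for the shelf opened here.
      · have hmem : key prev ∉ insert (key a) (l.map key).toFinset := by
          intro hm
          rcases Finset.mem_insert.1 hm with hm | hm
          · exact hk hm
          · obtain ⟨b, hb, hbk⟩ := List.mem_map.1 (List.mem_toFinset.1 hm)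
            exact hk (hbet prev a b (List.rel_of_pairwise_cons hR (by simp))
              (List.rel_of_pairwise_cons hR.of_cons hb) hbk.symm)
        rw [Finset.erase_eq_of_notMem hmem, 
          ← Finset.card_erase_add_one (Finset.mem_insert_self (key a) _),
          Finset.erase_insert_eq_erase]
        have : 0 ≤ (1 - room) * prev.ht := mul_nonneg (by linarith) dp.1.le
        push_cast
        linarith
    · intro a l prev room r hk hpos hfit ih hR hw hδ h0 h1
      have ha := hw a (by simp)
      have ih := ih hR.of_cons (fun b hb => hw b (by simp [hb]))
        (fun b hb => hδ b (by simp at hb ⊢; tauto)) (by linarith) (by linarith)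
      have hp := hht prev a (List.rel_of_pairwise_cons hR (by simp)) hk
      simp only [List.map_cons, List.sum_cons, List.toFinset_cons]
      rw [hk, Finset.erase_insert_eq_erase]
      have : (1 - room) * a.ht ≤ (1 - room) * prev.ht := mul_le_mul_of_nonneg_left hp (by linarith)
      linarith
    · intro a l prev room r hk hpos hcut ih hR hw hδ h0 h1
      have ha := hw a (by simp)
      have ih := ih hR.of_cons (fun b hb => hw b (by simp [hb]))
        (fun b hb => hδ b (by simp at hb ⊢; tauto)) (by linarith) (by linarith)
      have hp := hht prev a (List.rel_of_pairwise_cons hR (by simp)) hk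
      simp only [List.map_cons, List.sum_cons, List.toFinset_cons]
      rw [hk, Finset.erase_insert_eq_erase]
      have : (1 - room) * a.ht ≤ (1 - room) * prev.ht := mul_le_mul_of_nonneg_left hp (by linarith)
      linarith
  cases l with
  | nil => simp [shelveT]
  | cons a l =>
    have ha := hw a (by simp)
    have da := hδ a (by simp)
    have hH := H l a (1 - a.wd) hl (fun b hb => hw b (by simp [hb])) hδ (by linarith) (by linarith)
    rw [shelveT_cons]
    simp only [List.map_cons, List.sum_cons, List.toFinset_cons]
    rw [← Finset.card_erase_add_one (Finset.mem_insert_self (key a) _),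
          Finset.erase_insert_eq_erase]
    push_cast
    linarith

/-- Every slice pays for its steps. -/
theorem steps_shelveT (K : ℕ) (hK : ∀ a b, (same a b).steps ≤ K) (l : List (Piece n)) :
    (shelveT same l).steps ≤ (K + 5) * l.length + 2 := by
  have H : ∀ (l : List (Piece n)) (prev : Piece n) (room : ℝ),
      (shelveFromT same l prev room).steps ≤ (K + 5) * l.length + 1 := by
    intro l
    induction l with
    | nil => simp [shelveFromT]
    | cons a l ih =>
      intro prev room
      have hk := hK prev a
      simp only [shelveFromT, Timed.steps_bind, steps_tick, ltT, leT, subT, List.length_cons]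
      have h1 := ih a (room - a.wd)
      have h2 := ih a (1 - (a.wd - room))
      have h3 := ih a (1 - a.wd)
      by_cases hs : ((same prev a).val && decide (0 < room)) = true
      · by_cases hf : a.wd ≤ room
        · simp [hs, hf] at *; nlinarith
        · simp [hs, hf] at *; nlinarith
      · rw [if_neg hs]
        simp only [Timed.steps_bind, Timed.steps_pure]
        nlinarith
  cases l with
  | nil => simp [shelveT]
  | cons a l =>
    have := H l a (1 - a.wd)
    simp [shelveT]
    nlinarith

end Shelving

/-! ## Filling shelf spaces -/

section Fill

variable {n : ℕ}

theorem fillT_stay (a : Piece n) (l : List (Piece n)) (s : Space) (ss : List Space) {room : ℝ}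
    (h : a.wd < room) : (fillT (a :: l) (s :: ss) room).val =
      ⟨a.src, s.ht, a.wd⟩ :: (fillT l (s :: ss) (room - a.wd)).val := by
  simp [fillT, h]

theorem fillT_cut (a : Piece n) (l : List (Piece n)) (s s' : Space) (ss : List Space) {room : ℝ}
    (h : room < a.wd) : (fillT (a :: l) (s :: s' :: ss) room).val =
      ⟨a.src, s.ht, room⟩ :: ⟨a.src, s'.ht, a.wd - room⟩ ::
        (fillT l (s' :: ss) (1 - (a.wd - room))).val := by
  simp [fillT, h, h.not_gt]

theorem fillT_end (a : Piece n) (l : List (Piece n)) (s : Space) {room : ℝ}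
    (h : room < a.wd) : (fillT (a :: l) [s] room).val = [⟨a.src, s.ht, room⟩] := by
  simp [fillT, h, h.not_gt]

theorem fillT_exact (a : Piece n) (l : List (Piece n)) (s : Space) (ss : List Space) {room : ℝ}
    (h : a.wd = room) : (fillT (a :: l) (s :: ss) room).val =
      ⟨a.src, s.ht, room⟩ :: (fillT l ss 1).val := by
  simp [fillT, h]

theorem fillT_nil_right (l : List (Piece n)) (room : ℝ) : (fillT l [] room).val = [] := by
  cases l <;> simp [fillT]

/-- What the steps of filling have in common. -/
theorem fillT_induction {motive : List (Piece n) → List Space → ℝ → List (Piece n) → Prop}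
    (nil : ∀ sp room, motive [] sp room [])
    (full : ∀ l room, motive l [] room [])
    (stay : ∀ a l s ss room r, a.wd < room → motive l (s :: ss) (room - a.wd) r →
      motive (a :: l) (s :: ss) room (⟨a.src, s.ht, a.wd⟩ :: r))
    (cut : ∀ a l s s' ss room r, room < a.wd → motive l (s' :: ss) (1 - (a.wd - room)) r →
      motive (a :: l) (s :: s' :: ss) room
        (⟨a.src, s.ht, room⟩ :: ⟨a.src, s'.ht, a.wd - room⟩ :: r))
    (last : ∀ a l s room, room < a.wd → motive (a :: l) [s] room [⟨a.src, s.ht, room⟩])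
    (exactFit : ∀ a l s ss room r, a.wd = room → motive l ss 1 r →
      motive (a :: l) (s :: ss) room (⟨a.src, s.ht, room⟩ :: r))
    (l : List (Piece n)) (sp : List Space) (room : ℝ) :
    motive l sp room (fillT l sp room).val := by
  induction l generalizing sp room with
  | nil => simpa [fillT] using nil sp room
  | cons a l ih =>
    cases sp with
    | nil => rw [fillT_nil_right]; exact full _ _
    | cons s ss =>
      rcases lt_trichotomy a.wd room with h | h | h
      · rw [fillT_stay _ _ _ _ h]
        exact stay _ _ _ _ _ _ h (ih _ _)
      · rw [fillT_exact _ _ _ _ h]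
        exact exactFit _ _ _ _ _ _ h (ih _ _)
      · cases ss with
        | nil => rw [fillT_end _ _ _ h]; exact last _ _ _ _ h
        | cons s' ss =>
          rw [fillT_cut _ _ _ _ _ h]
          exact cut _ _ _ _ _ _ _ h (ih _ _)

open Classical in
/-- The width that is left in spaces of height at least `h`. -/
noncomputable def capacity : List Space → ℝ → ℝ → ℝ
  | [], _, _ => 0
  | s :: ss, room, h => (if h ≤ s.ht then room else 0) + cnt (fun s : Space => h ≤ s.ht) ss

theorem capacity_one (sp : List Space) (h : ℝ) :
    capacity sp 1 h = cnt (fun s : Space => h ≤ s.ht) sp := by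
  cases sp with
  | nil => simp [capacity]
  | cons s ss =>
    by_cases hs : h ≤ s.ht
    · simp [capacity, hs, cnt_cons_pos]
    · simp [capacity, hs, cnt_cons_neg]

/-- If there is enough space of every height, every piece gets slices at least as high. -/
theorem wt_le_wt_fillT (p : Prep n → Prop) (l : List (Piece n)) (sp : List Space) (room : ℝ)
    (hl : l.Pairwise fun a b => b.ht ≤ a.ht) (hw : ∀ a ∈ l, 0 < a.wd ∧ a.wd ≤ 1)
    (hsp : sp.Pairwise fun s t => t.ht ≤ s.ht) (h0 : 0 < room) (h1 : room ≤ 1)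
    (hcap : ∀ h, wt Piece.wd (fun a => h ≤ a.ht) l ≤ capacity sp room h) (h : ℝ) :
    wt Piece.wd (fun a => p a.src ∧ h ≤ a.ht) l ≤
      wt Piece.wd (fun a => p a.src ∧ h ≤ a.ht) (fillT l sp room).val := by
  revert hl hw hsp h0 h1 hcap h
  -- If the first space were lower than `a`, then so would be all spaces, as they are sorted. The
  -- capacity at height `a.ht` would be `0`, although `a` has positive width.
  have key : ∀ (a : Piece n) (l : List (Piece n)) (s : Space) (ss : List Space) (room : ℝ),
      (∀ b ∈ a :: l, 0 < b.wd ∧ b.wd ≤ 1) → (s :: ss).Pairwise (fun s t => t.ht ≤ s.ht) →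
      (∀ h, wt Piece.wd (fun a => h ≤ a.ht) (a :: l) ≤ capacity (s :: ss) room h) →
      a.ht ≤ s.ht := by
    intro a l s ss room hw hsp hcap
    by_contra hlt
    have hc := hcap a.ht
    have nn : 0 ≤ wt Piece.wd (fun b => a.ht ≤ b.ht) l :=
      wt_nonneg fun b hb => (hw b (by simp [hb])).1.le
    have hz : cnt (fun s : Space => a.ht ≤ s.ht) ss = 0 :=
      cnt_eq_zero fun t ht hh => hlt (hh.trans (List.rel_of_pairwise_cons hsp ht))
    rw [wt_cons_pos (by exact le_rfl), capacity, if_neg hlt, hz] at hc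
    have := (hw a (by simp)).1
    norm_num at hc
    linarith
  have zero : ∀ (a : Piece n) (l : List (Piece n)) (h : ℝ),
      (a :: l).Pairwise (fun a b => b.ht ≤ a.ht) → ¬ h ≤ a.ht →
      wt Piece.wd (fun a => h ≤ a.ht) l = 0 := by
    intro a l h hl hh
    exact wt_eq_zero fun b hb hb' => hh (hb'.trans (List.rel_of_pairwise_cons hl hb))
  refine fillT_induction (motive := fun l sp room r =>
    (l.Pairwise fun a b => b.ht ≤ a.ht) → (∀ a ∈ l, 0 < a.wd ∧ a.wd ≤ 1) →
    (sp.Pairwise fun s t => t.ht ≤ s.ht) → 0 < room → room ≤ 1 →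
    (∀ h, wt Piece.wd (fun a => h ≤ a.ht) l ≤ capacity sp room h) → ∀ h,
    wt Piece.wd (fun a => p a.src ∧ h ≤ a.ht) l ≤
      wt Piece.wd (fun a => p a.src ∧ h ≤ a.ht) r) ?_ ?_ ?_ ?_ ?_ ?_ l sp room
  · simp
  · intro l room hl hw hsp h0 h1 hcap h
    rw [wt_nil]
    exact (wt_mono (fun a _ ha => ha.2) fun a ha => (hw a ha).1.le).trans (hcap h)
  · intro a l s ss room r hlt ih hl hw hsp h0 h1 hcap h
    have ha := hw a (by simp)
    have has := key a l s ss room hw hsp hcap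
    have ih := ih hl.of_cons (fun b hb => hw b (by simp [hb])) hsp (by linarith) (by linarith) ?_ h
    · by_cases hp : p a.src ∧ h ≤ a.ht
      · rw [wt_cons_pos (by exact hp), wt_cons_pos ⟨hp.1, hp.2.trans has⟩]
        simpa using ih
      · rw [wt_cons_neg (by exact hp)]
        by_cases hp' : p a.src ∧ h ≤ s.ht
        · rw [wt_cons_pos (by exact hp')]
          simp only
          linarith
        · rwa [wt_cons_neg (by exact hp')]
    -- Up to height `a.ht`, demand and capacity both drop by `a.wd`. Above it the sorted rest has no
    -- demand. The same reasoning preserves the hypothesis in the other cases.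
    · intro h
      have hc := hcap h
      by_cases hh : h ≤ a.ht
      · rw [wt_cons_pos (by exact hh)] at hc
        simp only [capacity, if_pos (hh.trans has)] at hc ⊢
        linarith
      · rw [zero a l h hl hh]
        simp only [capacity]
        split_ifs <;> positivity
  · intro a l s s' ss room r hlt ih hl hw hsp h0 h1 hcap h
    have ha := hw a (by simp)
    have has := key a l s (s' :: ss) room hw hsp hcap
    -- The piece does not fit into the room of `s`, so capacity at height `a.ht` must come from
    -- another space, and `s'` is the highest of these.
    have has' : a.ht ≤ s'.ht := by
      by_contra hn
      have hc := hcap a.ht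
      have nn : 0 ≤ wt Piece.wd (fun b => a.ht ≤ b.ht) l :=
        wt_nonneg fun b hb => (hw b (by simp [hb])).1.le
      have hz : cnt (fun s : Space => a.ht ≤ s.ht) (s' :: ss) = 0 := by
        refine cnt_eq_zero fun t ht hh => hn (hh.trans ?_)
        rcases List.mem_cons.1 ht with rfl | ht
        · exact le_rfl
        · exact List.rel_of_pairwise_cons hsp.of_cons ht
      rw [wt_cons_pos (by exact le_rfl), capacity, if_pos has, hz] at hc
      norm_num at hc
      linarith
    have ih := ih hl.of_cons (fun b hb => hw b (by simp [hb])) hsp.of_cons (by linarith)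
      (by linarith) ?_ h
    · by_cases hp : p a.src ∧ h ≤ a.ht
      · rw [wt_cons_pos (by exact hp), wt_cons_pos ⟨hp.1, hp.2.trans has⟩,
          wt_cons_pos ⟨hp.1, hp.2.trans has'⟩]
        simp only
        linarith
      · rw [wt_cons_neg (by exact hp)]
        refine ih.trans ?_
        by_cases hp' : p a.src ∧ h ≤ s.ht
        · rw [wt_cons_pos (by exact hp')]
          by_cases hp2 : p a.src ∧ h ≤ s'.ht
          · rw [wt_cons_pos (by exact hp2)]
            simp only
            linarith
          · rw [wt_cons_neg (by exact hp2)]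
            simp only
            linarith
        · rw [wt_cons_neg (by exact hp')]
          by_cases hp2 : p a.src ∧ h ≤ s'.ht
          · rw [wt_cons_pos (by exact hp2)]
            simp only
            linarith
          · rw [wt_cons_neg (by exact hp2)]
    · intro h
      have hc := hcap h
      by_cases hh : h ≤ a.ht
      · rw [wt_cons_pos (by exact hh)] at hc
        simp only [capacity, if_pos (hh.trans has), cnt_cons_pos (p := fun s : Space => h ≤ s.ht) (l := ss)
          (a := s') (hh.trans has')] at hc
        simp only [capacity, if_pos (hh.trans has')]
        push_cast at hc
        linarith
      · rw [zero a l h hl hh]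
        simp only [capacity]
        have : 0 ≤ 1 - (a.wd - room) := by linarith
        split_ifs <;> positivity
  · intro a l s room hlt hl hw hsp h0 h1 hcap h
    -- Only the last space is left and `a` is wider than its room, which contradicts the capacity at
    -- height `a.ht`.
    exfalso
    have hc := hcap a.ht
    have nn : 0 ≤ wt Piece.wd (fun b => a.ht ≤ b.ht) l :=
      wt_nonneg fun b hb => (hw b (by simp [hb])).1.le
    rw [wt_cons_pos (by exact le_rfl), capacity, if_pos (key a l s [] room hw hsp hcap)] at hc
    simp at hc
    linarith
  · intro a l s ss room r heq ih hl hw hsp h0 h1 hcap h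
    have ha := hw a (by simp)
    have has := key a l s ss room hw hsp hcap
    have ih := ih hl.of_cons (fun b hb => hw b (by simp [hb])) hsp.of_cons (by linarith)
      (by linarith) ?_ h
    · by_cases hp : p a.src ∧ h ≤ a.ht
      · rw [wt_cons_pos (by exact hp), wt_cons_pos ⟨hp.1, hp.2.trans has⟩]
        simp only
        linarith
      · rw [wt_cons_neg (by exact hp)]
        by_cases hp' : p a.src ∧ h ≤ s.ht
        · rw [wt_cons_pos (by exact hp')]
          simp only
          linarith
        · rwa [wt_cons_neg (by exact hp')]
    · intro h
      rw [capacity_one]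
      have hc := hcap h
      by_cases hh : h ≤ a.ht
      · rw [wt_cons_pos (by exact hh)] at hc
        simp only [capacity, if_pos (hh.trans has)] at hc
        linarith
      · rw [zero a l h hl hh]
        positivity

/-- The slices of a height fit into the spaces of this height. -/
theorem wt_fillT_le (l : List (Piece n)) (sp : List Space) (h : ℝ)
    (hw : ∀ a ∈ l, 0 < a.wd ∧ a.wd ≤ 1) :
    wt Piece.wd (fun a => a.ht = h) (fillT l sp 1).val ≤ cnt (fun s : Space => s.ht = h) sp := by
  -- The second statement strengthens the first for the induction: if the first space has height
  -- `h`, its used part `1 - room` fits in addition.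
  have H : ∀ (l : List (Piece n)) (sp : List Space) (room : ℝ),
      (∀ a ∈ l, 0 < a.wd ∧ a.wd ≤ 1) → 0 < room → room ≤ 1 →
      (wt Piece.wd (fun a => a.ht = h) (fillT l sp room).val ≤ cnt (fun s : Space => s.ht = h) sp) ∧
      ∀ s ss, sp = s :: ss → s.ht = h →
      wt Piece.wd (fun a => a.ht = h) (fillT l sp room).val + (1 - room) ≤
        cnt (fun s : Space => s.ht = h) sp := by
    refine fillT_induction (motive := fun l sp room r => (∀ a ∈ l, 0 < a.wd ∧ a.wd ≤ 1) →
      0 < room → room ≤ 1 →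
      (wt Piece.wd (fun a => a.ht = h) r ≤ cnt (fun s : Space => s.ht = h) sp) ∧
      ∀ s ss, sp = s :: ss → s.ht = h →
      wt Piece.wd (fun a => a.ht = h) r + (1 - room) ≤
        cnt (fun s : Space => s.ht = h) sp) ?_ ?_ ?_ ?_ ?_ ?_
    · intro sp room _ h0 h1
      refine ⟨by simp, ?_⟩
      rintro s ss rfl hs
      rw [cnt_cons_pos (by exact hs), wt_nil]
      push_cast
      have : (0 : ℝ) ≤ cnt (fun s : Space => s.ht = h) ss := by positivity
      linarith
    · intro l room _ _ _
      simp
    · intro a l s ss room r hlt ih hw h0 h1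
      have ha := hw a (by simp)
      obtain ⟨i1, i2⟩ := ih (fun b hb => hw b (by simp [hb])) (by linarith) (by linarith)
      by_cases hs : s.ht = h
      · have i2 := i2 s ss rfl hs
        have : wt Piece.wd (fun a => a.ht = h) (⟨a.src, s.ht, a.wd⟩ :: r) + (1 - room) ≤
            cnt (fun s : Space => s.ht = h) (s :: ss) := by
          rw [wt_cons_pos (by exact hs)]
          simp only
          linarith
        refine ⟨by linarith, ?_⟩
        rintro s' ss' he -
        exact this
      · rw [wt_cons_neg (by exact hs)]
        refine ⟨i1, ?_⟩
        rintro s' ss' he hs'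
        cases he
        exact absurd hs' hs
    · intro a l s s' ss room r hlt ih hw h0 h1
      have ha := hw a (by simp)
      obtain ⟨i1, i2⟩ := ih (fun b hb => hw b (by simp [hb])) (by linarith) (by linarith)
      have i3 : wt Piece.wd (fun a => a.ht = h) (⟨a.src, s'.ht, a.wd - room⟩ :: r) ≤
          cnt (fun s : Space => s.ht = h) (s' :: ss) := by
        by_cases hs : s'.ht = h
        · have i2 := i2 s' ss rfl hs
          rw [wt_cons_pos (by exact hs)]
          simp only
          linarith
        · rwa [wt_cons_neg (by exact hs)]
      by_cases hs : s.ht = h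
      · rw [wt_cons_pos (by exact hs), cnt_cons_pos (by exact hs)]
        push_cast
        refine ⟨by linarith, fun _ _ _ _ => by linarith⟩
      · rw [wt_cons_neg (by exact hs), cnt_cons_neg (by exact hs)]
        refine ⟨i3, ?_⟩
        rintro s' ss' he hs'
        cases he
        exact absurd hs' hs
    · intro a l s room hlt hw h0 h1
      by_cases hs : s.ht = h
      · rw [wt_cons_pos (by exact hs), cnt_cons_pos (by exact hs)]
        simpa using h1
      · rw [wt_cons_neg (by exact hs), cnt_cons_neg (by exact hs)]
        simp [hs]
    · intro a l s ss room r heq ih hw h0 h1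
      obtain ⟨i1, -⟩ := ih (fun b hb => hw b (by simp [hb])) (by linarith) (by linarith)
      by_cases hs : s.ht = h
      · rw [wt_cons_pos (by exact hs), cnt_cons_pos (by exact hs)]
        push_cast
        refine ⟨by linarith, fun _ _ _ _ => by linarith⟩
      · rw [wt_cons_neg (by exact hs), cnt_cons_neg (by exact hs)]
        refine ⟨i1, ?_⟩
        rintro s' ss' he hs'
        cases he
        exact absurd hs' hs
  exact (H l sp 1 hw one_pos le_rfl).1

/-- Pieces are at most as wide as a space, so each is cut at most once; hence the factor `2`. -/
theorem mem_fillT (l : List (Piece n)) (sp : List Space) (room : ℝ)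
    (hw : ∀ a ∈ l, 0 < a.wd ∧ a.wd ≤ 1) (h0 : 0 < room) (h1 : room ≤ 1) :
    (∀ b ∈ (fillT l sp room).val, (0 < b.wd ∧ b.wd ≤ 1) ∧ (∃ a ∈ l, a.src = b.src) ∧
      ∃ s ∈ sp, s.ht = b.ht) ∧ (fillT l sp room).val.length ≤ 2 * l.length := by
  revert hw h0 h1
  refine fillT_induction (motive := fun l sp room r => (∀ a ∈ l, 0 < a.wd ∧ a.wd ≤ 1) →
    0 < room → room ≤ 1 → (∀ b ∈ r, (0 < b.wd ∧ b.wd ≤ 1) ∧ (∃ a ∈ l, a.src = b.src) ∧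
      ∃ s ∈ sp, s.ht = b.ht) ∧ r.length ≤ 2 * l.length) ?_ ?_ ?_ ?_ ?_ ?_ l sp room
  · simp
  · simp
  · intro a l s ss room r hlt ih hw h0 h1
    have ha := hw a (by simp)
    obtain ⟨i1, i2⟩ := ih (fun b hb => hw b (by simp [hb])) (by linarith) (by linarith)
    refine ⟨?_, by simp; omega⟩
    simp only [List.mem_cons, forall_eq_or_imp]
    refine ⟨⟨ha, ⟨a, by simp⟩, s, by simp⟩, fun b hb => ?_⟩
    obtain ⟨j1, ⟨c, hc, j2⟩, t, ht, j3⟩ := i1 b hb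
    exact ⟨j1, ⟨c, by simp [hc], j2⟩, t, by simpa using ht, j3⟩
  · intro a l s s' ss room r hlt ih hw h0 h1
    have ha := hw a (by simp)
    obtain ⟨i1, i2⟩ := ih (fun b hb => hw b (by simp [hb])) (by linarith) (by linarith)
    refine ⟨?_, by simp; omega⟩
    simp only [List.mem_cons, forall_eq_or_imp]
    refine ⟨⟨⟨h0, h1⟩, ⟨a, by simp⟩, s, by simp⟩,
      ⟨⟨by linarith, by linarith⟩, ⟨a, by simp⟩, s', by simp⟩, fun b hb => ?_⟩
    obtain ⟨j1, ⟨c, hc, j2⟩, t, ht, j3⟩ := i1 b hb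
    exact ⟨j1, ⟨c, by simp [hc], j2⟩, t, Or.inr (by simpa using ht), j3⟩
  · intro a l s room hlt hw h0 h1
    refine ⟨?_, by simp; omega⟩
    simp only [List.mem_singleton, forall_eq]
    exact ⟨⟨h0, h1⟩, ⟨a, by simp⟩, s, rfl, rfl⟩
  · intro a l s ss room r heq ih hw h0 h1
    obtain ⟨i1, i2⟩ := ih (fun b hb => hw b (by simp [hb])) (by linarith) (by linarith)
    refine ⟨?_, by simp; omega⟩
    simp only [List.mem_cons, forall_eq_or_imp]
    refine ⟨⟨⟨h0, h1⟩, ⟨a, by simp⟩, s, by simp⟩, fun b hb => ?_⟩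
    obtain ⟨j1, ⟨c, hc, j2⟩, t, ht, j3⟩ := i1 b hb
    exact ⟨j1, ⟨c, by simp [hc], j2⟩, t, Or.inr ht, j3⟩

theorem steps_fillT (l : List (Piece n)) (sp : List Space) (room : ℝ) :
    (fillT l sp room).steps ≤ 5 * l.length + 1 := by
  induction l generalizing sp room with
  | nil => simp [fillT]
  | cons a l ih =>
    cases sp with
    | nil => simp [fillT]
    | cons s ss =>
      by_cases h : a.wd < room
      · have := ih (s :: ss) (room - a.wd)
        simp [fillT, h]; omega
      · by_cases h' : room < a.wd
        · cases ss with
          | nil => simp [fillT, h, h']; omega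
          | cons s' ss =>
            have := ih (s' :: ss) (1 - (a.wd - room))
            simp [fillT, h, h']; omega
        · have := ih ss 1
          simp [fillT, h, h']; omega

end Fill

/-! ## Places for shelves -/

section Places

variable {n : ℕ}

/-- Two spaces do not overlap. -/
def Space.Sep (s t : Space) : Prop := s.bin = t.bin → s.y + s.ht ≤ t.y ∨ t.y + t.ht ≤ s.y

/-- The space that a placed shelf takes. -/
def PlacedShelf.space (p : PlacedShelf n) : Space := ⟨p.bin, p.y, p.rep.ht⟩

/-! ### Pushing shelves down and skipping used places -/

theorem stackBinT_spec (b : ℕ) (l : List (Shelf n)) (y : ℝ) (hl : ∀ s ∈ l, 0 ≤ s.ht) :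
    (stackBinT b l y).val.1.map Space.ht = l.map Shelf.ht ∧
    (stackBinT b l y).val.2 = y + (l.map Shelf.ht).sum ∧
    (∀ s ∈ (stackBinT b l y).val.1, s.bin = b ∧ y ≤ s.y ∧
      s.y + s.ht ≤ (stackBinT b l y).val.2) ∧
    (stackBinT b l y).val.1.Pairwise Space.Sep := by
  induction l generalizing y with
  | nil => simp [stackBinT]
  | cons s l ih =>
    have hs := hl s (by simp)
    obtain ⟨h1, h2, h3, h4⟩ := ih (y + s.ht) fun t ht => hl t (by simp [ht])
    have h5 : 0 ≤ (l.map Shelf.ht).sum := List.sum_nonneg fun x hx => by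
      obtain ⟨t, ht, rfl⟩ := List.mem_map.1 hx
      exact hl t (by simp [ht])
    simp only [stackBinT, Timed.val_bind, Timed.val_pure, addT, List.map_cons, List.sum_cons,
      List.mem_cons, forall_eq_or_imp, List.pairwise_cons]
    refine ⟨by rw [h1], by rw [h2]; ring, ⟨⟨trivial, le_rfl, by rw [h2]; linarith⟩, fun t ht => ?_⟩,
      fun t ht _ => Or.inl (h3 t ht).2.1, h4⟩
    exact ⟨(h3 t ht).1, by linarith [(h3 t ht).2.1], (h3 t ht).2.2⟩

theorem steps_stackBinT (b : ℕ) (l : List (Shelf n)) (y : ℝ) :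
    (stackBinT b l y).steps = 2 * l.length + 1 := by
  induction l generalizing y with
  | nil => simp [stackBinT]
  | cons s l ih => simp [stackBinT, ih]; ring

theorem stackBinsT_spec (l : List (Bin n)) (b : ℕ) (hl : ∀ B ∈ l, ∀ s ∈ B.shelves, 0 ≤ s.ht) :
    (stackBinsT l b).val.1.map Space.ht = (l.flatMap Bin.shelves).map Shelf.ht ∧
    (stackBinsT l b).val.2.map OpenBin.top = l.map (fun B => (B.shelves.map Shelf.ht).sum) ∧
    (stackBinsT l b).val.2.map OpenBin.bin = List.range' b l.length ∧
    (∀ s ∈ (stackBinsT l b).val.1, ∃ o ∈ (stackBinsT l b).val.2, o.bin = s.bin ∧ 0 ≤ s.y ∧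
      s.y + s.ht ≤ o.top) ∧
    (stackBinsT l b).val.1.Pairwise Space.Sep := by
  induction l generalizing b with
  | nil => simp [stackBinsT]
  | cons B l ih =>
    obtain ⟨h1, h2, h3, h4, h5⟩ := ih (b + 1) fun C hC => hl C (by simp [hC])
    obtain ⟨i1, i2, i3, i4⟩ := stackBinT_spec b B.shelves 0 (hl B (by simp))
    simp only [stackBinsT, Timed.val_bind, Timed.val_pure, succT, val_appendT, List.map_append,
      List.map_cons, List.flatMap_cons, List.mem_append, List.length_cons, List.range'_succ]
    refine ⟨by rw [h1, i1], by rw [h2, i2, zero_add], by rw [h3], ?_, ?_⟩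
    · rintro s (hs | hs)
      · exact ⟨_, List.mem_cons_self, (i3 s hs).1.symm, (i3 s hs).2⟩
      · obtain ⟨o, ho, ho'⟩ := h4 s hs
        exact ⟨o, List.mem_cons_of_mem _ ho, ho'⟩
    · refine List.pairwise_append.2 ⟨i4, h5, fun s hs t ht hst => ?_⟩
      exfalso
      obtain ⟨o, ho, hob, -⟩ := h4 t ht
      have : o.bin ∈ List.range' (b + 1) l.length := h3 ▸ List.mem_map_of_mem ho
      rw [List.mem_range'_1] at this
      have := (i3 s hs).1
      omega

theorem steps_stackBinsT (l : List (Bin n)) (b : ℕ) :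
    (stackBinsT l b).steps ≤ 4 * l.length + 3 * (l.flatMap Bin.shelves).length + 1 := by
  induction l generalizing b with
  | nil => simp [stackBinsT]
  | cons B l ih =>
    have h1 := ih (b + 1)
    have h2 : (stackBinT b B.shelves 0).val.1.length = B.shelves.length := by
      have H : ∀ (l : List (Shelf n)) (y : ℝ), (stackBinT b l y).val.1.length = l.length := by
        intro l
        induction l with
        | nil => simp [stackBinT]
        | cons s l ih => intro y; simp [stackBinT, ih]
      exact H _ _
    simp only [stackBinsT, Timed.steps_bind, steps_tick, succT, steps_appendT, Timed.steps_pure,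
      steps_stackBinT, h2, List.length_cons, List.flatMap_cons, List.length_append]
    omega

/-- The dropped prefix `pre` is exposed because it pays for the steps: what is dropped is never seen
again, so repeated calls take linear time altogether. `dropFullT_spec` and `dropOtherTypeT_spec`
have this form for the same reason. -/
theorem dropHigherT_spec (h : ℝ) (l : List Space) :
    ∃ pre, l = pre ++ (dropHigherT h l).val ∧ (∀ s ∈ pre, h < s.ht) ∧
      (∀ t r, (dropHigherT h l).val = t :: r → t.ht ≤ h) ∧
      (dropHigherT h l).steps ≤ 2 * pre.length + 2 := by
  induction l with
  | nil => exact ⟨[], by simp [dropHigherT]⟩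
  | cons s l ih =>
    by_cases hs : h < s.ht
    · obtain ⟨pre, h1, h2, h3, h4⟩ := ih
      refine ⟨s :: pre, ?_, ?_, ?_, ?_⟩
      · simpa [dropHigherT, hs] using h1
      · simpa [hs] using h2
      · simpa [dropHigherT, hs] using h3
      · simp [dropHigherT, hs]; omega
    · refine ⟨[], ?_, ?_, ?_, ?_⟩
      · simp [dropHigherT, hs]
      · simp
      · simpa [dropHigherT, hs] using not_lt.1 hs
      · simp [dropHigherT, hs]

theorem dropFullT_spec (h : ℝ) (l : List OpenBin) :
    ∃ pre, l = pre ++ (dropFullT h l).val ∧ (∀ o ∈ pre, 1 < o.top + h) ∧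
      (∀ o r, (dropFullT h l).val = o :: r → o.top + h ≤ 1) ∧
      (dropFullT h l).steps ≤ 3 * pre.length + 3 := by
  induction l with
  | nil => exact ⟨[], by simp [dropFullT]⟩
  | cons s l ih =>
    by_cases hs : s.top + h ≤ 1
    · refine ⟨[], ?_, ?_, ?_, ?_⟩
      · simp [dropFullT, hs]
      · simp
      · simp [dropFullT, hs]
      · simp [dropFullT, hs]
    · obtain ⟨pre, h1, h2, h3, h4⟩ := ih
      refine ⟨s :: pre, ?_, ?_, ?_, ?_⟩
      · simpa [dropFullT, hs] using h1
      · simpa [not_le.1 hs] using h2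
      · simpa [dropFullT, hs] using h3
      · simp [dropFullT, hs]; omega

/-! ### Reusing the spaces of equal height -/

theorem reuseT_nil (s : TightShelf n) (l : List (TightShelf n)) (sp : List Space) (b : ℕ)
    (h : (dropHigherT s.rep.ht sp).val = []) :
    (reuseT (s :: l) sp b).val =
      (⟨s.rep, b, 0⟩ :: (reuseT l [] (b + 1)).val.1, (reuseT l [] (b + 1)).val.2) := by
  simp [reuseT, h]

theorem reuseT_eq (s : TightShelf n) (l : List (TightShelf n)) (sp : List Space) (b : ℕ)
    (t : Space) (ts : List Space) (h : (dropHigherT s.rep.ht sp).val = t :: ts)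
    (ht : s.rep.ht ≤ t.ht) :
    (reuseT (s :: l) sp b).val =
      (⟨s.rep, t.bin, t.y⟩ :: (reuseT l ts b).val.1, (reuseT l ts b).val.2) := by
  simp [reuseT, h, ht]

theorem reuseT_lt (s : TightShelf n) (l : List (TightShelf n)) (sp : List Space) (b : ℕ)
    (t : Space) (ts : List Space) (h : (dropHigherT s.rep.ht sp).val = t :: ts)
    (ht : ¬ s.rep.ht ≤ t.ht) :
    (reuseT (s :: l) sp b).val =
      (⟨s.rep, b, 0⟩ :: (reuseT l (t :: ts) (b + 1)).val.1,
        (reuseT l (t :: ts) (b + 1)).val.2) := by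
  simp [reuseT, h, ht]

theorem rep_reuseT (l : List (TightShelf n)) (sp : List Space) (b : ℕ) :
    (reuseT l sp b).val.1.map PlacedShelf.rep = l.map TightShelf.rep := by
  induction l generalizing sp b with
  | nil => simp [reuseT]
  | cons s l ih =>
    cases h : (dropHigherT s.rep.ht sp).val with
    | nil => simp [reuseT_nil s l sp b h, ih]
    | cons t ts =>
      by_cases ht : s.rep.ht ≤ t.ht
      · simp [reuseT_eq s l sp b t ts h ht, ih]
      · simp [reuseT_lt s l sp b t ts h ht, ih]

/-- A reused place has exactly the height of its new shelf, so the new shelf occupies one of the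
given separated spaces, and each space is consumed at most once. All other shelves get bins of their
own. -/
theorem reuseT_places (l : List (TightShelf n)) (sp : List Space) (b : ℕ)
    (hsp : sp.Pairwise Space.Sep) (hb : ∀ s ∈ sp, s.bin < b) :
    b ≤ (reuseT l sp b).val.2 ∧
    (∀ p ∈ (reuseT l sp b).val.1, p.space ∈ sp ∨
      (b ≤ p.bin ∧ p.bin < (reuseT l sp b).val.2 ∧ p.y = 0)) ∧
    (reuseT l sp b).val.1.Pairwise fun p q => p.space.Sep q.space := by
  induction l generalizing sp b with
  | nil => simp [reuseT]
  | cons s l ih =>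
    obtain ⟨pre, h1, h2, h3, -⟩ := dropHigherT_spec s.rep.ht sp
    have new : ∀ sp', (dropHigherT s.rep.ht sp).val = sp' →
        (reuseT (s :: l) sp b).val =
        (⟨s.rep, b, 0⟩ :: (reuseT l sp' (b + 1)).val.1, (reuseT l sp' (b + 1)).val.2) →
        b ≤ (reuseT (s :: l) sp b).val.2 ∧
        (∀ p ∈ (reuseT (s :: l) sp b).val.1, p.space ∈ sp ∨
          (b ≤ p.bin ∧ p.bin < (reuseT (s :: l) sp b).val.2 ∧ p.y = 0)) ∧
        (reuseT (s :: l) sp b).val.1.Pairwise fun p q => p.space.Sep q.space := by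
      intro sp' h e
      rw [h] at h1
      obtain ⟨i1, i2, i3⟩ := ih sp' (b + 1)
        ((List.pairwise_append.1 (h1 ▸ hsp)).2.1)
        (fun t ht => Nat.lt_succ_of_lt (hb t (by rw [h1]; simp [ht])))
      rw [e]
      simp only [List.mem_cons, forall_eq_or_imp, List.pairwise_cons]
      refine ⟨by omega, ⟨Or.inr ⟨le_rfl, by omega, trivial⟩, fun p hp => ?_⟩, fun p hp hpb => ?_, i3⟩
      · rcases i2 p hp with h | h
        · exact Or.inl (by rw [h1]; simp [h])
        · exact Or.inr ⟨by omega, h.2⟩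
      · exfalso
        simp only [PlacedShelf.space] at hpb
        rcases i2 p hp with h | h
        · have := hb _ (by rw [h1]; exact List.mem_append_right _ h)
          simp only [PlacedShelf.space] at this
          omega
        · omega
    cases h : (dropHigherT s.rep.ht sp).val with
    | nil => exact new _ h (reuseT_nil s l sp b h)
    | cons t ts =>
      by_cases ht : s.rep.ht ≤ t.ht
      · have hte : s.rep.ht = t.ht := le_antisymm ht (h3 t ts h)
        rw [h] at h1
        have hp := (List.pairwise_append.1 (h1 ▸ hsp)).2.1
        obtain ⟨i1, i2, i3⟩ := ih ts b hp.of_cons (fun t ht => hb t (by rw [h1]; simp [ht]))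
        rw [reuseT_eq s l sp b t ts h ht]
        have hst : (⟨s.rep, t.bin, t.y⟩ : PlacedShelf n).space = t := by
          simp [PlacedShelf.space, hte]
        simp only [List.mem_cons, forall_eq_or_imp, List.pairwise_cons]
        refine ⟨i1, ⟨Or.inl ?_, fun p hp => ?_⟩, fun p hp' => ?_, i3⟩
        · rw [hst, h1]
          simp
        · rcases i2 p hp with h | h
          · exact Or.inl (by rw [h1]; simp [h])
          · exact Or.inr h
        · rw [hst]
          rcases i2 p hp' with h | h
          · exact List.rel_of_pairwise_cons hp h
          · intro hpb
            exfalso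
            have := hb t (by rw [h1]; simp)
            simp only [PlacedShelf.space] at hpb
            omega
      · exact new _ h (reuseT_lt s l sp b t ts h ht)

/-- The number of new bins is at most the excess of shelves over spaces of the same height. -/
theorem reuseT_bins (l : List (TightShelf n)) (sp : List Space) (b : ℕ) (T : Finset ℝ)
    (hT : ∀ s ∈ l, s.rep.ht ∈ T) (hl : l.Pairwise fun s t => t.rep.ht ≤ s.rep.ht)
    (hsp : sp.Pairwise fun s t => t.ht ≤ s.ht) :
    (reuseT l sp b).val.2 ≤ b + ∑ h ∈ T, (cnt (fun s : TightShelf n => s.rep.ht = h) l -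
      cnt (fun s : Space => s.ht = h) sp) := by
  induction l generalizing sp b with
  | nil => simp [reuseT]
  | cons s l ih =>
    obtain ⟨pre, h1, h2, h3, -⟩ := dropHigherT_spec s.rep.ht sp
    have hle : ∀ t ∈ s :: l, t.rep.ht ≤ s.rep.ht := by
      simp only [List.mem_cons, forall_eq_or_imp, le_refl, true_and]
      exact fun t ht => List.rel_of_pairwise_cons hl ht
    have hsp' : ((dropHigherT s.rep.ht sp).val).Pairwise fun s t => t.ht ≤ s.ht :=
      (List.pairwise_append.1 (h1 ▸ hsp)).2.1
    -- The dropped spaces are higher than every shelf still to be placed. At such heights there are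
    -- no shelves, so the truncated difference is `0` on both sides.
    have e : ∑ h ∈ T, (cnt (fun s : TightShelf n => s.rep.ht = h) (s :: l) -
        cnt (fun s : Space => s.ht = h) sp) =
        ∑ h ∈ T, (cnt (fun s : TightShelf n => s.rep.ht = h) (s :: l) -
        cnt (fun s : Space => s.ht = h) (dropHigherT s.rep.ht sp).val) := by
      refine Finset.sum_congr rfl fun h _ => ?_
      by_cases hh : h ≤ s.rep.ht
      · conv_lhs => rw [h1]
        rw [cnt_append, cnt_eq_zero (l := pre) fun t ht hth => ?_, zero_add]
        exact absurd (h2 t ht) (by rw [hth]; exact not_lt.2 hh)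
      · rw [cnt_eq_zero (l := s :: l) fun t ht hth => hh (le_of_eq_of_le (Eq.symm hth) (hle t ht))]
        simp
    rw [e]
    have hsT := hT s (by simp)
    have other : ∀ h ∈ T.erase s.rep.ht,
        cnt (fun s : TightShelf n => s.rep.ht = h) (s :: l) =
          cnt (fun s : TightShelf n => s.rep.ht = h) l :=
      fun h hh => cnt_cons_neg fun hc => (Finset.mem_erase.1 hh).1 hc.symm
    -- With no space of this height left, the shelf is an excess shelf; its new bin is the `1` by
    -- which the term for its height decreases.
    have new : cnt (fun t : Space => t.ht = s.rep.ht) (dropHigherT s.rep.ht sp).val = 0 →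
        (∑ h ∈ T, (cnt (fun s : TightShelf n => s.rep.ht = h) (s :: l) -
        cnt (fun s : Space => s.ht = h) (dropHigherT s.rep.ht sp).val)) =
        1 + ∑ h ∈ T, (cnt (fun s : TightShelf n => s.rep.ht = h) l -
        cnt (fun s : Space => s.ht = h) (dropHigherT s.rep.ht sp).val) := by
      intro hz
      rw [← Finset.add_sum_erase _ _ hsT, ← Finset.add_sum_erase _ _ hsT,
        cnt_cons_pos (by rfl), hz, Finset.sum_congr rfl fun h hh => by rw [other h hh]]
      omega
    cases h : (dropHigherT s.rep.ht sp).val with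
    | nil =>
      have := ih [] (b + 1) (fun t ht => hT t (by simp [ht])) hl.of_cons List.Pairwise.nil
      rw [reuseT_nil s l sp b h]
      rw [h] at new
      rw [new (by simp)]
      simp only
      omega
    | cons t ts =>
      rw [h] at hsp' new
      by_cases ht : s.rep.ht ≤ t.ht
      · have hte : s.rep.ht = t.ht := le_antisymm ht (h3 t ts h)
        have := ih ts b (fun t ht => hT t (by simp [ht])) hl.of_cons hsp'.of_cons
        rw [reuseT_eq s l sp b t ts h ht]
        refine this.trans (le_of_eq ?_)
        congr 1
        refine Finset.sum_congr rfl fun x hx => ?_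
        by_cases hxs : s.rep.ht = x
        · rw [cnt_cons_pos (by exact hxs), cnt_cons_pos (by exact hte ▸ hxs)]
          omega
        · rw [cnt_cons_neg (by exact hxs), cnt_cons_neg (by exact hte ▸ hxs)]
      · have := ih (t :: ts) (b + 1) (fun t ht => hT t (by simp [ht])) hl.of_cons hsp'
        rw [reuseT_lt s l sp b t ts h ht]
        rw [new (cnt_eq_zero fun u hu hue => ht ?_)]
        · simp only
          omega
        · rw [← hue]
          rcases List.mem_cons.1 hu with rfl | hu
          · exact le_rfl
          · exact List.rel_of_pairwise_cons hsp' hu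

theorem steps_reuseT (l : List (TightShelf n)) (sp : List Space) (b : ℕ) :
    (reuseT l sp b).steps ≤ 5 * l.length + 2 * sp.length + 1 := by
  induction l generalizing sp b with
  | nil => simp [reuseT]
  | cons s l ih =>
    obtain ⟨pre, h1, -, -, h4⟩ := dropHigherT_spec s.rep.ht sp
    have h5 := congrArg List.length h1
    rw [List.length_append] at h5
    cases h : (dropHigherT s.rep.ht sp).val with
    | nil =>
      have := ih [] (b + 1)
      simp [reuseT, h] at *
      omega
    | cons t ts =>
      have i1 := ih ts b
      have i2 := ih (t :: ts) (b + 1)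
      by_cases ht : s.rep.ht ≤ t.ht
      · simp [reuseT, h, ht] at *
        omega
      · simp [reuseT, h, ht] at *
        omega

/-! ### Next-Fit -/

theorem nextFitT_nil (s : TightShelf n) (l : List (TightShelf n)) (os : List OpenBin) (b : ℕ)
    (h : (dropFullT s.rep.ht os).val = []) :
    (nextFitT (s :: l) os b).val =
      (⟨s.rep, b, 0⟩ :: (nextFitT l [⟨b, s.rep.ht⟩] (b + 1)).val.1,
        (nextFitT l [⟨b, s.rep.ht⟩] (b + 1)).val.2) := by
  simp [nextFitT, h]

theorem nextFitT_cons (s : TightShelf n) (l : List (TightShelf n)) (os : List OpenBin) (b : ℕ)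
    (o : OpenBin) (os' : List OpenBin) (h : (dropFullT s.rep.ht os).val = o :: os') :
    (nextFitT (s :: l) os b).val =
      (⟨s.rep, o.bin, o.top⟩ :: (nextFitT l (⟨o.bin, o.top + s.rep.ht⟩ :: os') b).val.1,
        (nextFitT l (⟨o.bin, o.top + s.rep.ht⟩ :: os') b).val.2) := by
  simp [nextFitT, h]

theorem rep_nextFitT (l : List (TightShelf n)) (os : List OpenBin) (b : ℕ) :
    (nextFitT l os b).val.1.map PlacedShelf.rep = l.map TightShelf.rep := by
  induction l generalizing os b with
  | nil => simp [nextFitT]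
  | cons s l ih =>
    cases h : (dropFullT s.rep.ht os).val with
    | nil => simp [nextFitT_nil s l os b h, ih]
    | cons o os' => simp [nextFitT_cons s l os b o os' h, ih]

/-- Later shelves of an open bin lie at or above its `top`. Applied to the updated bin, whose `top`
is the upper edge of the shelf just placed, this separates that shelf from all later ones in its
bin. Distinct bin numbers are needed to identify the bin. -/
theorem nextFitT_places (l : List (TightShelf n)) (os : List OpenBin) (b : ℕ)
    (hl : ∀ s ∈ l, 0 ≤ s.rep.ht ∧ s.rep.ht ≤ 1)
    (hos : os.Pairwise fun o o' => o.bin ≠ o'.bin) (hb : ∀ o ∈ os, o.bin < b) :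
    b ≤ (nextFitT l os b).val.2 ∧
    (∀ p ∈ (nextFitT l os b).val.1, ((∃ o ∈ os, o.bin = p.bin ∧ o.top ≤ p.y) ∨
      (b ≤ p.bin ∧ p.bin < (nextFitT l os b).val.2 ∧ 0 ≤ p.y)) ∧ p.y + p.rep.ht ≤ 1) ∧
    (nextFitT l os b).val.1.Pairwise fun p q => p.space.Sep q.space := by
  induction l generalizing os b with
  | nil => simp [nextFitT]
  | cons s l ih =>
    have hs := hl s (by simp)
    obtain ⟨pre, h1, h2, h3, -⟩ := dropFullT_spec s.rep.ht os
    cases h : (dropFullT s.rep.ht os).val with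
    | nil =>
      obtain ⟨i1, i2, i3⟩ := ih [⟨b, s.rep.ht⟩] (b + 1) (fun t ht => hl t (by simp [ht]))
        (by simp) (by simp)
      rw [nextFitT_nil s l os b h]
      simp only [List.mem_cons, forall_eq_or_imp, List.pairwise_cons]
      refine ⟨by omega, ⟨⟨Or.inr ⟨le_rfl, by omega, le_rfl⟩, by simpa using hs.2⟩, fun p hp => ?_⟩,
        fun p hp hpb => Or.inl ?_, i3⟩
      · obtain ⟨h | h, h'⟩ := i2 p hp
        · obtain ⟨o, ho, hob, hoy⟩ := h
          rw [List.mem_singleton.1 ho] at hob hoy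
          simp only at hob hoy
          exact ⟨Or.inr ⟨by omega, by omega, hs.1.trans hoy⟩, h'⟩
        · exact ⟨Or.inr ⟨by omega, h.2⟩, h'⟩
      · simp only [PlacedShelf.space] at hpb ⊢
        obtain ⟨h | h, h'⟩ := i2 p hp
        · obtain ⟨o, ho, hob, hoy⟩ := h
          rw [List.mem_singleton.1 ho] at hob hoy
          simp only at hob hoy
          linarith
        · omega
    | cons o os' =>
      rw [h] at h1
      have hpw := (List.pairwise_append.1 (h1 ▸ hos)).2.1
      have hob : o.bin < b := hb o (by rw [h1]; simp)
      obtain ⟨i1, i2, i3⟩ := ih (⟨o.bin, o.top + s.rep.ht⟩ :: os') b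
        (fun t ht => hl t (by simp [ht]))
        (List.pairwise_cons.2 ⟨fun o' ho' => List.rel_of_pairwise_cons hpw ho', hpw.of_cons⟩)
        (by
          simp only [List.mem_cons, forall_eq_or_imp]
          exact ⟨hob, fun o' ho' => hb o' (by rw [h1]; simp [ho'])⟩)
      rw [nextFitT_cons s l os b o os' h]
      simp only [List.mem_cons, forall_eq_or_imp, List.pairwise_cons]
      refine ⟨i1, ⟨⟨Or.inl ⟨o, by rw [h1]; simp, rfl, le_rfl⟩, h3 o os' h⟩, fun p hp => ?_⟩,
        fun p hp hpb => Or.inl ?_, i3⟩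
      · obtain ⟨h | h, h'⟩ := i2 p hp
        · obtain ⟨o', ho, hob, hoy⟩ := h
          rcases List.mem_cons.1 ho with rfl | ho
          · exact ⟨Or.inl ⟨o, by rw [h1]; simp, hob, by simp only at hoy; linarith⟩, h'⟩
          · exact ⟨Or.inl ⟨o', by rw [h1]; simp [ho], hob, hoy⟩, h'⟩
        · exact ⟨Or.inr h, h'⟩
      · simp only [PlacedShelf.space] at hpb ⊢
        obtain ⟨h | h, h'⟩ := i2 p hp
        · obtain ⟨o', ho, hob, hoy⟩ := h
          rcases List.mem_cons.1 ho with rfl | ho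
          · exact hoy
          · exact absurd (hpb.trans hob.symm) (List.rel_of_pairwise_cons hpw ho)
        · omega

/-- All bins but the last one are filled to more than `1 - δ`. -/
theorem nextFitT_bins (l : List (TightShelf n)) (os : List OpenBin) (b : ℕ) (δ : ℝ)
    (hl : ∀ s ∈ l, 0 < s.rep.ht ∧ s.rep.ht ≤ δ) :
    (nextFitT l os b).val.2 = b ∨
    ((os.length : ℝ) + (nextFitT l os b).val.2 - b - 1) * (1 - δ) <
      (os.map OpenBin.top).sum + (l.map fun s => s.rep.ht).sum := by
  induction l generalizing os b with
  | nil => simp [nextFitT]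
  | cons s l ih =>
    have hs := hl s (by simp)
    obtain ⟨pre, h1, h2, h3, -⟩ := dropFullT_spec s.rep.ht os
    -- A bin is skipped only if a shelf of height at most `δ` would exceed height `1` in it.
    have hpre : (pre.length : ℝ) * (1 - δ) ≤ (pre.map OpenBin.top).sum := by
      have := List.card_nsmul_le_sum (pre.map OpenBin.top) (1 - δ) fun x hx => by
        obtain ⟨o, ho, rfl⟩ := List.mem_map.1 hx
        linarith [h2 o ho]
      simpa using this
    have hnn : 0 ≤ (l.map fun s => s.rep.ht).sum := List.sum_nonneg fun x hx => by
      obtain ⟨t, ht, rfl⟩ := List.mem_map.1 hx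
      exact (hl t (by simp [ht])).1.le
    cases h : (dropFullT s.rep.ht os).val with
    | nil =>
      rw [h, List.append_nil] at h1
      rw [nextFitT_nil s l os b h, h1]
      right
      rcases ih [⟨b, s.rep.ht⟩] (b + 1) (fun t ht => hl t (by simp [ht])) with i | i
      -- This is the last new bin, and it is the one discounted by `- 1`. Strictness comes from the
      -- positive height of the shelf that opens it.
      · rw [i]
        simp only [List.map_cons, List.sum_cons]
        push_cast
        linarith
      · simp only [List.map_cons, List.sum_cons, List.length_singleton, List.map_nil,
          List.sum_nil] at i ⊢
        push_cast at i
        linarith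
    | cons o os' =>
      rw [h] at h1
      rw [nextFitT_cons s l os b o os' h]
      rcases ih (⟨o.bin, o.top + s.rep.ht⟩ :: os') b (fun t ht => hl t (by simp [ht])) with i | i
      · exact Or.inl i
      · right
        rw [h1]
        simp only [List.map_cons, List.sum_cons, List.length_cons, List.map_append,
          List.sum_append, List.length_append] at i ⊢
        push_cast at i ⊢
        linarith

theorem steps_nextFitT (l : List (TightShelf n)) (os : List OpenBin) (b : ℕ) :
    (nextFitT l os b).steps ≤ 8 * l.length + 3 * os.length + 1 := by
  induction l generalizing os b with
  | nil => simp [nextFitT]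
  | cons s l ih =>
    obtain ⟨pre, h1, -, -, h4⟩ := dropFullT_spec s.rep.ht os
    have h5 := congrArg List.length h1
    rw [List.length_append] at h5
    cases h : (dropFullT s.rep.ht os).val with
    | nil =>
      have := ih [⟨b, s.rep.ht⟩] (b + 1)
      simp [nextFitT, h] at *
      omega
    | cons o os' =>
      have := ih (⟨o.bin, o.top + s.rep.ht⟩ :: os') b
      simp [nextFitT, h] at *
      omega

end Places

/-! ## Preparing the items -/

section Prepare

variable {k : ℕ}

/-- The search keeps the invariant `x ≤ 1 / q`. If it stops early, then `1 / (q + 1) < x ≤ 1 / q`,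
so `⌊1 / x⌋ = q`; if it runs out of values, `q = k`. -/
theorem typeSearchT_spec (x : ℝ) (hx : 0 < x) (r q : ℕ) (hq : 1 ≤ q) (hqr : q + r = k)
    (hxq : x ≤ 1 / (q : ℝ)) : (typeSearchT x r q).val = typeK k x := by
  induction r generalizing q with
  | zero =>
    have : q = k := by omega
    subst this
    simp [typeSearchT, typeK] at hxq ⊢
    simp [hxq]
  | succ r ih =>
    by_cases h : 1 / ((q + 1 : ℕ) : ℝ) < x
    · have hk : ¬ x ≤ 1 / (k : ℝ) := by
        refine not_le.2 (lt_of_le_of_lt ?_ h)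
        have : ((q + 1 : ℕ) : ℝ) ≤ k := by exact_mod_cast (by omega : q + 1 ≤ k)
        exact one_div_le_one_div_of_le (by positivity) this
      have hv : (typeSearchT x (r + 1) q).val = q := by
        push_cast at h
        simp only [typeSearchT, Timed.val_bind, succT, divT, ltT]
        rw [if_pos (by simpa using h)]
        simp
      rw [hv, typeK, if_neg hk, eq_comm, Nat.floor_eq_iff (by positivity)]
      have hq0 : (0 : ℝ) < q := by exact_mod_cast hq
      constructor
      · rw [le_div_iff₀ hx]
        rw [le_div_iff₀ hq0] at hxq
        linarith
      · rw [div_lt_iff₀ hx]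
        rw [div_lt_iff₀ (by positivity)] at h
        push_cast at h
        linarith
    · have hv : (typeSearchT x (r + 1) q).val = (typeSearchT x r (q + 1)).val := by
        push_cast at h
        simp only [typeSearchT, Timed.val_bind, succT, divT, ltT]
        rw [if_neg (by simpa using h)]
      rw [hv]
      exact ih (q + 1) (by omega) (by omega) (not_lt.1 h)

theorem steps_typeSearchT (x : ℝ) (r q : ℕ) : (typeSearchT x r q).steps ≤ 4 * r + 1 := by
  induction r generalizing q with
  | zero => simp [typeSearchT]
  | succ r ih =>
    have := ih (q + 1)
    simp only [typeSearchT, Timed.steps_bind, steps_tick, succT, divT, ltT]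
    split_ifs
    · simp; omega
    · omega

/-! ### Bounds for `type_k` and `f_k` -/

theorem typeK_lt {x : ℝ} (hk : 3 ≤ k) (hx : 0 < x) (h : ¬ x ≤ 1 / (k : ℝ)) : typeK k x < k := by
  rw [typeK, if_neg h, Nat.floor_lt (by positivity), div_lt_iff₀ hx]
  have hk : (0 : ℝ) < k := by exact_mod_cast (by omega : 0 < k)
  rw [not_le, div_lt_iff₀ hk] at h
  linarith

theorem typeK_eq {x : ℝ} (h : x ≤ 1 / (k : ℝ)) : typeK k x = k := if_pos h

theorem typeK_pos {x : ℝ} (hx : 0 < x) (hx1 : x ≤ 1) (h : ¬ x ≤ 1 / (k : ℝ)) :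
    1 ≤ typeK k x := by
  rw [typeK, if_neg h, Nat.one_le_floor_iff]
  rwa [le_div_iff₀ hx, one_mul]

/-- An item of type less than `k` is not longer than its rounded length. -/
theorem le_fK {x : ℝ} (hx : 0 < x) (hx1 : x ≤ 1) (h : ¬ x ≤ 1 / (k : ℝ)) : x ≤ fK k x := by
  rw [fK, if_neg h]
  have h1 := typeK_pos hx hx1 h
  have h2 : (typeK k x : ℝ) ≤ 1 / x := by
    rw [typeK, if_neg h]
    exact Nat.floor_le (by positivity)
  have h3 : (0 : ℝ) < typeK k x := by exact_mod_cast h1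
  rw [le_div_iff₀ hx] at h2
  rw [le_div_iff₀ h3]
  linarith

/-- This bounds what the last item, which is exempt from the volume hypothesis, can add to the
volume of a sequence of type `k`. -/
theorem fK_le {x : ℝ} (hk : 3 ≤ k) (h : x ≤ 1 / (k : ℝ)) : fK k x ≤ 1 / ((k : ℝ) - 2) := by
  have hk : (3 : ℝ) ≤ k := by exact_mod_cast hk
  rw [fK, if_pos h, div_mul_eq_mul_div]
  rw [le_div_iff₀ (by linarith)] at h
  gcongr
  · linarith
  · linarith

theorem fK_pos {x : ℝ} (hk : 3 ≤ k) (hx : 0 < x) (hx1 : x ≤ 1) : 0 < fK k x := by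
  have hk : (3 : ℝ) ≤ k := by exact_mod_cast hk
  by_cases h : x ≤ 1 / (k : ℝ)
  · rw [fK, if_pos h]
    have : 0 < (k : ℝ) - 2 := by linarith
    positivity
  · exact hx.trans_le (le_fK hx hx1 h)

/-- For small lengths this is where `3 ≤ k` enters: `1 / (k - 2) ≤ 1`. -/
theorem fK_le_one {x : ℝ} (hk : 3 ≤ k) (hx : 0 < x) (hx1 : x ≤ 1) : fK k x ≤ 1 := by
  have hk' : (3 : ℝ) ≤ k := by exact_mod_cast hk
  by_cases h : x ≤ 1 / (k : ℝ)
  · refine (fK_le hk h).trans ?_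
    rw [div_le_one (by linarith)]
    linarith
  · rw [fK, if_neg h]
    have h3 : (1 : ℝ) ≤ typeK k x := by exact_mod_cast typeK_pos hx hx1 h
    rw [div_le_one (by linarith)]
    exact h3

theorem val_fKT {x : ℝ} (hk : 3 ≤ k) (hx : 0 < x) : (fKT k x (typeK k x)).val = fK k x := by
  by_cases h : x ≤ 1 / (k : ℝ)
  · rw [typeK_eq h, fK, if_pos h]
    simp [fKT]
  · rw [fK, if_neg h]
    simp [fKT, typeK_lt hk hx h]

theorem steps_fKT (x : ℝ) (q : ℕ) : (fKT k x q).steps ≤ 4 := by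
  simp only [fKT, Timed.steps_bind, ltNatT]
  split_ifs <;> simp

theorem prepArraysT_spec (hk : 3 ≤ k) (len : ℕ → ℝ) (D : ℕ)
    (hlen : ∀ c < D, 0 < len c ∧ len c ≤ 1) :
    (∀ c < D, (prepArraysT k len D).val.1 c = typeK k (len c)) ∧
    ∀ c ≤ D, (prepArraysT k len D).val.2 c = ∏ j ∈ Finset.range c, fK k (len j) := by
  induction D with
  | zero => simp [prepArraysT]
  | succ D ih =>
    obtain ⟨h1, h2⟩ := ih fun c hc => hlen c (by omega)
    have hD := hlen D (by omega)
    have e : (typeSearchT (len D) (k - 1) 1).val = typeK k (len D) :=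
      typeSearchT_spec _ hD.1 _ _ le_rfl (by omega) (by simpa using hD.2)
    constructor
    · intro c hc
      simp only [prepArraysT, Timed.val_bind, Timed.val_pure, readT, writeT, mulT, e]
      rcases Nat.lt_succ_iff_lt_or_eq.1 hc with h | rfl
      · rw [Function.update_of_ne (by omega), h1 c h]
      · simp
    · intro c hc
      simp only [prepArraysT, Timed.val_bind, Timed.val_pure, readT, writeT, mulT, e, val_fKT hk hD.1]
      rcases Nat.lt_or_ge c (D + 1) with h | h
      · rw [Function.update_of_ne (by omega), h2 c (by omega)]
      · have : c = D + 1 := by omega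
        subst this
        rw [Function.update_self, h2 D le_rfl, Finset.prod_range_succ]

theorem steps_prepArraysT (len : ℕ → ℝ) (D : ℕ) :
    (prepArraysT k len D).steps ≤ (4 * k + 11) * (D + 1) := by
  induction D with
  | zero => simp [prepArraysT]
  | succ D ih =>
    simp only [prepArraysT, Timed.steps_bind, steps_tick, Timed.steps_pure, readT, writeT, mulT]
    have h1 := steps_typeSearchT (len D) (k - 1) 1
    have h2 := steps_fKT (k := k) (len D) (typeSearchT (len D) (k - 1) 1).val
    nlinarith [Nat.sub_le k 1]

/-- The prepared and rounded item. -/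
noncomputable def pieceOf (k : ℕ) {n d : ℕ} (I : Fin n → Fin d → ℝ) (i : Fin n) : Piece n :=
  ⟨⟨i, coord (I i), (prepArraysT k (coord (I i)) (d - 1)).val.1,
    (prepArraysT k (coord (I i)) (d - 1)).val.2⟩, coord (I i) (d - 1),
    (prepArraysT k (coord (I i)) (d - 1)).val.2 (d - 1)⟩

theorem val_prepT {n d : ℕ} (I : Fin n → Fin d → ℝ) (l : List (Fin n)) :
    (prepT k I l).val = l.map (pieceOf k I) := by
  induction l with
  | nil => simp [prepT]
  | cons i l ih => simp [prepT, ih, pieceOf]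

theorem steps_prepT {n d : ℕ} (I : Fin n → Fin d → ℝ) (l : List (Fin n)) :
    (prepT k I l).steps ≤ ((4 * k + 11) * (d - 1 + 1) + 3) * l.length + 1 := by
  induction l with
  | nil => simp [prepT]
  | cons i l ih =>
    have := steps_prepArraysT (k := k) (coord (I i)) (d - 1)
    simp [prepT] at *
    nlinarith

/-- The arrays are correct, for `D` base dimensions. -/
structure Prep.Valid {n : ℕ} (k D : ℕ) (a : Prep n) : Prop where
  len_pos : ∀ c < D, 0 < a.len c
  len_le : ∀ c < D, a.len c ≤ 1
  typ_eq : ∀ c < D, a.typ c = typeK k (a.len c)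
  vol_eq : ∀ c ≤ D, a.vol c = ∏ j ∈ Finset.range c, fK k (a.len j)

theorem Prep.Valid.vol_zero {n D : ℕ} {a : Prep n} (h : a.Valid k D) : a.vol 0 = 1 := by
  simp [h.vol_eq 0 (Nat.zero_le _)]

theorem Prep.Valid.vol_succ {n D : ℕ} {a : Prep n} (h : a.Valid k D) {c : ℕ} (hc : c < D) :
    a.vol (c + 1) = a.vol c * fK k (a.len c) := by
  rw [h.vol_eq _ hc, h.vol_eq _ hc.le, Finset.prod_range_succ]

theorem Prep.Valid.vol_pos {n D : ℕ} {a : Prep n} (h : a.Valid k D) (hk : 3 ≤ k) {c : ℕ}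
    (hc : c ≤ D) : 0 < a.vol c := by
  rw [h.vol_eq _ hc]
  refine Finset.prod_pos fun j hj => ?_
  have := Finset.mem_range.1 hj
  exact fK_pos hk (h.len_pos j (by omega)) (h.len_le j (by omega))

theorem Prep.Valid.vol_le_one {n D : ℕ} {a : Prep n} (h : a.Valid k D) (hk : 3 ≤ k) {c : ℕ}
    (hc : c ≤ D) : a.vol c ≤ 1 := by
  rw [h.vol_eq _ hc]
  refine Finset.prod_le_one (fun j hj => ?_) fun j hj => ?_
  all_goals have := Finset.mem_range.1 hj
  · exact (fK_pos hk (h.len_pos j (by omega)) (h.len_le j (by omega))).le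
  · exact fK_le_one hk (h.len_pos j (by omega)) (h.len_le j (by omega))

end Prepare

/-! ## HDH-unit-pack -/

section UnitPack

variable {n : ℕ}

/-- Shortest prefixes with total at least `1`, where `s` is in the first prefix already. -/
def Chunks (v : Piece n → ℝ) : ℝ → List (List (Piece n)) → Prop
  | _, [] => True
  | s, J :: S => J ≠ [] ∧ s + (J.dropLast.map v).sum < 1 ∧ (S ≠ [] → 1 ≤ s + (J.map v).sum) ∧
      Chunks v 0 S

theorem prefixesT_spec (c : ℕ) (l : List (Piece n)) (s : ℝ) (hs : s < 1) :
    (prefixesT c l s).val.flatten = l ∧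
    Chunks (fun a => a.src.vol c) s (prefixesT c l s).val := by
  induction l generalizing s with
  | nil => simp [prefixesT, Chunks]
  | cons a l ih =>
    by_cases h : 1 ≤ s + a.src.vol c
    · obtain ⟨h1, h2⟩ := ih 0 one_pos
      have e : (prefixesT c (a :: l) s).val = [a] :: (prefixesT c l 0).val := by
        simp [prefixesT, h]
      rw [e]
      refine ⟨by simp [h1], by simp, by simpa using hs, fun _ => by simpa using h, h2⟩
    · obtain ⟨h1, h2⟩ := ih (s + a.src.vol c) (not_le.1 h)
      cases hr : (prefixesT c l (s + a.src.vol c)).val with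
      | nil =>
        have e : (prefixesT c (a :: l) s).val = [[a]] := by simp [prefixesT, h, hr]
        rw [hr] at h1
        rw [e, ← h1]
        refine ⟨by simp, by simp, by simpa using hs, fun h => absurd rfl h, trivial⟩
      | cons J S =>
        have e : (prefixesT c (a :: l) s).val = (a :: J) :: S := by simp [prefixesT, h, hr]
        rw [hr] at h1 h2
        obtain ⟨g1, g2, g3, g4⟩ := h2
        rw [e]
        refine ⟨by rw [← h1]; simp, by simp, ?_, fun hS => ?_, g4⟩
        · rw [List.dropLast_cons_of_ne_nil g1, List.map_cons, List.sum_cons]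
          linarith
        · rw [List.map_cons, List.sum_cons]
          linarith [g3 hS]

/-- The bound on each prefix without its last item is the volume hypothesis of `unitPackT_spec` in
one dimension fewer, so the recursion can continue. -/
theorem Chunks.mem {v : Piece n → ℝ} {s : ℝ} {S : List (List (Piece n))} (hs : 0 ≤ s)
    (h : Chunks v s S) : ∀ J ∈ S, J ≠ [] ∧ (J.dropLast.map v).sum < 1 := by
  induction S generalizing s with
  | nil => simp
  | cons J S ih =>
    obtain ⟨h1, h2, -, h4⟩ := h
    simp only [List.mem_cons, forall_eq_or_imp]
    exact ⟨⟨h1, by linarith⟩, ih le_rfl h4⟩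

/-- Every chunk but the last has total at least `1`, and none of these contains the final item of
the whole sequence, so the sum without that item still covers them. -/
theorem Chunks.length_le {v : Piece n → ℝ} {S : List (List (Piece n))} (h : Chunks v 0 S)
    (hv : ∀ a ∈ S.flatten, 0 ≤ v a) :
    (S.length : ℝ) ≤ 1 + (S.flatten.dropLast.map v).sum := by
  induction S with
  | nil => simp
  | cons J S ih =>
    obtain ⟨h1, h2, h3, h4⟩ := h
    cases S with
    | nil =>
      have : 0 ≤ (([J].flatten).dropLast.map v).sum := List.sum_nonneg fun x hx => by
        obtain ⟨t, ht, rfl⟩ := List.mem_map.1 hx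
        exact hv t (List.mem_of_mem_dropLast ht)
      simpa using this
    | cons K S =>
      have ih := ih h4 fun a ha => hv a (by
        rw [List.flatten_cons]; exact List.mem_append_right _ ha)
      have h3 := h3 (by simp)
      have hne : (K :: S).flatten ≠ [] := by
        rw [List.flatten_cons]
        exact fun h => h4.1 (List.append_eq_nil_iff.1 h).1
      rw [List.flatten_cons, List.dropLast_append_of_ne_nil hne, List.map_append, List.sum_append]
      push_cast [List.length_cons] at ih ⊢
      linarith

theorem le_maxLenT (c : ℕ) (J : List (Piece n)) (m : ℝ) :
    m ≤ (maxLenT c J m).val ∧ (∀ a ∈ J, a.src.len c ≤ (maxLenT c J m).val) ∧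
    ∀ M, m ≤ M → (∀ a ∈ J, a.src.len c ≤ M) → (maxLenT c J m).val ≤ M := by
  induction J generalizing m with
  | nil => simp [maxLenT]
  | cons a J ih =>
    have e : (maxLenT c (a :: J) m).val = (maxLenT c J (max (a.src.len c) m)).val := by
      simp only [maxLenT, Timed.val_bind, readT, leT]
      congr 2
      by_cases h : a.src.len c ≤ m
      · simp [h]
      · simp [h, (not_le.1 h).le]
    obtain ⟨h1, h2, h3⟩ := ih (max (a.src.len c) m)
    rw [e]
    simp only [List.mem_cons, forall_eq_or_imp]
    exact ⟨(le_max_right _ _).trans h1, ⟨(le_max_left _ _).trans h1, h2⟩,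
      fun M hm hM => h3 M (max_le hM.1 hm) hM.2⟩

theorem steps_maxLenT (c : ℕ) (J : List (Piece n)) (m : ℝ) :
    (maxLenT c J m).steps = 3 * J.length + 1 := by
  induction J generalizing m with
  | nil => simp [maxLenT]
  | cons a J ih => simp [maxLenT, ih]; ring

/-- As for decreasing-height shelf packing: no item of a chunk is longer than any item of the chunk
before, and the latter has total `v` at least `1`. So each shelf after the first is paid for by the
products `v a * a.src.len c` of the chunk before it, and `M` pays for the first. -/
theorem sum_maxLenT_le (c : ℕ) (v : Piece n → ℝ) (S : List (List (Piece n))) (M : ℝ)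
    (h : Chunks v 0 S) (hv : ∀ a ∈ S.flatten, 0 ≤ v a)
    (hlen : ∀ a ∈ S.flatten, 0 ≤ a.src.len c ∧ a.src.len c ≤ M) (hM : 0 ≤ M)
    (hsort : S.flatten.Pairwise fun a b => b.src.len c ≤ a.src.len c) :
    (S.map fun J => (maxLenT c J 0).val).sum ≤
      M + (S.flatten.map fun a => v a * a.src.len c).sum := by
  induction S generalizing M with
  | nil => simpa using hM
  | cons J S ih =>
    obtain ⟨h1, h2, h3, h4⟩ := h
    have hJ : (maxLenT c J 0).val ≤ M :=
      (le_maxLenT c J 0).2.2 M hM fun a ha => (hlen a (by simp [ha])).2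
    have nn : ∀ a ∈ (J :: S).flatten, 0 ≤ v a * a.src.len c :=
      fun a ha => mul_nonneg (hv a ha) (hlen a ha).1
    rw [List.map_cons, List.sum_cons, List.flatten_cons, List.map_append, List.sum_append]
    rw [List.flatten_cons] at nn hv hlen hsort
    cases S with
    | nil =>
      have : 0 ≤ (J.map fun a => v a * a.src.len c).sum := List.sum_nonneg fun x hx => by
        obtain ⟨t, ht, rfl⟩ := List.mem_map.1 hx
        exact nn t (by simp [ht])
      simp only [List.map_nil, List.sum_nil, List.flatten_nil]
      linarith
    | cons K S =>
      obtain ⟨b, K, rfl⟩ := List.exists_cons_of_ne_nil h4.1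
      have hsort' := List.pairwise_append.1 hsort
      have hb : b ∈ ((b :: K) :: S).flatten := by simp
      -- The first item `b` of the next chunk is the longest one remaining, so its length serves as
      -- the new `M`.
      have ih := ih (b.src.len c) h4 (fun a ha => hv a (List.mem_append_right _ ha))
        (fun a ha => ⟨(hlen a (List.mem_append_right _ ha)).1, by
          rw [List.flatten_cons, List.cons_append] at ha
          rcases List.mem_cons.1 ha with rfl | ha
          · exact le_rfl
          · have := hsort'.2.1
            rw [List.flatten_cons, List.cons_append] at this
            exact List.rel_of_pairwise_cons this ha⟩)
        (hlen b (List.mem_append_right _ hb)).1 hsort'.2.1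
      have hge : b.src.len c * (J.map v).sum ≤ (J.map fun a => v a * a.src.len c).sum := by
        rw [← List.sum_map_mul_left]
        refine List.sum_le_sum fun a ha => ?_
        rw [mul_comm]
        exact mul_le_mul_of_nonneg_left (hsort'.2.2 a ha b hb) (hv a (by simp [ha]))
      have hge2 : b.src.len c ≤ b.src.len c * (J.map v).sum := by
        have := h3 (by simp)
        exact le_mul_of_one_le_right (hlen b (List.mem_append_right _ hb)).1 (by linarith)
      linarith

/-- The items `l` are packed into a unit cube by their dimensions `0, …, j`. -/
structure UnitPacked (L : Fin n → ℕ → ℝ) (j : ℕ) (l : List (Piece n)) (acc : List ℝ)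
    (out : List (Fin n × List ℝ)) : Prop where
  perm : (out.map Prod.fst).Perm (l.map fun a => a.src.idx)
  form : ∀ p ∈ out, ∃ xs : List ℝ, xs.length = j + 1 ∧ p.2 = xs ++ acc
  inside : ∀ p ∈ out, ∀ c ≤ j, 0 ≤ p.2.getD c 0 ∧ p.2.getD c 0 + L p.1 c ≤ 1
  apart : out.Pairwise fun p q => ∃ c ≤ j,
    p.2.getD c 0 + L p.1 c ≤ q.2.getD c 0 ∨ q.2.getD c 0 + L q.1 c ≤ p.2.getD c 0

theorem lineT_spec (L : Fin n → ℕ → ℝ) (l : List (Piece n)) (x : ℝ) (acc : List ℝ)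
    (hL : ∀ a ∈ l, a.src.len = L a.src.idx) (hpos : ∀ a ∈ l, 0 ≤ a.src.len 0) :
    (lineT l x acc).val.map Prod.fst = (l.map fun a => a.src.idx) ∧
    (∀ p ∈ (lineT l x acc).val, ∃ y, p.2 = y :: acc ∧ x ≤ y ∧
      y + L p.1 0 ≤ x + (l.map fun a => a.src.len 0).sum) ∧
    (lineT l x acc).val.Pairwise fun p q => p.2.getD 0 0 + L p.1 0 ≤ q.2.getD 0 0 := by
  induction l generalizing x with
  | nil => simp [lineT]
  | cons a l ih =>
    obtain ⟨h1, h2, h3⟩ := ih (x + a.src.len 0) (fun b hb => hL b (by simp [hb]))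
      fun b hb => hpos b (by simp [hb])
    have ha := hpos a (by simp)
    have hLa := hL a (by simp)
    have h5 : 0 ≤ (l.map fun a => a.src.len 0).sum := List.sum_nonneg fun x hx => by
      obtain ⟨t, ht, rfl⟩ := List.mem_map.1 hx
      exact hpos t (by simp [ht])
    simp only [lineT, Timed.val_bind, Timed.val_pure, readT, addT, List.map_cons, List.sum_cons,
      List.mem_cons, forall_eq_or_imp, List.pairwise_cons]
    refine ⟨by rw [h1], ⟨⟨x, rfl, le_rfl, by rw [← hLa]; linarith⟩, fun p hp => ?_⟩,
      fun p hp => ?_, h3⟩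
    · obtain ⟨y, hy, hy1, hy2⟩ := h2 p hp
      exact ⟨y, hy, by linarith, by linarith⟩
    · obtain ⟨y, hy, hy1, hy2⟩ := h2 p hp
      rw [hy, ← hLa]
      simpa using hy1

theorem stackShelvesT_spec (L : Fin n → ℕ → ℝ) (j : ℕ)
    (sub : List (Piece n) → List ℝ → Timed (List (Fin n × List ℝ)))
    (S : List (List (Piece n))) (y : ℝ) (acc : List ℝ)
    (hL : ∀ a ∈ S.flatten, a.src.len = L a.src.idx)
    (hsub : ∀ J ∈ S, ∀ acc, UnitPacked L j J acc (sub J acc).val) :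
    ((stackShelvesT (j + 1) sub S y acc).val.map Prod.fst).Perm
      (S.flatten.map fun a => a.src.idx) ∧
    (∀ p ∈ (stackShelvesT (j + 1) sub S y acc).val,
      (∃ xs : List ℝ, xs.length = j + 2 ∧ p.2 = xs ++ acc) ∧
      (∀ c ≤ j, 0 ≤ p.2.getD c 0 ∧ p.2.getD c 0 + L p.1 c ≤ 1) ∧ y ≤ p.2.getD (j + 1) 0 ∧
      p.2.getD (j + 1) 0 + L p.1 (j + 1) ≤ y + (S.map fun J => (maxLenT (j + 1) J 0).val).sum) ∧
    (stackShelvesT (j + 1) sub S y acc).val.Pairwise fun p q => ∃ c ≤ j + 1,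
      p.2.getD c 0 + L p.1 c ≤ q.2.getD c 0 ∨ q.2.getD c 0 + L q.1 c ≤ p.2.getD c 0 := by
  induction S generalizing y with
  | nil => simp [stackShelvesT]
  | cons J S ih =>
    obtain ⟨h1, h2, h3⟩ := ih (y + (maxLenT (j + 1) J 0).val)
      (fun a ha => hL a (by rw [List.flatten_cons]; exact List.mem_append_right _ ha))
      fun K hK => hsub K (by simp [hK])
    obtain ⟨i1, i2, i3, i4⟩ := hsub J (by simp) (y :: acc)
    obtain ⟨m1, m2, -⟩ := le_maxLenT (j + 1) J 0
    have hnn : 0 ≤ (S.map fun J => (maxLenT (j + 1) J 0).val).sum :=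
      List.sum_nonneg fun x hx => by
        obtain ⟨t, ht, rfl⟩ := List.mem_map.1 hx
        exact (le_maxLenT (j + 1) t 0).1
    -- The recursive call produces `j + 1` coordinates in front of its accumulator `y :: acc`; hence
    -- entry `j + 1` is the base `y` of the shelf.
    have hy : ∀ p ∈ (sub J (y :: acc)).val, p.2.getD (j + 1) 0 = y := by
      intro p hp
      obtain ⟨xs, hxs, hp2⟩ := i2 p hp
      rw [hp2, List.getD_append_right _ _ _ _ hxs.le, hxs]
      simp
    have hLm : ∀ p ∈ (sub J (y :: acc)).val, L p.1 (j + 1) ≤ (maxLenT (j + 1) J 0).val := by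
      intro p hp
      have : p.1 ∈ J.map fun a => a.src.idx := i1.mem_iff.1 (List.mem_map_of_mem hp)
      obtain ⟨a, ha, hap⟩ := List.mem_map.1 this
      rw [← hap, ← hL a (by simp [ha])]
      exact m2 a ha
    simp only [stackShelvesT, Timed.val_bind, addT, val_appendT, List.map_append, List.map_cons,
      List.sum_cons, List.flatten_cons, List.mem_append]
    refine ⟨i1.append h1, ?_, ?_⟩
    · rintro p (hp | hp)
      · refine ⟨?_, i3 p hp, (hy p hp).ge, ?_⟩
        · obtain ⟨xs, hxs, hp2⟩ := i2 p hp
          exact ⟨xs ++ [y], by simp [hxs], by simp [hp2]⟩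
        · rw [hy p hp]
          linarith [hLm p hp]
      · obtain ⟨g1, g2, g3, g4⟩ := h2 p hp
        exact ⟨g1, g2, by linarith, by linarith⟩
    · refine List.pairwise_append.2 ⟨i4.imp fun ⟨c, hc, h⟩ => ⟨c, by omega, h⟩, h3,
        fun p hp q hq => ⟨j + 1, le_rfl, Or.inl ?_⟩⟩
      rw [hy p hp]
      linarith [hLm p hp, (h2 q hq).2.2.1]

theorem sortSmallT_cons (k c : ℕ) (a : Piece n) (l : List (Piece n)) :
    (a.src.typ c < k ∧ (sortSmallT k c (a :: l)).val = a :: l) ∨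
    (¬ a.src.typ c < k ∧ ((sortSmallT k c (a :: l)).val.Perm (a :: l) ∧
      (sortSmallT k c (a :: l)).val.Pairwise fun a b => b.src.len c ≤ a.src.len c)) := by
  by_cases h : a.src.typ c < k
  · exact Or.inl ⟨h, by simp [sortSmallT, h]⟩
  · right
    have e : (sortSmallT k c (a :: l)).val = (sortT (fun p q => do
        let u ← readT p.src.len c
        let v ← readT q.src.len c
        leT v u) (a :: l)).val := by
      simp [sortSmallT, h]
    rw [e]
    exact ⟨h, perm_sortT _ _, pairwise_sortT_desc (fun a : Piece n => a.src.len c) _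
      (fun a b => by simp) _⟩

/-- Items of one type whose total volume without the last one is less than `1` fit into a stack of
height `1`. -/
theorem sum_maxLenT_le_one {k : ℕ} (hk : 3 ≤ k) {D c : ℕ} (hc : c < D) (l : List (Piece n))
    (hval : ∀ a ∈ l, a.src.Valid k D)
    (htyp : ∀ a ∈ l, ∀ b ∈ l, a.src.typ c = b.src.typ c)
    (hvol : (l.dropLast.map fun a => a.src.vol (c + 1)).sum < 1) (S : List (List (Piece n)))
    (hS : S.flatten = (sortSmallT k c l).val) (hch : Chunks (fun a => a.src.vol c) 0 S) :
    (S.map fun J => (maxLenT c J 0).val).sum ≤ 1 := by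
  have hk' : (3 : ℝ) ≤ k := by exact_mod_cast hk
  cases l with
  | nil =>
    cases S with
    | nil => simp
    | cons J S =>
      rw [List.flatten_cons] at hS
      exact absurd (List.append_eq_nil_iff.1 (hS.trans (by simp [sortSmallT]))).1 hch.1
  | cons a l =>
    have ha := hval a (by simp)
    rcases sortSmallT_cons k c a l with ⟨hlt, e⟩ | ⟨hlt, e, hsort⟩
    · rw [e] at hS
      have hna : ¬ a.src.len c ≤ 1 / (k : ℝ) := by
        intro h
        rw [ha.typ_eq c hc, typeK_eq h] at hlt
        exact lt_irrefl _ hlt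
      have hq1 := typeK_pos (ha.len_pos c hc) (ha.len_le c hc) hna
      set q := typeK k (a.src.len c) with hq
      have hq0 : (0 : ℝ) < q := by exact_mod_cast hq1
      have hf : ∀ b ∈ a :: l, fK k (b.src.len c) = 1 / (q : ℝ) ∧ b.src.len c ≤ 1 / (q : ℝ) := by
        intro b hb
        have hbv := hval b hb
        have hbt : typeK k (b.src.len c) = q := by
          rw [← hbv.typ_eq c hc, hq, ← ha.typ_eq c hc]
          exact htyp b hb a (by simp)
        have hnb : ¬ b.src.len c ≤ 1 / (k : ℝ) := by
          intro h
          rw [typeK_eq h] at hbt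
          rw [ha.typ_eq c hc, ← hq, ← hbt] at hlt
          exact lt_irrefl _ hlt
        have h1 : fK k (b.src.len c) = 1 / (q : ℝ) := by rw [fK, if_neg hnb, hbt]
        exact ⟨h1, h1 ▸ le_fK (hbv.len_pos c hc) (hbv.len_le c hc) hnb⟩
      have hlen := hch.length_le (by
        rw [hS]
        exact fun b hb => ((hval b hb).vol_pos hk hc.le).le)
      rw [hS] at hlen
      -- For type `q < k` the factor `f_k` is constantly `1 / q`, so the volume hypothesis says that
      -- without the last item the volume in one dimension fewer is below `q`. Then
      -- `Chunks.length_le` leaves at most `q` shelves, each of height at most `1 / q`.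
      have e2 : ((a :: l).dropLast.map fun a => a.src.vol (c + 1)).sum =
          ((a :: l).dropLast.map fun a => a.src.vol c).sum * (1 / (q : ℝ)) := by
        rw [← List.sum_map_mul_right]
        refine congrArg List.sum (List.map_congr_left fun b hb => ?_)
        have hb := List.mem_of_mem_dropLast hb
        rw [(hval b hb).vol_succ hc, (hf b hb).1]
      rw [e2, mul_one_div, div_lt_one hq0] at hvol
      have hSq : (S.length : ℝ) < q + 1 := by linarith
      have hSq : S.length ≤ q := by
        have : S.length < q + 1 := by exact_mod_cast hSq
        omega
      have := List.sum_le_card_nsmul (S.map fun J => (maxLenT c J 0).val) (1 / (q : ℝ))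
        fun x hx => by
          obtain ⟨J, hJ, rfl⟩ := List.mem_map.1 hx
          refine (le_maxLenT c J 0).2.2 _ (by positivity) fun b hb => (hf b ?_).2
          rw [← hS]
          exact List.mem_flatten_of_mem hJ hb
      refine this.trans ?_
      rw [List.length_map, nsmul_eq_mul, mul_one_div, div_le_one hq0]
      exact_mod_cast hSq
    · have hall : ∀ b ∈ a :: l, b.src.len c ≤ 1 / (k : ℝ) := by
        intro b hb
        by_contra hn
        have := typeK_lt hk ((hval b hb).len_pos c hc) hn
        rw [← (hval b hb).typ_eq c hc, htyp b hb a (by simp)] at this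
        exact hlt this
      rw [← hS] at e hsort
      -- For type `k` all lengths are at most `1 / k`, which serves as `M`. Moreover a length is `(k
      -- - 2) / k` times its `f_k`, so the weighted lengths become volumes of one dimension more.
      have h1 := sum_maxLenT_le c (fun a => a.src.vol c) S (1 / (k : ℝ)) hch
        (fun b hb => ((hval b (e.mem_iff.1 hb)).vol_pos hk hc.le).le)
        (fun b hb => ⟨((hval b (e.mem_iff.1 hb)).len_pos c hc).le, hall b (e.mem_iff.1 hb)⟩)
        (by positivity) hsort
      rw [(e.map fun a => a.src.vol c * a.src.len c).sum_eq] at h1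
      have e2 : ((a :: l).map fun a => a.src.vol c * a.src.len c).sum =
          ((a :: l).map fun a => a.src.vol (c + 1)).sum * (((k : ℝ) - 2) / k) := by
        rw [← List.sum_map_mul_right]
        refine congrArg List.sum (List.map_congr_left fun b hb => ?_)
        rw [(hval b hb).vol_succ hc, fK, if_pos (hall b hb)]
        have : (k : ℝ) - 2 ≠ 0 := by linarith
        field_simp
      -- Without its last item the volume is below `1`, and that item adds at most `1 / (k - 2)`.
      have hlast : ((a :: l).map fun a => a.src.vol (c + 1)).sum < 1 + 1 / ((k : ℝ) - 2) := by
        rw [← List.dropLast_append_getLast (l := a :: l) (by simp), List.map_append,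
          List.sum_append]
        refine add_lt_add_of_lt_of_le hvol ?_
        have hm := List.getLast_mem (l := a :: l) (by simp)
        have hv := hval _ hm
        rw [List.map_singleton, List.sum_singleton, hv.vol_succ hc]
        calc _ ≤ 1 * fK k (((a :: l).getLast (by simp)).src.len c) :=
              mul_le_mul_of_nonneg_right (hv.vol_le_one hk hc.le)
                (fK_pos hk (hv.len_pos c hc) (hv.len_le c hc)).le
          _ ≤ _ := by rw [one_mul]; exact fK_le hk (hall _ hm)
      have h2 : ((a :: l).map fun a => a.src.vol (c + 1)).sum * (((k : ℝ) - 2) / k) ≤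
          (1 + 1 / ((k : ℝ) - 2)) * (((k : ℝ) - 2) / k) :=
        mul_le_mul_of_nonneg_right hlast.le (div_nonneg (by linarith) (by linarith))
      -- The definition of `f_k` is made for this identity: `1 - 1 / k` is just what the first
      -- shelf, of height at most `1 / k`, leaves.
      have h3 : (1 + 1 / ((k : ℝ) - 2)) * (((k : ℝ) - 2) / k) = 1 - 1 / k := by
        have : (k : ℝ) - 2 ≠ 0 := by linarith
        have : (k : ℝ) ≠ 0 := by linarith
        field_simp
        ring
      linarith

/-- A line of items in dimension `0` is a stack of one-item shelves. As `vol 0` is the empty product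
`1`, the singletons are chunks, and `sum_maxLenT_le_one` applies. The items need not be sorted for
the line itself, since the sum does not depend on their order. -/
theorem sum_len_le_one {k : ℕ} (hk : 3 ≤ k) {D : ℕ} (hD : 0 < D) (l : List (Piece n))
    (hval : ∀ a ∈ l, a.src.Valid k D)
    (htyp : ∀ a ∈ l, ∀ b ∈ l, a.src.typ 0 = b.src.typ 0)
    (hvol : (l.dropLast.map fun a => a.src.vol 1).sum < 1) :
    (l.map fun a => a.src.len 0).sum ≤ 1 := by
  have hS : (((sortSmallT k 0 l).val.map fun a => [a]).flatten) = (sortSmallT k 0 l).val := by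
    rw [← List.flatMap_def, List.flatMap_singleton']
  have hperm : (sortSmallT k 0 l).val.Perm l := by
    cases l with
    | nil => simp [sortSmallT]
    | cons a l =>
      rcases sortSmallT_cons k 0 a l with ⟨-, e⟩ | ⟨-, e, -⟩
      · rw [e]
      · exact e
  have hch : ∀ l : List (Piece n), (∀ a ∈ l, a.src.Valid k D) →
      Chunks (fun a : Piece n => a.src.vol 0) 0 (l.map fun a => [a]) := by
    intro l
    induction l with
    | nil => simp [Chunks]
    | cons a l ih =>
      intro h
      refine ⟨by simp, by simp, fun _ => ?_, ih fun b hb => h b (by simp [hb])⟩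
      simp [(h a (by simp)).vol_zero]
  have := sum_maxLenT_le_one hk hD l hval htyp hvol _ hS
    (hch _ fun a ha => hval a (hperm.mem_iff.1 ha))
  rw [← (hperm.map fun a => a.src.len 0).sum_eq]
  refine le_trans (le_of_eq ?_) this
  rw [List.map_map]
  refine congrArg List.sum (List.map_congr_left fun a ha => ?_)
  have h0 := (hval a (hperm.mem_iff.1 ha)).len_pos 0 hD
  have h1 := le_maxLenT 0 [a] 0
  exact le_antisymm (h1.2.1 a (by simp)) (h1.2.2 _ h0.le (by simp))

/-- Induction on the dimension. Prefixes inherit the volume hypothesis through `Chunks.mem`, so each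
fits into a unit cube of one dimension fewer, and `sum_maxLenT_le_one` stacks the resulting shelves
within height `1`. -/
theorem unitPackT_spec {k : ℕ} (hk : 3 ≤ k) (L : Fin n → ℕ → ℝ) {D : ℕ} (j : ℕ) (hj : j < D)
    (l : List (Piece n)) (acc : List ℝ) (hval : ∀ a ∈ l, a.src.Valid k D)
    (hL : ∀ a ∈ l, a.src.len = L a.src.idx)
    (htyp : ∀ a ∈ l, ∀ b ∈ l, ∀ c ≤ j, a.src.typ c = b.src.typ c)
    (hvol : (l.dropLast.map fun a => a.src.vol (j + 1)).sum < 1) :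
    UnitPacked L j l acc (unitPackT k j l acc).val := by
  induction j generalizing l acc with
  | zero =>
    obtain ⟨h1, h2, h3⟩ := lineT_spec L l 0 acc hL fun a ha => ((hval a ha).len_pos 0 hj).le
    have hsum := sum_len_le_one hk hj l hval (fun a ha b hb => htyp a ha b hb 0 le_rfl) hvol
    refine ⟨h1 ▸ List.Perm.refl _, fun p hp => ?_, fun p hp c hc => ?_, ?_⟩
    · obtain ⟨y, hy, -⟩ := h2 p hp
      exact ⟨[y], rfl, hy⟩
    · obtain ⟨y, hy, hy1, hy2⟩ := h2 p hp
      obtain rfl : c = 0 := by omega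
      rw [hy]
      simp only [List.getD_cons_zero]
      exact ⟨hy1, by linarith⟩
    · exact h3.imp fun h => ⟨0, le_rfl, Or.inl h⟩
  | succ j ih =>
    have hperm : (sortSmallT k (j + 1) l).val.Perm l := by
      cases l with
      | nil => simp [sortSmallT]
      | cons a l =>
        rcases sortSmallT_cons k (j + 1) a l with ⟨-, e⟩ | ⟨-, e, -⟩
        · rw [e]
        · exact e
    obtain ⟨p1, p2⟩ := prefixesT_spec (j + 1) (sortSmallT k (j + 1) l).val 0 one_pos
    have hmem : ∀ a ∈ (prefixesT (j + 1) (sortSmallT k (j + 1) l).val 0).val.flatten, a ∈ l := by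
      rw [p1]
      exact fun a ha => hperm.mem_iff.1 ha
    have hmem' : ∀ J ∈ (prefixesT (j + 1) (sortSmallT k (j + 1) l).val 0).val, ∀ a ∈ J, a ∈ l :=
      fun J hJ a ha => hmem a (List.mem_flatten_of_mem hJ ha)
    have hsum := sum_maxLenT_le_one hk hj l hval (fun a ha b hb => htyp a ha b hb _ le_rfl) hvol
      _ p1 p2
    obtain ⟨h1, h2, h3⟩ := stackShelvesT_spec L j (unitPackT k j)
      (prefixesT (j + 1) (sortSmallT k (j + 1) l).val 0).val 0 acc
      (fun a ha => hL a (hmem a ha)) fun J hJ acc => ih (by omega) J acc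
        (fun a ha => hval a (hmem' J hJ a ha)) (fun a ha => hL a (hmem' J hJ a ha))
        (fun a ha b hb c hc => htyp a (hmem' J hJ a ha) b (hmem' J hJ b hb) c (by omega))
        (p2.mem le_rfl J hJ).2
    have e : (unitPackT k (j + 1) l acc).val = (stackShelvesT (j + 1) (unitPackT k j)
      (prefixesT (j + 1) (sortSmallT k (j + 1) l).val 0).val 0 acc).val := by
      simp [unitPackT]
    rw [e]
    refine ⟨h1.trans ?_, fun p hp => (h2 p hp).1, fun p hp c hc => ?_, h3⟩
    · rw [p1]
      exact hperm.map _
    · obtain ⟨-, g2, g3, g4⟩ := h2 p hp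
      rcases Nat.lt_or_ge c (j + 1) with h | h
      · exact g2 c (by omega)
      · obtain rfl : c = j + 1 := by omega
        exact ⟨g3, by linarith⟩

end UnitPack

/-! ## The final packing -/

section Final

variable {n d k : ℕ}

theorem dropOtherTypeT_spec (D : ℕ) (a : Piece n) (l : List (PlacedShelf n)) :
    ∃ pre, l = pre ++ (dropOtherTypeT D a l).val ∧ (∀ s ∈ pre, s.rep.key D ≠ a.key D) ∧
      (∀ t r, (dropOtherTypeT D a l).val = t :: r → t.rep.key D = a.key D) ∧
      (dropOtherTypeT D a l).steps ≤ (5 * D + 2) * (pre.length + 1) := by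
  induction l with
  | nil => exact ⟨[], by simp [dropOtherTypeT]⟩
  | cons s l ih =>
    have hst := steps_sameTypeT D a s.rep
    by_cases hs : a.key D = s.rep.key D
    · refine ⟨[], ?_, ?_, ?_, ?_⟩
      · simp [dropOtherTypeT, val_sameTypeT, hs]
      · simp
      · simp [dropOtherTypeT, val_sameTypeT, hs]
      · simp [dropOtherTypeT, val_sameTypeT, hs]; omega
    · obtain ⟨pre, h1, h2, h3, h4⟩ := ih
      refine ⟨s :: pre, ?_, ?_, ?_, ?_⟩
      · simpa [dropOtherTypeT, val_sameTypeT, hs] using h1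
      · simpa [Ne.symm hs] using h2
      · simpa [dropOtherTypeT, val_sameTypeT, hs] using h3
      · simp [dropOtherTypeT, val_sameTypeT, hs]; nlinarith

theorem val_writeOutT (b : ℕ) (l : List (Fin n × List ℝ)) :
    (writeOutT d b l).val = l.map fun p => ⟨p.1, b, fun j => p.2.getD j 0⟩ := by
  induction l with
  | nil => simp [writeOutT]
  | cons p l ih => simp [writeOutT, ih]

theorem steps_writeOutT (b : ℕ) (l : List (Fin n × List ℝ)) :
    (writeOutT d b l).steps = (1 + d) * l.length + 1 := by
  induction l with
  | nil => simp [writeOutT]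
  | cons p l ih => simp [writeOutT, ih]; ring

/-- The placements of the items of a tight shelf in a placed shelf. -/
noncomputable def block (k d : ℕ) (s : TightShelf n) (t : PlacedShelf n) : List (Placement n d) :=
  (writeOutT d t.bin (unitPackT k (d - 2) s.items [t.y]).val).val

/-- If there are enough placed shelves of every base type and height, then every tight shelf gets
one of its base type that is at least as high. -/
theorem packShelvesT_spec (l : List (TightShelf n)) (ps : List (PlacedShelf n))
    (hl : SortedTypeHt (d - 1) (l.map TightShelf.rep))
    (hps : SortedTypeHt (d - 1) (ps.map PlacedShelf.rep))
    (hdom : ∀ κ h, cnt (fun s : TightShelf n => s.rep.key (d - 1) = κ ∧ h ≤ s.rep.ht) l ≤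
      cnt (fun s : PlacedShelf n => s.rep.key (d - 1) = κ ∧ h ≤ s.rep.ht) ps) :
    ∃ ts : List (PlacedShelf n), ts.Sublist ps ∧
      List.Forall₂ (fun s t => t.rep.key (d - 1) = s.rep.key (d - 1) ∧ s.rep.ht ≤ t.rep.ht) l ts ∧
      (packShelvesT k d l ps).val = (List.zipWith (block k d) l ts).flatten := by
  induction l generalizing ps with
  | nil => exact ⟨[], by simp, List.Forall₂.nil, by simp [packShelvesT]⟩
  | cons s l ih =>
    obtain ⟨pre, h1, h2, h3, -⟩ := dropOtherTypeT_spec (d - 1) s.rep ps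
    -- Domination at the base type and height of `s` itself yields a placed shelf `u` that would do.
    -- It is not among the dropped ones.
    have hpos : 0 < cnt (fun t : PlacedShelf n =>
        t.rep.key (d - 1) = s.rep.key (d - 1) ∧ s.rep.ht ≤ t.rep.ht) ps := by
      have := hdom (s.rep.key (d - 1)) s.rep.ht
      rw [cnt_cons_pos (by exact ⟨rfl, le_rfl⟩)] at this
      omega
    obtain ⟨u, hu, huk, hut⟩ := exists_of_cnt_pos hpos
    have hu' : u ∈ (dropOtherTypeT (d - 1) s.rep ps).val := by
      rw [h1] at hu
      exact (List.mem_append.1 hu).resolve_left fun h => h2 u h huk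
    obtain ⟨t, ts, ht⟩ := List.exists_cons_of_ne_nil (List.ne_nil_of_mem hu')
    have htk := h3 t ts ht
    rw [ht] at h1 hu'
    rw [h1, List.map_append, List.map_cons] at hps
    obtain ⟨-, hps2, hps3⟩ := List.pairwise_append.1 hps
    rw [List.map_cons] at hl
    have hst : s.rep.ht ≤ t.rep.ht := by
      rcases List.mem_cons.1 hu' with rfl | h
      · exact hut
      · rcases List.rel_of_pairwise_cons hps2 (List.mem_map_of_mem h) with h | h
        · rw [huk, htk] at h
          exact absurd h (lt_irrefl _)
        · exact hut.trans h.2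
    have hdom' : ∀ κ h, cnt (fun s : TightShelf n => s.rep.key (d - 1) = κ ∧ h ≤ s.rep.ht) l ≤
        cnt (fun s : PlacedShelf n => s.rep.key (d - 1) = κ ∧ h ≤ s.rep.ht) ts := by
      intro κ h
      by_cases hz : cnt (fun s : TightShelf n => s.rep.key (d - 1) = κ ∧ h ≤ s.rep.ht) l = 0
      · omega
      obtain ⟨x, hx, hxk, hxh⟩ := exists_of_cnt_pos (Nat.pos_of_ne_zero hz)
      have hsx := List.rel_of_pairwise_cons hl (List.mem_map_of_mem hx)
      have hd := hdom κ h
      -- A remaining shelf `x` with base type `κ` does not come before `s` in the order of types,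
      -- whereas all dropped shelves have types before that of `s`. So dropping them costs nothing
      -- for `κ`.
      have hpre : cnt (fun s : PlacedShelf n => s.rep.key (d - 1) = κ ∧ h ≤ s.rep.ht) pre = 0 := by
        refine cnt_eq_zero fun p hp hpk => ?_
        have hlt : p.rep.key (d - 1) < t.rep.key (d - 1) := by
          rcases hps3 p.rep (List.mem_map_of_mem hp) t.rep (by simp) with h | h
          · exact h
          · exact absurd (h.1.trans htk) (h2 p hp)
        rw [htk, hpk.1, ← hxk] at hlt
        rcases hsx with h | h
        · exact lt_asymm hlt h
        · rw [h.1] at hlt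
          exact lt_irrefl _ hlt
      rw [h1, cnt_append, hpre, zero_add] at hd
      by_cases hk : s.rep.key (d - 1) = κ
      · have hh : h ≤ s.rep.ht := by
          rcases hsx with h' | h'
          · rw [hk, hxk] at h'
            exact absurd h' (lt_irrefl _)
          · exact hxh.trans h'.2
        rw [cnt_cons_pos (by exact ⟨hk, hh⟩),
          cnt_cons_pos (by exact ⟨htk.trans hk, hh.trans hst⟩)] at hd
        omega
      · rw [cnt_cons_neg (by exact fun h => hk h.1),
          cnt_cons_neg (by exact fun h => hk (htk.symm.trans h.1))] at hd
        exact hd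
    obtain ⟨us, i1, i2, i3⟩ := ih ts hl.of_cons hps2.of_cons hdom'
    refine ⟨t :: us, ?_, List.Forall₂.cons ⟨htk, hst⟩ i2, ?_⟩
    · rw [h1]
      exact (i1.cons_cons t).trans (List.sublist_append_right _ _)
    · simp [packShelvesT, ht, i3, block]

/-! ### From matched shelves to a packing of the items -/

theorem coord_val {x : Fin d → ℝ} (j : Fin d) : coord x j = x j := by
  simp [coord]

theorem valid_pieceOf (hk : 3 ≤ k) {I : Fin n → Fin d → ℝ} (hI : ∀ i j, 0 < I i j ∧ I i j ≤ 1)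
    (i : Fin n) : (pieceOf k I i).src.Valid k (d - 1) := by
  have hlen : ∀ c < d - 1, 0 < coord (I i) c ∧ coord (I i) c ≤ 1 := by
    intro c hc
    have := hI i ⟨c, by omega⟩
    rwa [← coord_val (x := I i)] at this
  obtain ⟨h1, h2⟩ := prepArraysT_spec hk (coord (I i)) (d - 1) hlen
  exact ⟨fun c hc => (hlen c hc).1, fun c hc => (hlen c hc).2, h1, h2⟩

/-- What is needed of a tight shelf for packing its items. -/
theorem block_spec (hk : 3 ≤ k) (hd : 2 ≤ d) {I : Fin n → Fin d → ℝ}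
    (hI : ∀ i j, 0 < I i j ∧ I i j ≤ 1) (s : TightShelf n) (t : PlacedShelf n)
    (hsrc : ∀ a ∈ s.items, ∃ i, a = pieceOf k I i) (hs : s.Good (Piece.key (d - 1)))
    (hst : s.rep.ht ≤ t.rep.ht) :
    ((block k d s t).map Placement.item).Perm (s.items.map fun a => a.src.idx) ∧
    (∀ p ∈ block k d s t, p.bin = t.bin ∧ p.pos ⟨d - 1, by omega⟩ = t.y ∧
      I p.item ⟨d - 1, by omega⟩ ≤ t.rep.ht ∧
      ∀ j : Fin d, (j : ℕ) < d - 1 → 0 ≤ p.pos j ∧ p.pos j + I p.item j ≤ 1) ∧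
    (block k d s t).Pairwise fun p q =>
      ∃ j, p.pos j + I p.item j ≤ q.pos j ∨ q.pos j + I q.item j ≤ p.pos j := by
  have hup : UnitPacked (fun i => coord (I i)) (d - 2) s.items [t.y]
      (unitPackT k (d - 2) s.items [t.y]).val := by
    refine unitPackT_spec hk (D := d - 1) _ _ (by omega) _ _ ?_ ?_ ?_ ?_
    · intro a ha
      obtain ⟨i, rfl⟩ := hsrc a ha
      exact valid_pieceOf hk hI i
    · intro a ha
      obtain ⟨i, rfl⟩ := hsrc a ha
      rfl
    · intro a ha b hb c hc
      exact (keyList_eq_iff _ _ _).1 ((hs.key_eq a ha).trans (hs.key_eq b hb).symm) c (by omega)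
    · refine lt_of_eq_of_lt (congrArg List.sum (List.map_congr_left fun a ha => ?_)) hs.width
      obtain ⟨i, rfl⟩ := hsrc a (List.mem_of_mem_dropLast ha)
      have : d - 2 + 1 = d - 1 := by omega
      rw [this]
      rfl
  obtain ⟨h1, h2, h3, h4⟩ := hup
  rw [block, val_writeOutT]
  refine ⟨?_, ?_, ?_⟩
  · rw [List.map_map]
    exact h1
  · intro p hp
    obtain ⟨q, hq, rfl⟩ := List.mem_map.1 hp
    refine ⟨rfl, ?_, ?_, fun j hj => ?_⟩
    · obtain ⟨xs, hxs, e⟩ := h2 q hq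
      -- The packing of the shelf determines the first `d - 1` coordinates; the accumulator `[t.y]`
      -- supplies the last one, so all items stand on the bottom of the shelf.
      have hxs : xs.length = d - 1 := by omega
      simp only [e]
      rw [List.getD_append_right _ _ _ _ hxs.le, hxs]
      simp
    · have : q.1 ∈ s.items.map fun a => a.src.idx := h1.mem_iff.1 (List.mem_map_of_mem hq)
      obtain ⟨a, ha, hap⟩ := List.mem_map.1 this
      obtain ⟨i, rfl⟩ := hsrc a ha
      have := (hs.ht_le _ ha).trans hst
      simp only [pieceOf] at this hap
      rw [← coord_val (x := I _)]
      simp only [← hap]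
      exact this
    · have := h3 q hq j (by omega)
      rwa [coord_val] at this
  · refine List.pairwise_map.2 (h4.imp ?_)
    rintro p q ⟨c, hc, h⟩
    refine ⟨⟨c, by omega⟩, ?_⟩
    simpa only [← coord_val (x := I _)] using h

/-- Two items of the same shelf are apart by HDH-unit-pack. Two items of different shelves in one
bin are apart in the last dimension, since each lies within the vertical extent of its shelf and the
shelves do not overlap. -/
theorem isPackingOf_of_forall₂ (hk : 3 ≤ k) (hd : 2 ≤ d) {I : Fin n → Fin d → ℝ}
    (hI : ∀ i j, 0 < I i j ∧ I i j ≤ 1) (N : ℕ) (l : List (TightShelf n))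
    (ts : List (PlacedShelf n)) (hsrc : ∀ s ∈ l, ∀ a ∈ s.items, ∃ i, a = pieceOf k I i)
    (hgood : ∀ s ∈ l, s.Good (Piece.key (d - 1)))
    (hperm : ((l.flatMap TightShelf.items).map fun a => a.src.idx).Perm (List.finRange n))
    (hlt : List.Forall₂ (fun s t => s.rep.ht ≤ t.rep.ht) l ts)
    (hts : ∀ t ∈ ts, t.bin < N ∧ 0 ≤ t.y ∧ t.y + t.rep.ht ≤ 1)
    (hsep : ts.Pairwise fun p q => p.space.Sep q.space) :
    (⟨N, (List.zipWith (block k d) l ts).flatten⟩ : Packing n d).IsPackingOf I := by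
  have H : ((List.zipWith (block k d) l ts).flatten.map Placement.item).Perm
        ((l.flatMap TightShelf.items).map fun a => a.src.idx) ∧
      (∀ p ∈ (List.zipWith (block k d) l ts).flatten, (∃ t ∈ ts, p.bin = t.bin ∧
        p.pos ⟨d - 1, by omega⟩ = t.y ∧ I p.item ⟨d - 1, by omega⟩ ≤ t.rep.ht) ∧
        ∀ j : Fin d, (j : ℕ) < d - 1 → 0 ≤ p.pos j ∧ p.pos j + I p.item j ≤ 1) ∧
      (List.zipWith (block k d) l ts).flatten.Pairwise fun p q => p.bin = q.bin →
        ∃ j, p.pos j + I p.item j ≤ q.pos j ∨ q.pos j + I q.item j ≤ p.pos j := by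
    clear hperm hts
    induction hlt with
    | nil => simp
    | @cons s t l ts hst _ ih =>
      obtain ⟨i1, i2, i3⟩ := ih (fun s hs => hsrc s (by simp [hs])) (fun s hs => hgood s (by simp [hs]))
        hsep.of_cons
      obtain ⟨b1, b2, b3⟩ := block_spec hk hd hI s t (hsrc s (by simp)) (hgood s (by simp)) hst
      simp only [List.zipWith_cons_cons, List.flatten_cons, List.map_append, List.flatMap_cons,
        List.mem_append]
      refine ⟨b1.append i1, ?_, ?_⟩
      · rintro p (hp | hp)
        · obtain ⟨c1, c2, c3, c4⟩ := b2 p hp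
          exact ⟨⟨t, by simp, c1, c2, c3⟩, c4⟩
        · obtain ⟨⟨u, hu, hu'⟩, c⟩ := i2 p hp
          exact ⟨⟨u, by simp [hu], hu'⟩, c⟩
      · refine List.pairwise_append.2 ⟨b3.imp (by intro p q h _; exact h), i3, fun p hp q hq hpq => ?_⟩
        obtain ⟨c1, c2, c3, c4⟩ := b2 p hp
        obtain ⟨⟨u, hu, e1, e2, e3⟩, -⟩ := i2 q hq
        refine ⟨⟨d - 1, by omega⟩, ?_⟩
        rw [c2, e2]
        have := List.rel_of_pairwise_cons hsep hu
          (by simp only [PlacedShelf.space]; rw [← c1, hpq, e1])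
        simp only [PlacedShelf.space] at this
        rcases this with h | h
        · left; linarith
        · right; linarith
  obtain ⟨h1, h2, h3⟩ := H
  refine ⟨h1.trans hperm, fun p hp => ?_, fun p hp j => ?_, h3⟩
  · obtain ⟨⟨t, ht, e, -⟩, -⟩ := h2 p hp
    rw [e]
    exact (hts t ht).1
  · obtain ⟨⟨t, ht, -, e1, e2⟩, h4⟩ := h2 p hp
    rcases Nat.lt_or_ge j (d - 1) with h | h
    · exact h4 j h
    · have hj : j = ⟨d - 1, by omega⟩ := Fin.ext (by have := j.2; simp only; omega)
      rw [hj]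
      obtain ⟨-, g1, g2⟩ := hts t ht
      rw [e1]
      exact ⟨g1, by linarith⟩

theorem onePerBinT_spec (l : List (Fin n)) (b : ℕ) :
    (onePerBinT d l b).val.map Placement.item = l ∧
    (∀ p ∈ (onePerBinT d l b).val, b ≤ p.bin ∧ p.bin < b + l.length ∧ p.pos = fun _ => 0) ∧
    (onePerBinT d l b).val.Pairwise (fun p q => p.bin ≠ q.bin) ∧
    (onePerBinT d l b).steps = (2 + d) * l.length + 1 := by
  induction l generalizing b with
  | nil => simp [onePerBinT]
  | cons i l ih =>
    obtain ⟨h1, h2, h3, h4⟩ := ih (b + 1)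
    simp only [onePerBinT, Timed.val_bind, Timed.val_pure, succT, List.map_cons, List.mem_cons,
      forall_eq_or_imp, List.pairwise_cons, List.length_cons]
    refine ⟨by rw [h1], ⟨⟨le_rfl, by omega, trivial⟩, fun p hp => ?_⟩, ⟨fun p hp => ?_, h3⟩, ?_⟩
    · obtain ⟨e1, e2, e3⟩ := h2 p hp
      exact ⟨by omega, by omega, e3⟩
    · have := (h2 p hp).1
      omega
    · simp [h4]
      ring

theorem isPackingOf_onePerBinT {I : Fin n → Fin d → ℝ} (hI : ∀ i j, 0 < I i j ∧ I i j ≤ 1) :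
    (⟨n, (onePerBinT d (List.finRange n) 0).val⟩ : Packing n d).IsPackingOf I := by
  obtain ⟨h1, h2, h3, -⟩ := onePerBinT_spec (d := d) (List.finRange n) 0
  refine ⟨by simp [h1], fun p hp => ?_, fun p hp j => ?_, h3.imp fun h h' => absurd h' h⟩
  · have := (h2 p hp).2.1
    simpa using this
  · rw [(h2 p hp).2.2]
    simpa using (hI p.item j).2

end Final

/-! ## Widths and areas in a fractional packing -/

open MeasureTheory in
/-- Rectangles in the unit square that do not overlap have a total area of at most `1`. -/
theorem sum_area_le_one (l : List Placed) (hl : ∀ p ∈ l, p.InUnit ∧ 0 ≤ p.w ∧ 0 ≤ p.h)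
    (hap : l.Pairwise Placed.Apart) : (l.map fun p => p.w * p.h).sum ≤ 1 := by
  -- Half-open boxes make rectangles that only touch disjoint, so that measure is additive without
  -- discarding boundaries.
  let S : Placed → Set (ℝ × ℝ) := fun p =>
    Set.Ico p.x (p.x + p.w) ×ˢ Set.Ico p.y (p.y + p.h)
  have hdisj : ∀ p q : Placed, p.Apart q → Disjoint (S p) (S q) := by
    intro p q h
    rw [Set.disjoint_left]
    rintro ⟨u, v⟩ ⟨⟨h1, h2⟩, h3, h4⟩ ⟨⟨h5, h6⟩, h7, h8⟩
    simp only at h1 h2 h3 h4 h5 h6 h7 h8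
    rcases h with h | h | h | h <;> linarith
  have hmeas : ∀ p, MeasurableSet (S p) := fun p => measurableSet_Ico.prod measurableSet_Ico
  have hvol : ∀ p : Placed, 0 ≤ p.w → volume (S p) = ENNReal.ofReal (p.w * p.h) := by
    intro p hp
    rw [Measure.volume_eq_prod, Measure.prod_prod, Real.volume_Ico, Real.volume_Ico,
      ENNReal.ofReal_mul hp]
    simp
  have H : ∀ l : List Placed, (∀ p ∈ l, 0 ≤ p.w ∧ 0 ≤ p.h) → l.Pairwise Placed.Apart →
      MeasurableSet (⋃ p ∈ l, S p) ∧
      volume (⋃ p ∈ l, S p) = ENNReal.ofReal (l.map fun p => p.w * p.h).sum := by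
    intro l
    induction l with
    | nil => simp
    | cons p l ih =>
      intro hl hap
      obtain ⟨h1, h2⟩ := ih (fun q hq => hl q (by simp [hq])) hap.of_cons
      have hp := hl p (by simp)
      have e : (⋃ q ∈ p :: l, S q) = S p ∪ ⋃ q ∈ l, S q := by simp [Set.iUnion_or, Set.iUnion_union_distrib]
      rw [e]
      refine ⟨(hmeas p).union h1, ?_⟩
      rw [measure_union ?_ h1, h2, hvol p hp.1, List.map_cons, List.sum_cons, ENNReal.ofReal_add]
      · exact mul_nonneg hp.1 hp.2
      · refine List.sum_nonneg fun x hx => ?_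
        obtain ⟨q, hq, rfl⟩ := List.mem_map.1 hx
        have hq := hl q (by simp [hq])
        exact mul_nonneg hq.1 hq.2
      · simp only [Set.disjoint_iUnion_right]
        exact fun q hq => hdisj p q (List.rel_of_pairwise_cons hap hq)
  obtain ⟨-, h2⟩ := H l (fun p hp => (hl p hp).2) hap
  have hsub : (⋃ p ∈ l, S p) ⊆ Set.Icc (0 : ℝ) 1 ×ˢ Set.Icc (0 : ℝ) 1 := by
    simp only [Set.iUnion_subset_iff]
    rintro p hp ⟨u, v⟩ ⟨⟨h1, h2⟩, h3, h4⟩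
    obtain ⟨⟨g1, g2, g3, g4⟩, -, -⟩ := hl p hp
    simp only at h1 h2 h3 h4
    exact ⟨⟨by simp only; linarith, by simp only; linarith⟩,
      by simp only; linarith, by simp only; linarith⟩
  have hle := measure_mono (μ := volume) hsub
  rw [h2, Measure.volume_eq_prod, Measure.prod_prod, Real.volume_Icc] at hle
  simpa using hle

/-! ### What cuts preserve: positivity, area, and height and total width for vertical cuts -/

theorem Slicing.pos {hor : Prop} {r : Rect} {S : Multiset Rect} (h : Slicing hor r S)
    (hw : 0 < r.w) (hh : 0 < r.h) : ∀ p ∈ S, 0 < p.w ∧ 0 < p.h := by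
  induction h with
  | whole r => simpa using ⟨hw, hh⟩
  | vertical w₁ w₂ h S₁ S₂ hw₁ hw₂ s₁ s₂ ih₁ ih₂ =>
    intro p hp
    rcases Multiset.mem_add.1 hp with hp | hp
    · exact ih₁ hw₁ hh p hp
    · exact ih₂ hw₂ hh p hp
  | horizontal w h₁ h₂ S₁ S₂ allowed hh₁ hh₂ s₁ s₂ ih₁ ih₂ =>
    intro p hp
    rcases Multiset.mem_add.1 hp with hp | hp
    · exact ih₁ hw hh₁ p hp
    · exact ih₂ hw hh₂ p hp

theorem Slicing.sum_area {hor : Prop} {r : Rect} {S : Multiset Rect} (h : Slicing hor r S) :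
    (S.map fun p => p.w * p.h).sum = r.w * r.h := by
  induction h with
  | whole r => simp
  | vertical w₁ w₂ h S₁ S₂ hw₁ hw₂ s₁ s₂ ih₁ ih₂ =>
    rw [Multiset.map_add, Multiset.sum_add, ih₁, ih₂]
    ring
  | horizontal w h₁ h₂ S₁ S₂ allowed hh₁ hh₂ s₁ s₂ ih₁ ih₂ =>
    rw [Multiset.map_add, Multiset.sum_add, ih₁, ih₂]
    ring

theorem Slicing.of_vertical {hor : Prop} {r : Rect} {S : Multiset Rect} (h : Slicing hor r S)
    (hn : ¬ hor) : (∀ p ∈ S, p.h = r.h) ∧ (S.map Rect.w).sum = r.w := by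
  induction h with
  | whole r => simp
  | vertical w₁ w₂ h S₁ S₂ hw₁ hw₂ s₁ s₂ ih₁ ih₂ =>
    rw [Multiset.map_add, Multiset.sum_add, ih₁.2, ih₂.2]
    refine ⟨fun p hp => ?_, rfl⟩
    rcases Multiset.mem_add.1 hp with hp | hp
    · exact ih₁.1 p hp
    · exact ih₂.1 p hp
  | horizontal w h₁ h₂ S₁ S₂ allowed => exact absurd allowed hn

section Fractional

variable {n : ℕ} {P : FracPacking n} {δ : ℝ} {K : Fin n → Rect}

/-- All slices in a packing. -/
abbrev FracPacking.slices (P : FracPacking n) : List (Slice n) := P.flatMap Bin.slices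

theorem mem_slicesOf {p : Slice n} (hp : p ∈ P.slices) :
    (⟨p.pos.w, p.pos.h⟩ : Rect) ∈ P.slicesOf p.item := by
  unfold FracPacking.slicesOf
  rw [Multiset.mem_coe]
  exact List.mem_map.2 ⟨p, List.mem_filter.2 ⟨hp, by simp⟩, rfl⟩

/-- Double counting: summing over items and then over their slices is summing over all slices. It
transfers bounds per shelf or bin to the rectangles. -/
theorem sum_slicesOf (f : Rect → ℝ) (P : FracPacking n) (c : Fin n → Prop) [DecidablePred c] :
    ∑ i, (if c i then ((P.slicesOf i).map f).sum else 0) =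
      wt (fun p : Slice n => f ⟨p.pos.w, p.pos.h⟩) (fun p => c p.item) P.slices := by
  unfold FracPacking.slicesOf
  have H : ∀ L : List (Slice n), ∑ i, (if c i then (Multiset.map f
      (((L.filter fun p => p.item = i).map fun p => (⟨p.pos.w, p.pos.h⟩ : Rect) : List Rect) :
        Multiset Rect)).sum else 0) =
      wt (fun p : Slice n => f ⟨p.pos.w, p.pos.h⟩) (fun p => c p.item) L := by
    intro L
    induction L with
    | nil => simp
    | cons p L ih =>
      have e : ∀ i, (if c i then (Multiset.map f
        ((((p :: L).filter fun p => p.item = i).map fun p => (⟨p.pos.w, p.pos.h⟩ : Rect) :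
          List Rect) : Multiset Rect)).sum else 0) =
          (if p.item = i then (if c i then f ⟨p.pos.w, p.pos.h⟩ else 0) else 0) +
          (if c i then (Multiset.map f
          (((L.filter fun p => p.item = i).map fun p => (⟨p.pos.w, p.pos.h⟩ : Rect) : List Rect) :
            Multiset Rect)).sum else 0) := by
        intro i
        by_cases hc : c i <;> by_cases hi : p.item = i <;> simp [hc, hi]
      rw [Finset.sum_congr rfl fun i _ => e i, Finset.sum_add_distrib, ih,
        Finset.sum_ite_eq]
      by_cases hc : c p.item
      · rw [wt_cons_pos (by exact hc)]
        simp [hc]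
      · rw [wt_cons_neg (by exact hc)]
        simp [hc]
  exact H _

theorem FracPacking.IsShelfBased.slice_pos (h : P.IsShelfBased δ K)
    (hK : ∀ i, 0 < (K i).w ∧ 0 < (K i).h) : ∀ p ∈ P.slices, 0 < p.pos.w ∧ 0 < p.pos.h :=
  fun p hp => (h.slicing p.item).pos (hK _).1 (hK _).2 _ (mem_slicesOf hp)

theorem mem_slices_of_shelf {B : Bin n} (hB : B ∈ P) {s : Shelf n} (hs : s ∈ B.shelves)
    {p : Slice n} (hp : p ∈ s.slices) : p ∈ P.slices :=
  List.mem_flatMap.2 ⟨B, hB, List.mem_append_left _ (List.mem_flatMap.2 ⟨s, hs, hp⟩)⟩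

theorem mem_slices_of_free {B : Bin n} (hB : B ∈ P) {p : Slice n} (hp : p ∈ B.free) :
    p ∈ P.slices :=
  List.mem_flatMap.2 ⟨B, hB, List.mem_append_right _ hp⟩

/-- Slices of positive height on a common bottom edge can be apart only horizontally. So each may be
stretched to height `1` without overlap, and then areas are widths. -/
theorem Shelf.Valid.sum_width_le {s : Shelf n} (h : s.Valid)
    (hpos : ∀ p ∈ s.slices, 0 < p.pos.w ∧ 0 < p.pos.h) :
    (s.slices.map fun p => p.pos.w).sum ≤ 1 := by
  obtain ⟨h1, h2⟩ := h
  have := sum_area_le_one (s.slices.map fun p => ⟨p.pos.x, 0, p.pos.w, 1⟩) ?_ ?_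
  · simpa [List.map_map, Function.comp_def] using this
  · intro q hq
    obtain ⟨p, hp, rfl⟩ := List.mem_map.1 hq
    obtain ⟨g1, g2, -⟩ := h1 p hp
    exact ⟨⟨g1, g2, by simp, by simp⟩, (hpos p hp).1.le, by simp⟩
  · refine List.pairwise_map.2 (h2.imp_of_mem fun {p q} hp hq hpq => ?_)
    have e1 := (h1 p hp).2.2.1
    have e2 := (h1 q hq).2.2.1
    have p1 := (hpos p hp).2
    have p2 := (hpos q hq).2
    rcases hpq with h | h | h | h
    · exact Or.inl h
    · exact Or.inr (Or.inl h)
    · exfalso; linarith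
    · exfalso; linarith

/-- The shelves and the slices outside of them have a total area of at most `1`. -/
theorem Bin.Valid.sum_area_le {B : Bin n} (h : B.Valid) (hs : ∀ s ∈ B.shelves, 0 ≤ s.ht)
    (hpos : ∀ p ∈ B.free, 0 < p.pos.w ∧ 0 < p.pos.h) :
    (B.shelves.map Shelf.ht).sum + (B.free.map fun p => p.pos.w * p.pos.h).sum ≤ 1 := by
  obtain ⟨h1, h2, h3, h4, h5⟩ := h
  have := sum_area_le_one (B.shelves.map Shelf.rect ++ B.free.map Slice.pos) ?_ ?_
  · simpa [List.map_map, Function.comp_def, Shelf.rect] using this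
  · intro q hq
    rcases List.mem_append.1 hq with hq | hq
    · obtain ⟨s, hs', rfl⟩ := List.mem_map.1 hq
      exact ⟨(h1 s hs').1, by simp [Shelf.rect], by simpa [Shelf.rect] using hs s hs'⟩
    · obtain ⟨p, hp, rfl⟩ := List.mem_map.1 hq
      exact ⟨h3 p hp, (hpos p hp).1.le, (hpos p hp).2.le⟩
  · refine List.pairwise_append.2 ⟨List.pairwise_map.2 h2, List.pairwise_map.2 h4, ?_⟩
    intro q hq r hr
    obtain ⟨s, hs', rfl⟩ := List.mem_map.1 hq
    obtain ⟨p, hp, rfl⟩ := List.mem_map.1 hr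
    rcases h5 p hp s hs' with h | h | h | h
    · exact Or.inr (Or.inl h)
    · exact Or.inl h
    · exact Or.inr (Or.inr (Or.inr h))
    · exact Or.inr (Or.inr (Or.inl h))

/-- The rectangles of at least a given height fit into the shelves of at least this height. -/
theorem FracPacking.IsShelfBased.sum_width_le (hP : P.IsShelfBased δ K)
    (hK : ∀ i, 0 < (K i).w ∧ 0 < (K i).h) (h : ℝ) [DecidablePred fun i => δ < (K i).h ∧ h ≤ (K i).h] :
    ∑ i, (if δ < (K i).h ∧ h ≤ (K i).h then (K i).w else 0) ≤
      cnt (fun s : Shelf n => h ≤ s.ht) (P.flatMap Bin.shelves) := by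
  -- Rectangles higher than `δ` are cut only vertically, so the widths of their slices add up to
  -- their own.
  have e : ∑ i, (if δ < (K i).h ∧ h ≤ (K i).h then (K i).w else 0) =
      ∑ i, (if δ < (K i).h ∧ h ≤ (K i).h then ((P.slicesOf i).map Rect.w).sum else 0) := by
    refine Finset.sum_congr rfl fun i _ => ?_
    split_ifs with hi
    · exact ((hP.slicing i).of_vertical (not_le.2 hi.1)).2.symm
    · rfl
  rw [e, sum_slicesOf]
  have hpos := hP.slice_pos hK
  have hshelf : ∀ B ∈ P, ∀ l : List (Shelf n), (∀ s ∈ l, s ∈ B.shelves) →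
      wt (fun p : Slice n => p.pos.w) (fun p => δ < (K p.item).h ∧ h ≤ (K p.item).h)
        (l.flatMap Shelf.slices) ≤ cnt (fun s : Shelf n => h ≤ s.ht) l := by
    intro B hB l
    induction l with
    | nil => simp
    | cons s l ih =>
      intro hl
      have ih := ih fun t ht => hl t (by simp [ht])
      have hs := hl s (by simp)
      rw [List.flatMap_cons, wt_append]
      have hsv := ((hP.valid B hB).1 s hs).2
      by_cases hh : h ≤ s.ht
      · rw [cnt_cons_pos (by exact hh)]
        have h1 := hsv.sum_width_le fun p hp => hpos p (mem_slices_of_shelf hB hs hp)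
        have h2 := wt_mono (f := fun p : Slice n => p.pos.w) (l := s.slices)
          (p := fun p => δ < (K p.item).h ∧ h ≤ (K p.item).h) (q := fun _ => True)
          (fun _ _ _ => trivial) fun p hp => (hpos p (mem_slices_of_shelf hB hs hp)).1.le
        rw [wt_true] at h2
        push_cast
        linarith
      · rw [cnt_cons_neg (by exact hh), wt_eq_zero, zero_add]
        · exact ih
        -- Vertical cuts keep the height, so no slice of a rectangle of height at least `h` lies in
        -- a lower shelf.
        · intro p hp hp'
          have h1 := ((hP.slicing p.item).of_vertical (not_le.2 hp'.1)).1 _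
            (mem_slicesOf (mem_slices_of_shelf hB hs hp))
          have h2 := (hsv.1 p hp).2.2.2
          simp only at h1
          exact hh (by linarith [hp'.2])
  have H : ∀ l : List (Bin n), (∀ B ∈ l, B ∈ P) →
      wt (fun p : Slice n => p.pos.w) (fun p => δ < (K p.item).h ∧ h ≤ (K p.item).h)
        (l.flatMap Bin.slices) ≤ cnt (fun s : Shelf n => h ≤ s.ht) (l.flatMap Bin.shelves) := by
    intro l
    induction l with
    | nil => simp
    | cons B l ih =>
      intro hl
      have ih := ih fun t ht => hl t (by simp [ht])
      have hB := hl B (by simp)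
      have h1 := hshelf B hB B.shelves fun _ h => h
      rw [List.flatMap_cons, List.flatMap_cons, wt_append, cnt_append, Bin.slices, wt_append,
        wt_eq_zero (l := B.free)]
      · push_cast
        linarith
      · exact fun p hp hp' => absurd (hP.small B hB p hp) (not_le.2 hp'.1)
  exact H P fun _ h => h

/-- The shelves and the rectangles that are not in shelves fit into the bins. -/
theorem FracPacking.IsShelfBased.sum_area_le (hP : P.IsShelfBased δ K) (hδ : 0 < δ)
    (hK : ∀ i, 0 < (K i).w ∧ 0 < (K i).h) [DecidablePred fun i => (K i).h ≤ δ] :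
    (P.map fun B => (B.shelves.map Shelf.ht).sum).sum +
      ∑ i, (if (K i).h ≤ δ then (K i).w * (K i).h else 0) ≤ P.length := by
  have e : ∑ i, (if (K i).h ≤ δ then (K i).w * (K i).h else 0) =
      ∑ i, (if (K i).h ≤ δ then ((P.slicesOf i).map fun p => p.w * p.h).sum else 0) := by
    refine Finset.sum_congr rfl fun i _ => ?_
    rw [(hP.slicing i).sum_area]
  rw [e, sum_slicesOf]
  have hpos := hP.slice_pos hK
  have H : ∀ l : List (Bin n), (∀ B ∈ l, B ∈ P) →
      (l.map fun B => (B.shelves.map Shelf.ht).sum).sum +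
      wt (fun p : Slice n => p.pos.w * p.pos.h) (fun p => (K p.item).h ≤ δ)
        (l.flatMap Bin.slices) ≤ l.length := by
    intro l
    induction l with
    | nil => simp
    | cons B l ih =>
      intro hl
      have ih := ih fun t ht => hl t (by simp [ht])
      have hB := hl B (by simp)
      have h1 := (hP.valid B hB).sum_area_le (fun s hs => hδ.le.trans (hP.shelf_ht B hB s hs).le)
        fun p hp => hpos p (mem_slices_of_free hB hp)
      have h2 := wt_mono (f := fun p : Slice n => p.pos.w * p.pos.h) (l := B.free)
          (p := fun p => (K p.item).h ≤ δ) (q := fun _ => True)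
          (fun _ _ _ => trivial) fun p hp => by
            have := hpos p (mem_slices_of_free hB hp)
            exact (mul_pos this.1 this.2).le
      rw [wt_true] at h2
      rw [List.flatMap_cons, wt_append, Bin.slices, wt_append,
        wt_eq_zero (l := B.shelves.flatMap Shelf.slices)]
      · simp only [List.map_cons, List.sum_cons, List.length_cons]
        push_cast
        linarith
      · intro p hp hp'
        obtain ⟨s, hs, hps⟩ := List.mem_flatMap.1 hp
        exact absurd (hP.large B hB s hs p hps) (not_lt.2 hp')
  exact H P fun _ h => h

/-- There are less than `1/δ` shelves in a bin. -/
theorem FracPacking.IsShelfBased.length_shelves_le (hP : P.IsShelfBased δ K) (hδ : 0 < δ)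
    (hK : ∀ i, 0 < (K i).w ∧ 0 < (K i).h) :
    ((P.flatMap Bin.shelves).length : ℝ) ≤ P.length / δ := by
  classical
  have h1 := hP.sum_area_le hδ hK
  have h2 : 0 ≤ ∑ i, (if (K i).h ≤ δ then (K i).w * (K i).h else 0) :=
    Finset.sum_nonneg fun i _ => by
      split_ifs
      · exact (mul_pos (hK i).1 (hK i).2).le
      · exact le_rfl
  have h3 : (P.map fun B => (B.shelves.map Shelf.ht).sum).sum =
      ((P.flatMap Bin.shelves).map Shelf.ht).sum := by
    generalize (P : List (Bin n)) = l
    induction l with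
    | nil => simp
    | cons B l ih => simp [ih]
  have h4 := List.card_nsmul_le_sum ((P.flatMap Bin.shelves).map Shelf.ht) δ fun x hx => by
    obtain ⟨s, hs, rfl⟩ := List.mem_map.1 hx
    obtain ⟨B, hB, hs⟩ := List.mem_flatMap.1 hs
    exact (hP.shelf_ht B hB s hs).le
  rw [List.length_map, nsmul_eq_mul] at h4
  rw [le_div_iff₀ hδ]
  linarith

end Fractional

/-! ## The steps of packing the shelves -/

section Steps

variable {n : ℕ}

theorem steps_lineT (l : List (Piece n)) (x : ℝ) (acc : List ℝ) :
    (lineT l x acc).steps = 3 * l.length + 1 ∧ (lineT l x acc).val.length = l.length := by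
  induction l generalizing x with
  | nil => simp [lineT]
  | cons a l ih => simp [lineT, (ih _).1, (ih _).2]; ring

theorem steps_prefixesT (c : ℕ) (l : List (Piece n)) (s : ℝ) :
    (prefixesT c l s).steps ≤ 4 * l.length + 1 := by
  induction l generalizing s with
  | nil => simp [prefixesT]
  | cons a l ih =>
    by_cases h : 1 ≤ s + a.src.vol c
    · have := ih 0
      simp [prefixesT, h]; omega
    · have := ih (s + a.src.vol c)
      cases hr : (prefixesT c l (s + a.src.vol c)).val <;> simp [prefixesT, h, hr] <;> omega

theorem steps_sortSmallT (k c : ℕ) (l : List (Piece n)) :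
    (sortSmallT k c l).steps ≤ 7 * (l.length * Nat.clog 2 l.length) + 2 * l.length + 5 := by
  cases l with
  | nil => simp [sortSmallT]
  | cons a l =>
    by_cases h : a.src.typ c < k
    · simp [sortSmallT, h]
    · have := steps_sortT (fun p q : Piece n => do
        let u ← readT p.src.len c
        let v ← readT q.src.len c
        leT v u) 3 (fun a b => by simp) (a :: l)
      simp [sortSmallT, h] at *
      omega

theorem perm_sortSmallT (k c : ℕ) (l : List (Piece n)) : (sortSmallT k c l).val.Perm l := by
  cases l with
  | nil => simp [sortSmallT]
  | cons a l =>
    rcases sortSmallT_cons k c a l with ⟨-, e⟩ | ⟨-, e, -⟩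
    · rw [e]
    · exact e

/-- Besides the cost of `sub`, a chunk `J` costs `4 * J.length + 4` steps, and with the constant `7`
from `hsub` the overhead is at most `15 * J.length`, because chunks are non-empty. This keeps
constants from piling up over the chunks. -/
theorem steps_stackShelvesT (c A : ℕ)
    (sub : List (Piece n) → List ℝ → Timed (List (Fin n × List ℝ)))
    (S : List (List (Piece n))) (y : ℝ) (acc : List ℝ) (hne : ∀ J ∈ S, J ≠ [])
    (hlen : ∀ J ∈ S, ∀ acc, (sub J acc).val.length = J.length)
    (hsub : ∀ J ∈ S, ∀ acc, (sub J acc).steps ≤ A * J.length + 7) :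
    (stackShelvesT c sub S y acc).steps ≤ (A + 15) * S.flatten.length + 1 ∧
    (stackShelvesT c sub S y acc).val.length = S.flatten.length := by
  induction S generalizing y with
  | nil => simp [stackShelvesT]
  | cons J S ih =>
    obtain ⟨h1, h2⟩ := ih (y + (maxLenT c J 0).val) (fun K hK => hne K (by simp [hK]))
      (fun K hK => hlen K (by simp [hK])) fun K hK => hsub K (by simp [hK])
    have h3 := hsub J (by simp) (y :: acc)
    have h4 := hlen J (by simp) (y :: acc)
    have h5 : 0 < J.length := List.length_pos_iff.2 (hne J (by simp))
    constructor
    · simp only [stackShelvesT, Timed.steps_bind, steps_tick, addT, steps_maxLenT, steps_appendT,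
        h4, List.flatten_cons, List.length_append]
      nlinarith
    · simp only [stackShelvesT, Timed.val_bind, addT, val_appendT, List.length_append, h4, h2,
        List.flatten_cons]

/-- The chunks of a level partition its items, so each dimension costs one round of sorting and
linear work. The logarithm is taken of a fixed `N` so that one factor serves all chunks of the
recursion. Linear work per level is `2 + 4 + 15 = 21` per item, from sorting, cutting and stacking.
-/
theorem steps_unitPackT (k N j : ℕ) (l : List (Piece n)) (acc : List ℝ) (hl : l.length ≤ N) :
    (unitPackT k j l acc).steps ≤ (7 * Nat.clog 2 N + 21) * (j + 1) * l.length + 7 ∧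
    (unitPackT k j l acc).val.length = l.length := by
  induction j generalizing l acc with
  | zero =>
    obtain ⟨h1, h2⟩ := steps_lineT l 0 acc
    refine ⟨?_, h2⟩
    simp only [unitPackT, h1]
    nlinarith [Nat.zero_le (Nat.clog 2 N * l.length)]
  | succ j ih =>
    have hperm := perm_sortSmallT k (j + 1) l
    obtain ⟨p1, p2⟩ := prefixesT_spec (j + 1) (sortSmallT k (j + 1) l).val 0 one_pos
    have hmem : ∀ J ∈ (prefixesT (j + 1) (sortSmallT k (j + 1) l).val 0).val, J.length ≤ N := by
      intro J hJ
      have := (List.sublist_flatten_of_mem hJ).length_le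
      rw [p1, hperm.length_eq] at this
      omega
    obtain ⟨h1, h2⟩ := steps_stackShelvesT (j + 1) ((7 * Nat.clog 2 N + 21) * (j + 1))
      (unitPackT k j) (prefixesT (j + 1) (sortSmallT k (j + 1) l).val 0).val 0 acc
      (fun J hJ => (p2.mem le_rfl J hJ).1) (fun J hJ acc => (ih J acc (hmem J hJ)).2)
      fun J hJ acc => (ih J acc (hmem J hJ)).1
    rw [p1, hperm.length_eq] at h1 h2
    have h3 := steps_sortSmallT k (j + 1) l
    have h4 := steps_prefixesT (j + 1) (sortSmallT k (j + 1) l).val 0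
    rw [hperm.length_eq] at h4
    have h5 : l.length * Nat.clog 2 l.length ≤ l.length * Nat.clog 2 N :=
      Nat.mul_le_mul_left _ (Nat.clog_mono_right 2 hl)
    constructor
    · simp only [unitPackT, Timed.steps_bind]
      nlinarith
    · simpa [unitPackT] using h2

/-- A placed shelf is passed only once, whether dropped or used, and every item is packed only once;
so the total is linear in the two lists of shelves and in the items, up to the costs of comparison
and unit packing. -/
theorem steps_packShelvesT (k N d : ℕ) (hd : 2 ≤ d) (l : List (TightShelf n))
    (ps : List (PlacedShelf n)) (hl : (l.flatMap TightShelf.items).length ≤ N) :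
    (packShelvesT k d l ps).steps ≤ (5 * (d - 1) + 2) * ps.length + (5 * (d - 1) + 13) * l.length +
      ((7 * Nat.clog 2 N + 21) * (d - 1) + d + 2) * (l.flatMap TightShelf.items).length + 1 := by
  induction l generalizing ps with
  | nil => simp [packShelvesT]
  | cons s l ih =>
    rw [List.flatMap_cons, List.length_append] at hl ⊢
    obtain ⟨pre, h1, -, -, h4⟩ := dropOtherTypeT_spec (d - 1) s.rep ps
    have h5 := congrArg List.length h1
    rw [List.length_append] at h5
    cases h : (dropOtherTypeT (d - 1) s.rep ps).val with
    | nil =>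
      rw [h] at h5
      simp only [packShelvesT, Timed.steps_bind, steps_tick, h, Timed.steps_pure, List.length_cons,
        List.length_nil] at h5 ⊢
      have : pre.length = ps.length := by omega
      rw [this] at h4
      nlinarith [Nat.zero_le (((7 * Nat.clog 2 N + 21) * (d - 1) + d + 2) *
        (s.items.length + (l.flatMap TightShelf.items).length)),
        Nat.zero_le ((5 * (d - 1) + 13) * l.length)]
    | cons t ts =>
      have i := ih ts (by omega)
      obtain ⟨u1, u2⟩ := steps_unitPackT k N (d - 2) s.items [t.y] (by omega)
      have hd' : d - 2 + 1 = d - 1 := by omega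
      rw [hd'] at u1
      rw [h, List.length_cons] at h5
      simp only [packShelvesT, Timed.steps_bind, steps_tick, h, steps_writeOutT, u2,
        steps_appendT, val_writeOutT, List.length_map, List.length_cons]
      rw [h5]
      nlinarith

end Steps

/-! ## Counting by keys -/

section Fibers

variable {α β : Type}

theorem cnt_eq_sum_fibers [DecidableEq β] (p : α → Prop) (g : α → β) (T : Finset β) (l : List α)
    (hT : ∀ a ∈ l, p a → g a ∈ T) : cnt p l = ∑ x ∈ T, cnt (fun a => g a = x ∧ p a) l := by
  induction l with
  | nil => simp
  | cons a l ih =>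
    have ih := ih fun b hb => hT b (by simp [hb])
    by_cases hp : p a
    · have e : ∀ x, cnt (fun a => g a = x ∧ p a) (a :: l) =
          (if g a = x then 1 else 0) + cnt (fun a => g a = x ∧ p a) l := by
        intro x
        by_cases hx : g a = x
        · rw [cnt_cons_pos (by exact ⟨hx, hp⟩), if_pos hx]
        · rw [cnt_cons_neg (by exact fun h => hx h.1), if_neg hx, zero_add]
      rw [cnt_cons_pos (by exact hp), ih, Finset.sum_congr rfl fun x _ => e x,
        Finset.sum_add_distrib, Finset.sum_ite_eq, if_pos (hT a (by simp) hp)]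
    · rw [cnt_cons_neg (by exact hp), ih]
      exact Finset.sum_congr rfl fun x _ => (cnt_cons_neg (by exact fun h => hp h.2)).symm

theorem wt_eq_sum_fibers [DecidableEq β] (f : α → ℝ) (p : α → Prop) (g : α → β) (T : Finset β)
    (l : List α) (hT : ∀ a ∈ l, p a → g a ∈ T) :
    wt f p l = ∑ x ∈ T, wt f (fun a => g a = x ∧ p a) l := by
  induction l with
  | nil => simp
  | cons a l ih =>
    have ih := ih fun b hb => hT b (by simp [hb])
    by_cases hp : p a
    · have e : ∀ x, wt f (fun a => g a = x ∧ p a) (a :: l) =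
          (if g a = x then f a else 0) + wt f (fun a => g a = x ∧ p a) l := by
        intro x
        by_cases hx : g a = x
        · rw [wt_cons_pos (by exact ⟨hx, hp⟩), if_pos hx]
        · rw [wt_cons_neg (by exact fun h => hx h.1), if_neg hx, zero_add]
      rw [wt_cons_pos (by exact hp), ih, Finset.sum_congr rfl fun x _ => e x,
        Finset.sum_add_distrib, Finset.sum_ite_eq, if_pos (hT a (by simp) hp)]
    · rw [wt_cons_neg (by exact hp), ih]
      exact Finset.sum_congr rfl fun x _ => (wt_cons_neg (by exact fun h => hp h.2)).symm

theorem wt_finRange {n : ℕ} (f : α → ℝ) (p : α → Prop) [DecidablePred p] (g : Fin n → α) :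
    wt f p ((List.finRange n).map g) = ∑ i, if p (g i) then f (g i) else 0 := by
  rw [Fin.sum_univ_def]
  unfold wt
  rw [List.map_map]
  congr 1
  refine List.map_congr_left fun i _ => ?_
  by_cases h : p (g i) <;> simp [h]

end Fibers

/-! ## The stages of `inflate` -/

section Stages

variable (k : ℕ) (δ : ℝ) {n d : ℕ} (I : Fin n → Fin d → ℝ) (P : FracPacking n)

/-- The rounded items. -/
noncomputable def items : List (Piece n) := (List.finRange n).map (pieceOf k I)

/-- The rounded items higher than `δ`. -/
noncomputable def largeItems : List (Piece n) := (items k I).filter fun a => decide (δ < a.ht)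

/-- The other rounded items. -/
noncomputable def smallItems : List (Piece n) := (items k I).filter fun a => decide (a.ht ≤ δ)

/-- The places of the shelves of `P`, by decreasing height. -/
noncomputable def spaces : List Space :=
  (sortT (fun s t => leT t.ht s.ht) (stackBinsT P 0).val.1).val

/-- The slices of the large items in the shelves of `P`. -/
noncomputable def largeSlices : List (Piece n) :=
  (fillT (sortT leHtT (largeItems k δ I)).val (spaces P) 1).val

/-- The slices in the shelves of `P`, sorted by base type. -/
noncomputable def sortedSlices : List (Piece n) :=
  (sortT (leTypeHtT (d - 1)) (largeSlices k δ I P)).val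

/-- The shelves for the slices of the large items, for each height and base type. -/
noncomputable def largeShelves : List (TightShelf n) :=
  (sortT (fun s t => leHtT s.rep t.rep)
    (shelveT (sameTypeHtT (d - 1)) (sortedSlices k δ I P)).val).val

/-- The small items, sorted by base type. -/
noncomputable def sortedSmall : List (Piece n) :=
  (sortT (leTypeHtT (d - 1)) (smallItems k δ I)).val

/-- The shelves for the small items. -/
noncomputable def smallShelves : List (TightShelf n) :=
  (shelveT (sameTypeT (d - 1)) (sortedSmall k δ I)).val

/-- The places of the shelves for the large items. -/
noncomputable def largePlaces : List (PlacedShelf n) × ℕ :=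
  (reuseT (largeShelves k δ I P) (spaces P) P.length).val

/-- The places of the shelves for the small items. -/
noncomputable def smallPlaces : List (PlacedShelf n) × ℕ :=
  (nextFitT (smallShelves k δ I) (stackBinsT P 0).val.2 (largePlaces k δ I P).2).val

/-- All placed shelves, sorted by base type. -/
noncomputable def placedShelves : List (PlacedShelf n) :=
  (sortT (fun s t => leTypeHtT (d - 1) s.rep t.rep)
    ((largePlaces k δ I P).1 ++ (smallPlaces k δ I P).1)).val

/-- All items, sorted by base type. -/
noncomputable def sortedItems : List (Piece n) := (sortT (leTypeHtT (d - 1)) (items k I)).val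

/-- The shelves for all items. -/
noncomputable def allShelves : List (TightShelf n) :=
  (shelveT (sameTypeT (d - 1)) (sortedItems k I)).val

theorem val_inflate_of_le (h : n ≤ P.length) :
    (inflate k δ I P).val = ⟨n, (onePerBinT d (List.finRange n) 0).val⟩ := by
  simp [inflate, h]

theorem val_inflate_of_lt (h : P.length < n) : (inflate k δ I P).val =
    ⟨(smallPlaces k δ I P).2,
      (packShelvesT k d (allShelves k I) (placedShelves k δ I P)).val⟩ := by
  have e : ((prepT k I (List.finRange n)).val) = items k I := val_prepT I _
  simp only [inflate, Timed.val_bind, val_longT, decide_eq_true_eq, not_le.2 h, if_false,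
    Timed.val_pure, val_lengthT, e, val_filterT, val_appendT]
  rfl

theorem steps_inflate_of_le (h : n ≤ P.length) : (inflate k δ I P).steps =
    (longT P n).steps + (onePerBinT d (List.finRange n) 0).steps := by
  simp [inflate, h]

theorem steps_inflate_of_lt (h : P.length < n) : (inflate k δ I P).steps =
    (longT P n).steps + ((lengthT P).steps + ((prepT k I (List.finRange n)).steps +
    ((filterT (fun a => ltT δ a.ht) (items k I)).steps +
    ((filterT (fun a => leT a.ht δ) (items k I)).steps +
    ((stackBinsT P 0).steps + ((sortT (fun s t => leT t.ht s.ht) (stackBinsT P 0).val.1).steps +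
    ((sortT leHtT (largeItems k δ I)).steps +
    ((fillT (sortT leHtT (largeItems k δ I)).val (spaces P) 1).steps +
    ((sortT (leTypeHtT (d - 1)) (largeSlices k δ I P)).steps +
    ((shelveT (sameTypeHtT (d - 1)) (sortedSlices k δ I P)).steps +
    ((sortT (fun s t => leHtT s.rep t.rep)
      (shelveT (sameTypeHtT (d - 1)) (sortedSlices k δ I P)).val).steps +
    ((reuseT (largeShelves k δ I P) (spaces P) P.length).steps +
    ((sortT (leTypeHtT (d - 1)) (smallItems k δ I)).steps +
    ((shelveT (sameTypeT (d - 1)) (sortedSmall k δ I)).steps +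
    ((nextFitT (smallShelves k δ I) (stackBinsT P 0).val.2 (largePlaces k δ I P).2).steps +
    ((appendT (largePlaces k δ I P).1 (smallPlaces k δ I P).1).steps +
    ((sortT (fun s t => leTypeHtT (d - 1) s.rep t.rep)
      ((largePlaces k δ I P).1 ++ (smallPlaces k δ I P).1)).steps +
    ((sortT (leTypeHtT (d - 1)) (items k I)).steps +
    ((shelveT (sameTypeT (d - 1)) (sortedItems k I)).steps +
    ((packShelvesT k d (allShelves k I) (placedShelves k δ I P)).steps + 0
      )))))))))))))))))))) := by
  have e : ((prepT k I (List.finRange n)).val) = items k I := val_prepT I _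
  simp only [inflate, Timed.steps_bind, val_longT, decide_eq_true_eq, not_le.2 h,
    if_false, val_lengthT, e, val_filterT, val_appendT, Timed.steps_pure]
  rfl

end Stages

/-! ## The number of bins -/

section Count

variable {k : ℕ} {δ : ℝ} {n d : ℕ} {I : Fin n → Fin d → ℝ} {P : FracPacking n}

theorem mem_items {a : Piece n} : a ∈ items k I ↔ ∃ i, pieceOf k I i = a := by
  simp [items]

theorem wd_pieceOf (hk : 3 ≤ k) (hI : ∀ i j, 0 < I i j ∧ I i j ≤ 1) (i : Fin n) :
    (pieceOf k I i).wd = (round k I i).w :=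
  (valid_pieceOf hk hI i).vol_eq (d - 1) le_rfl

theorem ht_pieceOf (i : Fin n) : (pieceOf k I i).ht = (round k I i).h := rfl

theorem pieceOf_bounds (hk : 3 ≤ k) (hd : 2 ≤ d) (hI : ∀ i j, 0 < I i j ∧ I i j ≤ 1) (i : Fin n) :
    (0 < (pieceOf k I i).wd ∧ (pieceOf k I i).wd ≤ 1) ∧
    0 < (pieceOf k I i).ht ∧ (pieceOf k I i).ht ≤ 1 := by
  refine ⟨⟨(valid_pieceOf hk hI i).vol_pos hk le_rfl, (valid_pieceOf hk hI i).vol_le_one hk le_rfl⟩,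
    ?_⟩
  have := hI i ⟨d - 1, by omega⟩
  rwa [← coord_val (x := I i)] at this

theorem round_pos (hk : 3 ≤ k) (hd : 2 ≤ d) (hI : ∀ i j, 0 < I i j ∧ I i j ≤ 1) (i : Fin n) :
    0 < (round k I i).w ∧ 0 < (round k I i).h := by
  rw [← wd_pieceOf hk hI, ← ht_pieceOf]
  exact ⟨(pieceOf_bounds hk hd hI i).1.1, (pieceOf_bounds hk hd hI i).2.1⟩

theorem items_bounds (hk : 3 ≤ k) (hd : 2 ≤ d) (hI : ∀ i j, 0 < I i j ∧ I i j ≤ 1) :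
    ∀ a ∈ items k I, (0 < a.wd ∧ a.wd ≤ 1) ∧ 0 < a.ht ∧ a.ht ≤ 1 := by
  intro a ha
  obtain ⟨i, rfl⟩ := mem_items.1 ha
  exact pieceOf_bounds hk hd hI i

theorem mem_largeItems {a : Piece n} : a ∈ largeItems k δ I ↔ a ∈ items k I ∧ δ < a.ht := by
  simp [largeItems]

theorem mem_smallItems {a : Piece n} : a ∈ smallItems k δ I ↔ a ∈ items k I ∧ a.ht ≤ δ := by
  simp [smallItems]

open Classical in
/-- The base types of the items. -/
noncomputable def baseKeys (k : ℕ) (I : Fin n → Fin d → ℝ) : Finset (List ℕ) :=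
  Finset.univ.image fun i => (pieceOf k I i).key (d - 1)

/-- The key list is a function of the base type. -/
theorem card_baseKeys_le (hk : 3 ≤ k) (hI : ∀ i j, 0 < I i j ∧ I i j ≤ 1) :
    (baseKeys k I).card ≤ numBaseTypes k I := by
  classical
  let g : (Fin (d - 1) → ℕ) → List ℕ := fun v =>
    keyList (fun j => if h : j < d - 1 then v ⟨j, h⟩ else 0) (d - 1)
  have e : baseKeys k I = (Finset.univ.image fun i => baseType k (I i)).image g := by
    rw [Finset.image_image, baseKeys]
    refine Finset.image_congr fun i _ => ?_
    refine (keyList_eq_iff _ _ _).2 fun j hj => ?_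
    rw [(valid_pieceOf hk hI i).typ_eq j hj, dif_pos hj]
    rfl
  rw [e]
  exact Finset.card_image_le

theorem one_le_numBaseTypes (hn : 1 ≤ n) : 1 ≤ numBaseTypes k I := by
  unfold numBaseTypes
  exact Finset.card_pos.2 ((Finset.univ_nonempty_iff.2 ⟨⟨0, by omega⟩⟩).image _)

theorem key_mem_baseKeys {a : Piece n} (ha : a ∈ items k I) : a.key (d - 1) ∈ baseKeys k I := by
  obtain ⟨i, rfl⟩ := mem_items.1 ha
  exact Finset.mem_image.2 ⟨i, Finset.mem_univ _, rfl⟩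

/-! ### Spaces -/

theorem perm_spaces (hP : P.IsShelfBased δ (round k I)) (hδ : 0 < δ) :
    ((spaces P).map Space.ht).Perm ((P.flatMap Bin.shelves).map Shelf.ht) := by
  rw [← (stackBinsT_spec P 0 fun B hB s hs => hδ.le.trans (hP.shelf_ht B hB s hs).le).1]
  exact (perm_sortT _ _).map _

theorem cnt_spaces (hP : P.IsShelfBased δ (round k I)) (hδ : 0 < δ) (q : ℝ → Prop) :
    cnt (fun s : Space => q s.ht) (spaces P) =
      cnt (fun s : Shelf n => q s.ht) (P.flatMap Bin.shelves) := by
  rw [← cnt_map (p := q) Space.ht, ← cnt_map (p := q) Shelf.ht]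
  exact cnt_perm (perm_spaces hP hδ)

theorem pairwise_spaces (P : FracPacking n) :
    (spaces P).Pairwise fun s t => t.ht ≤ s.ht :=
  pairwise_sortT_desc Space.ht _ (fun a b => by simp) _

theorem spaces_ht (hP : P.IsShelfBased δ (round k I)) (hδ : 0 < δ) :
    ∀ s ∈ spaces P, 0 < s.ht ∧ s.ht ≤ 1 := by
  intro s hs
  have : s.ht ∈ (P.flatMap Bin.shelves).map Shelf.ht :=
    (perm_spaces hP hδ).mem_iff.1 (List.mem_map_of_mem hs)
  obtain ⟨t, ht, e⟩ := List.mem_map.1 this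
  obtain ⟨B, hB, ht⟩ := List.mem_flatMap.1 ht
  obtain ⟨h1, -⟩ := (hP.valid B hB).1 t ht
  have h2 := hP.shelf_ht B hB t ht
  obtain ⟨-, -, h3, h4⟩ := h1
  simp only [Shelf.rect] at h3 h4
  rw [← e]
  exact ⟨by linarith, by linarith⟩

/-! ### Slices of large items -/

theorem sorted_large_bounds (hk : 3 ≤ k) (hd : 2 ≤ d) (hI : ∀ i j, 0 < I i j ∧ I i j ≤ 1) :
    ∀ a ∈ (sortT leHtT (largeItems k δ I)).val, 0 < a.wd ∧ a.wd ≤ 1 :=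
  fun a ha => (items_bounds hk hd hI a
    (mem_largeItems.1 ((perm_sortT _ _).mem_iff.1 ha)).1).1

/-- The large items of one base type and of at least a given height are not wider than their slices
in shelves of at least this height. -/
theorem wt_large_le (hk : 3 ≤ k) (hd : 2 ≤ d) (hI : ∀ i j, 0 < I i j ∧ I i j ≤ 1)
    (hδ : 0 < δ) (hP : P.IsShelfBased δ (round k I)) (κ : List ℕ) (h : ℝ) :
    wt Piece.wd (fun a => a.key (d - 1) = κ ∧ h ≤ a.ht) (largeItems k δ I) ≤
      wt Piece.wd (fun a => a.key (d - 1) = κ ∧ h ≤ a.ht) (largeSlices k δ I P) := by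
  classical
  rw [← wt_perm (perm_sortT leHtT (largeItems k δ I))]
  refine wt_le_wt_fillT (fun s => keyList s.typ (d - 1) = κ) _ _ _
    (pairwise_sortT_desc Piece.ht _ (fun a b => by simp [leHtT]) _)
    (sorted_large_bounds hk hd hI) (pairwise_spaces P) one_pos le_rfl (fun h => ?_) h
  -- The capacity of untouched spaces is their number, and the fractional packing `P` itself shows
  -- that it suffices at every height.
  rw [capacity_one, cnt_spaces hP hδ (fun x => h ≤ x), wt_perm (perm_sortT leHtT _), largeItems,
    wt_filter, items, wt_finRange]
  refine le_trans (le_of_eq ?_) (hP.sum_width_le (round_pos hk hd hI) h)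
  refine Finset.sum_congr rfl fun i _ => ?_
  rw [wd_pieceOf hk hI, ht_pieceOf]
  simp

theorem largeSlices_mem (hk : 3 ≤ k) (hd : 2 ≤ d) (hI : ∀ i j, 0 < I i j ∧ I i j ≤ 1) :
    (∀ b ∈ largeSlices k δ I P, (0 < b.wd ∧ b.wd ≤ 1) ∧ (b.key (d - 1) ∈ baseKeys k I) ∧
      ∃ s ∈ spaces P, s.ht = b.ht) ∧ (largeSlices k δ I P).length ≤ 2 * (largeItems k δ I).length := by
  obtain ⟨h1, h2⟩ := mem_fillT _ (spaces P) 1 (sorted_large_bounds (δ := δ) hk hd hI) one_pos le_rfl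
  refine ⟨fun b hb => ?_, ?_⟩
  · obtain ⟨g1, ⟨a, ha, g2⟩, g3⟩ := h1 b hb
    refine ⟨g1, ?_, g3⟩
    have := key_mem_baseKeys (mem_largeItems.1 ((perm_sortT _ _).mem_iff.1 ha)).1
    rwa [Piece.key, g2] at this
  · rwa [(perm_sortT _ _).length_eq] at h2

theorem sortedSlices_bounds (hk : 3 ≤ k) (hd : 2 ≤ d) (hI : ∀ i j, 0 < I i j ∧ I i j ≤ 1) :
    ∀ a ∈ sortedSlices k δ I P, 0 < a.wd ∧ a.wd ≤ 1 :=
  fun a ha => ((largeSlices_mem hk hd hI).1 a ((perm_sortT _ _).mem_iff.1 ha)).1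

/-- Sorting makes the pieces of each base type a contiguous run, as the counting lemmas for shelving
require. -/
theorem key_between (D : ℕ) (a b c : Piece n)
    (h : a.key D < b.key D ∨ a.key D = b.key D ∧ b.ht ≤ a.ht)
    (h' : b.key D < c.key D ∨ b.key D = c.key D ∧ c.ht ≤ b.ht) (e : a.key D = c.key D) :
    a.key D = b.key D := by
  rcases h with h | h
  · rcases h' with h' | h'
    · exact absurd (h.trans h') (by rw [e]; exact lt_irrefl _)
    · rw [e, h'.1] at h
      exact absurd h (lt_irrefl _)
  · exact h.1

theorem keyHt_between (D : ℕ) (a b c : Piece n)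
    (h : a.key D < b.key D ∨ a.key D = b.key D ∧ b.ht ≤ a.ht)
    (h' : b.key D < c.key D ∨ b.key D = c.key D ∧ c.ht ≤ b.ht)
    (e : (a.key D, a.ht) = (c.key D, c.ht)) : (a.key D, a.ht) = (b.key D, b.ht) := by
  obtain ⟨e1, e2⟩ := Prod.mk.inj e
  have h1 := key_between D a b c h h' e1
  rw [h1] at h e1
  rw [← e1] at h'
  simp only [lt_irrefl, true_and, false_or] at h h'
  rw [h1, le_antisymm (e2 ▸ h') h]

theorem ht_le_of_key (D : ℕ) (a b : Piece n)
    (h : a.key D < b.key D ∨ a.key D = b.key D ∧ b.ht ≤ a.ht) (e : a.key D = b.key D) :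
    b.ht ≤ a.ht := by
  rcases h with h | h
  · rw [e] at h
    exact absurd h (lt_irrefl _)
  · exact h.2

theorem sameTypeT_iff (D : ℕ) (a b : Piece n) :
    (sameTypeT D a b).val = true ↔ a.key D = b.key D := by
  simp [val_sameTypeT]

theorem sameTypeHtT_iff (D : ℕ) (a b : Piece n) :
    (sameTypeHtT D a b).val = true ↔ (a.key D, a.ht) = (b.key D, b.ht) := by
  simp [val_sameTypeHtT]

/-- With the height as part of the key, the condition `h ≤ s.rep.ht` in `cnt_shelveT` follows from
equality of keys, so the ceiling counts shelves of exactly this height. -/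
theorem cnt_largeShelves (hk : 3 ≤ k) (hd : 2 ≤ d) (hI : ∀ i j, 0 < I i j ∧ I i j ≤ 1)
    (κ : List ℕ) (h : ℝ) :
    cnt (fun s : TightShelf n => s.rep.key (d - 1) = κ ∧ s.rep.ht = h) (largeShelves k δ I P) =
      ⌈wt Piece.wd (fun a => a.key (d - 1) = κ ∧ a.ht = h) (largeSlices k δ I P)⌉₊ := by
  rw [← wt_perm (perm_sortT (leTypeHtT (d - 1)) (largeSlices k δ I P)), largeShelves,
    cnt_perm (perm_sortT _ _)]
  have := cnt_shelveT (sameTypeHtT_iff (d - 1)) (keyHt_between (d - 1))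
    (fun a b h e => ht_le_of_key (d - 1) a b h (Prod.mk.inj e).1) (sortedSlices k δ I P)
    (sortedTypeHt_sortT _ _) (sortedSlices_bounds hk hd hI) (κ, h) h
  have e : ∀ (a : List ℕ) (x : ℝ), ((a, x) = (κ, h) ∧ h ≤ x) ↔ (a = κ ∧ x = h) := by
    intro a x
    rw [Prod.mk.injEq]
    exact ⟨fun h => h.1, fun h => ⟨h, h.2.ge⟩⟩
  simp only [e] at this
  exact this

theorem largeShelves_rep (k : ℕ) (δ : ℝ) (I : Fin n → Fin d → ℝ) (P : FracPacking n) :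
    ∀ s ∈ largeShelves k δ I P, s.rep ∈ largeSlices k δ I P := by
  intro s hs
  have := rep_mem_shelveT (sameTypeHtT_iff (d - 1)) _ s ((perm_sortT _ _).mem_iff.1 hs)
  exact (perm_sortT _ _).mem_iff.1 this

theorem cnt_smallShelves (hk : 3 ≤ k) (hd : 2 ≤ d) (hI : ∀ i j, 0 < I i j ∧ I i j ≤ 1)
    (κ : List ℕ) (h : ℝ) :
    cnt (fun s : TightShelf n => s.rep.key (d - 1) = κ ∧ h ≤ s.rep.ht) (smallShelves k δ I) =
      ⌈wt Piece.wd (fun a => a.key (d - 1) = κ ∧ h ≤ a.ht) (smallItems k δ I)⌉₊ := by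
  rw [← wt_perm (perm_sortT (leTypeHtT (d - 1)) (smallItems k δ I))]
  exact cnt_shelveT (sameTypeT_iff (d - 1)) (key_between (d - 1)) (ht_le_of_key (d - 1))
    (sortedSmall k δ I) (sortedTypeHt_sortT _ _) (fun a ha => (items_bounds hk hd hI a
      (mem_smallItems.1 ((perm_sortT _ _).mem_iff.1 ha)).1).1) κ h

theorem cnt_allShelves (hk : 3 ≤ k) (hd : 2 ≤ d) (hI : ∀ i j, 0 < I i j ∧ I i j ≤ 1)
    (κ : List ℕ) (h : ℝ) :
    cnt (fun s : TightShelf n => s.rep.key (d - 1) = κ ∧ h ≤ s.rep.ht) (allShelves k I) =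
      ⌈wt Piece.wd (fun a => a.key (d - 1) = κ ∧ h ≤ a.ht) (items k I)⌉₊ := by
  rw [← wt_perm (perm_sortT (leTypeHtT (d - 1)) (items k I))]
  exact cnt_shelveT (sameTypeT_iff (d - 1)) (key_between (d - 1)) (ht_le_of_key (d - 1))
    (sortedItems k I) (sortedTypeHt_sortT _ _) (fun a ha => (items_bounds hk hd hI a
      ((perm_sortT _ _).mem_iff.1 ha)).1) κ h

/-- Separating the base types costs at most `Q - 1` new bins for each shelf height. -/
theorem largePlaces_bins (hk : 3 ≤ k) (hd : 2 ≤ d) (hI : ∀ i j, 0 < I i j ∧ I i j ≤ 1)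
    (hδ : 0 < δ) (hn : 1 ≤ n) (hP : P.IsShelfBased δ (round k I)) :
    (largePlaces k δ I P).2 ≤ P.length + P.numShelfHeights * (numBaseTypes k I - 1) := by
  classical
  have hT : ∀ s ∈ spaces P, s.ht ∈ ((P.flatMap Bin.shelves).map Shelf.ht).toFinset := by
    intro s hs
    exact List.mem_toFinset.2 ((perm_spaces hP hδ).mem_iff.1 (List.mem_map_of_mem hs))
  have h1 := reuseT_bins (largeShelves k δ I P) (spaces P) P.length
    ((P.flatMap Bin.shelves).map Shelf.ht).toFinset
    (fun s hs => by
      obtain ⟨-, -, t, ht, e⟩ := (largeSlices_mem hk hd hI).1 _ (largeShelves_rep k δ I P s hs)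
      rw [← e]
      exact hT t ht)
    (pairwise_sortT_desc (fun s : TightShelf n => s.rep.ht) _ (fun a b => by simp [leHtT]) _)
    (pairwise_spaces P)
  refine h1.trans (Nat.add_le_add_left ?_ _)
  have hterm : ∀ h ∈ ((P.flatMap Bin.shelves).map Shelf.ht).toFinset,
      cnt (fun s : TightShelf n => s.rep.ht = h) (largeShelves k δ I P) -
        cnt (fun s : Space => s.ht = h) (spaces P) ≤ numBaseTypes k I - 1 := by
    intro h _
    have e1 := cnt_eq_sum_fibers (fun s : TightShelf n => s.rep.ht = h)
      (fun s : TightShelf n => s.rep.key (d - 1)) (baseKeys k I) (largeShelves k δ I P)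
      (fun s hs _ => ((largeSlices_mem hk hd hI).1 _ (largeShelves_rep k δ I P s hs)).2.1)
    have e2 := wt_eq_sum_fibers Piece.wd (fun a : Piece n => a.ht = h)
      (fun a : Piece n => a.key (d - 1)) (baseKeys k I) (largeSlices k δ I P)
      (fun a ha _ => ((largeSlices_mem hk hd hI).1 a ha).2.1)
    have e3 := wt_fillT_le _ (spaces P) h (sorted_large_bounds (δ := δ) hk hd hI)
    change wt Piece.wd (fun a => a.ht = h) (largeSlices k δ I P) ≤ _ at e3
    rw [Finset.sum_congr rfl fun κ _ => cnt_largeShelves hk hd hI κ h] at e1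
    have hcard := card_baseKeys_le hk hI
    have hone := one_le_numBaseTypes (k := k) (I := I) hn
    rcases (baseKeys k I).eq_empty_or_nonempty with h0 | hne
    · rw [h0, Finset.sum_empty] at e1
      omega
    -- Each ceiling exceeds its argument by less than `1`, so the excess over the available spaces
    -- is strictly below the number of base types. Integrality improves this to `Q - 1`.
    · have hlt : ((∑ κ ∈ baseKeys k I,
          ⌈wt Piece.wd (fun a => a.key (d - 1) = κ ∧ a.ht = h) (largeSlices k δ I P)⌉₊ : ℕ) : ℝ) <
          ∑ κ ∈ baseKeys k I,
          (wt Piece.wd (fun a => a.key (d - 1) = κ ∧ a.ht = h) (largeSlices k δ I P) + 1) := by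
        push_cast
        refine Finset.sum_lt_sum_of_nonempty hne fun κ _ => Nat.ceil_lt_add_one ?_
        exact wt_nonneg fun a ha => ((largeSlices_mem hk hd hI).1 a ha).1.1.le
      rw [← e1, Finset.sum_add_distrib, ← e2, Finset.sum_const, nsmul_eq_mul, mul_one] at hlt
      have hlt2 : (cnt (fun s : TightShelf n => s.rep.ht = h) (largeShelves k δ I P) : ℝ) <
          ((cnt (fun s : Space => s.ht = h) (spaces P) + (baseKeys k I).card : ℕ) : ℝ) := by
        push_cast
        linarith
      have hlt3 := Nat.cast_lt.1 hlt2
      omega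
  refine (Finset.sum_le_sum hterm).trans ?_
  rw [Finset.sum_const, smul_eq_mul]
  refine le_of_eq ?_
  congr 1

/-- The placed shelves dominate the shelves for all items. -/
theorem cnt_allShelves_le (hk : 3 ≤ k) (hd : 2 ≤ d) (hI : ∀ i j, 0 < I i j ∧ I i j ≤ 1)
    (hδ : 0 < δ) (hP : P.IsShelfBased δ (round k I)) (κ : List ℕ) (h : ℝ) :
    cnt (fun s : TightShelf n => s.rep.key (d - 1) = κ ∧ h ≤ s.rep.ht) (allShelves k I) ≤
      cnt (fun s : PlacedShelf n => s.rep.key (d - 1) = κ ∧ h ≤ s.rep.ht)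
        (placedShelves k δ I P) := by
  classical
  have e0 : cnt (fun s : PlacedShelf n => s.rep.key (d - 1) = κ ∧ h ≤ s.rep.ht)
      (placedShelves k δ I P) =
      cnt (fun s : TightShelf n => s.rep.key (d - 1) = κ ∧ h ≤ s.rep.ht) (largeShelves k δ I P) +
      cnt (fun s : TightShelf n => s.rep.key (d - 1) = κ ∧ h ≤ s.rep.ht) (smallShelves k δ I) := by
    rw [placedShelves, cnt_perm (perm_sortT _ _), cnt_append]
    have H : ∀ (ps : List (PlacedShelf n)) (l : List (TightShelf n)),
        ps.map PlacedShelf.rep = l.map TightShelf.rep →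
        cnt (fun s : PlacedShelf n => s.rep.key (d - 1) = κ ∧ h ≤ s.rep.ht) ps =
        cnt (fun s : TightShelf n => s.rep.key (d - 1) = κ ∧ h ≤ s.rep.ht) l := by
      intro ps l e
      rw [← cnt_map (p := fun a : Piece n => a.key (d - 1) = κ ∧ h ≤ a.ht) PlacedShelf.rep, e,
        cnt_map]
    exact congrArg₂ (· + ·)
      (H _ _ (rep_reuseT (largeShelves k δ I P) (spaces P) P.length))
      (H _ _ (rep_nextFitT (smallShelves k δ I) (stackBinsT P 0).val.2 (largePlaces k δ I P).2))
  have e1 : wt Piece.wd (fun a => a.key (d - 1) = κ ∧ h ≤ a.ht) (items k I) =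
      wt Piece.wd (fun a => a.key (d - 1) = κ ∧ h ≤ a.ht) (largeItems k δ I) +
      wt Piece.wd (fun a => a.key (d - 1) = κ ∧ h ≤ a.ht) (smallItems k δ I) := by
    rw [largeItems, smallItems]
    induction items k I with
    | nil => simp
    | cons a l ih =>
      by_cases ha : δ < a.ht
      · rw [List.filter_cons_of_pos (by simpa using ha), List.filter_cons_of_neg (by simpa using ha)]
        by_cases hp : a.key (d - 1) = κ ∧ h ≤ a.ht
        · rw [wt_cons_pos (by exact hp), wt_cons_pos (by exact hp), ih]
          ring
        · rw [wt_cons_neg (by exact hp), wt_cons_neg (by exact hp), ih]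
      · rw [List.filter_cons_of_neg (by simpa using ha),
          List.filter_cons_of_pos (by simpa using ha)]
        by_cases hp : a.key (d - 1) = κ ∧ h ≤ a.ht
        · rw [wt_cons_pos (by exact hp), wt_cons_pos (by exact hp), ih]
          ring
        · rw [wt_cons_neg (by exact hp), wt_cons_neg (by exact hp), ih]
  -- Large slices are shelved separately for every height, so widths and shelves are compared for
  -- each shelf height `x ≥ h` and added up.
  have e2 : wt Piece.wd (fun a => a.key (d - 1) = κ ∧ h ≤ a.ht) (largeSlices k δ I P) ≤
      cnt (fun s : TightShelf n => s.rep.key (d - 1) = κ ∧ h ≤ s.rep.ht)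
        (largeShelves k δ I P) := by
    have c1 := cnt_eq_sum_fibers (fun s : TightShelf n => s.rep.key (d - 1) = κ ∧ h ≤ s.rep.ht)
      (fun s : TightShelf n => s.rep.ht) (((spaces P).map Space.ht).toFinset.filter fun x => h ≤ x)
      (largeShelves k δ I P) (fun s hs hp => by
        obtain ⟨-, -, t, ht, e⟩ := (largeSlices_mem hk hd hI).1 _ (largeShelves_rep k δ I P s hs)
        rw [Finset.mem_filter, List.mem_toFinset, ← e]
        exact ⟨List.mem_map_of_mem ht, e ▸ hp.2⟩)
    have c2 := wt_eq_sum_fibers Piece.wd (fun a : Piece n => a.key (d - 1) = κ ∧ h ≤ a.ht)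
      Piece.ht (((spaces P).map Space.ht).toFinset.filter fun x => h ≤ x)
      (largeSlices k δ I P) (fun a ha hp => by
        obtain ⟨-, -, t, ht, e⟩ := (largeSlices_mem hk hd hI).1 a ha
        rw [Finset.mem_filter, List.mem_toFinset, ← e]
        exact ⟨List.mem_map_of_mem ht, e ▸ hp.2⟩)
    rw [c1, c2]
    push_cast
    refine Finset.sum_le_sum fun x hx => ?_
    have hx := (Finset.mem_filter.1 hx).2
    rw [cnt_congr (q := fun s : TightShelf n => s.rep.key (d - 1) = κ ∧ s.rep.ht = x)
        fun s _ => ⟨fun hs => ⟨hs.2.1, hs.1⟩, fun hs => ⟨hs.2, hs.1, by rw [hs.2]; exact hx⟩⟩,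
      wt_congr (q := fun a : Piece n => a.key (d - 1) = κ ∧ a.ht = x)
        fun s _ => ⟨fun hs => ⟨hs.2.1, hs.1⟩, fun hs => ⟨hs.2, hs.1, by rw [hs.2]; exact hx⟩⟩,
      cnt_largeShelves hk hd hI]
    exact Nat.le_ceil _
  -- The left side is a ceiling, so bounding its argument suffices: large and small widths are each
  -- at most the number of their shelves.
  rw [cnt_allShelves hk hd hI, e0, Nat.ceil_le, e1]
  push_cast
  refine add_le_add ((wt_large_le hk hd hI hδ hP κ h).trans e2) ?_
  rw [cnt_smallShelves hk hd hI]
  exact Nat.le_ceil _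

end Count

/-! ## Correctness and the bound on the number of bins -/

section Correct

variable {k : ℕ} {δ : ℝ} {n d : ℕ} {I : Fin n → Fin d → ℝ} {P : FracPacking n}

theorem Space.Sep.symm {s t : Space} (h : s.Sep t) : t.Sep s := fun e => (h e.symm).symm

theorem FracPacking.IsShelfBased.stackBinsT_spec (hP : P.IsShelfBased δ (round k I))
    (hδ : 0 < δ) :
    (stackBinsT P 0).val.1.map Space.ht = (P.flatMap Bin.shelves).map Shelf.ht ∧
    (stackBinsT P 0).val.2.map OpenBin.top = P.map (fun B => (B.shelves.map Shelf.ht).sum) ∧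
    (stackBinsT P 0).val.2.map OpenBin.bin = List.range' 0 P.length ∧
    (∀ s ∈ (stackBinsT P 0).val.1, ∃ o ∈ (stackBinsT P 0).val.2, o.bin = s.bin ∧ 0 ≤ s.y ∧
      s.y + s.ht ≤ o.top) ∧
    (stackBinsT P 0).val.1.Pairwise Space.Sep :=
  HarmonicPacking.stackBinsT_spec P 0 fun B hB s hs => hδ.le.trans (hP.shelf_ht B hB s hs).le

theorem length_openBins (hP : P.IsShelfBased δ (round k I)) (hδ : 0 < δ) :
    (stackBinsT P 0).val.2.length = P.length := by
  simpa using congrArg List.length (hP.stackBinsT_spec hδ).2.2.1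

theorem openBins_bin_lt (hP : P.IsShelfBased δ (round k I)) (hδ : 0 < δ) :
    ∀ o ∈ (stackBinsT P 0).val.2, o.bin < P.length := by
  intro o ho
  have : o.bin ∈ List.range' 0 P.length :=
    (hP.stackBinsT_spec hδ).2.2.1 ▸ List.mem_map_of_mem ho
  simpa using this

theorem pairwise_openBins (hP : P.IsShelfBased δ (round k I)) (hδ : 0 < δ) :
    (stackBinsT P 0).val.2.Pairwise fun o o' => o.bin ≠ o'.bin := by
  have h : ((stackBinsT P 0).val.2.map OpenBin.bin).Nodup := by
    rw [(hP.stackBinsT_spec hδ).2.2.1]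
    exact List.nodup_range'
  exact List.pairwise_map.1 h

/-- The shelves of a bin of `P` have width `1` and do not overlap, so by area their heights add up
to at most `1`, and they still fit when pushed down. -/
theorem openBins_top (hk : 3 ≤ k) (hd : 2 ≤ d) (hI : ∀ i j, 0 < I i j ∧ I i j ≤ 1)
    (hP : P.IsShelfBased δ (round k I)) (hδ : 0 < δ) :
    ∀ o ∈ (stackBinsT P 0).val.2, o.top ≤ 1 := by
  intro o ho
  have h : o.top ∈ P.map fun B => (B.shelves.map Shelf.ht).sum :=
    (hP.stackBinsT_spec hδ).2.1 ▸ List.mem_map_of_mem ho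
  obtain ⟨B, hB, e⟩ := List.mem_map.1 h
  have hpos : ∀ p ∈ B.free, 0 < p.pos.w ∧ 0 < p.pos.h := fun p hp =>
    hP.slice_pos (round_pos hk hd hI) p (mem_slices_of_free hB hp)
  have h1 := (hP.valid B hB).sum_area_le
    (fun s hs => hδ.le.trans (hP.shelf_ht B hB s hs).le) hpos
  have h2 : 0 ≤ (B.free.map fun p => p.pos.w * p.pos.h).sum := List.sum_nonneg fun x hx => by
    obtain ⟨p, hp, rfl⟩ := List.mem_map.1 hx
    exact (mul_pos (hpos p hp).1 (hpos p hp).2).le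
  rw [← e]
  linarith

theorem pairwise_spaces_sep (hP : P.IsShelfBased δ (round k I)) (hδ : 0 < δ) :
    (spaces P).Pairwise Space.Sep :=
  ((perm_sortT _ _).pairwise_iff Space.Sep.symm).2 (hP.stackBinsT_spec hδ).2.2.2.2

theorem spaces_openBin (hP : P.IsShelfBased δ (round k I)) (hδ : 0 < δ) :
    ∀ s ∈ spaces P, ∃ o ∈ (stackBinsT P 0).val.2, o.bin = s.bin ∧ 0 ≤ s.y ∧
      s.y + s.ht ≤ o.top :=
  fun s hs => (hP.stackBinsT_spec hδ).2.2.2.1 s ((perm_sortT _ _).mem_iff.1 hs)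

theorem smallShelves_rep (k : ℕ) (δ : ℝ) (I : Fin n → Fin d → ℝ) :
    ∀ s ∈ smallShelves k δ I, s.rep ∈ smallItems k δ I := by
  intro s hs
  have := rep_mem_shelveT (sameTypeT_iff (d - 1)) _ s hs
  exact (perm_sortT _ _).mem_iff.1 this

theorem largePlaces_spec (hP : P.IsShelfBased δ (round k I)) (hδ : 0 < δ) :
    P.length ≤ (largePlaces k δ I P).2 ∧
    (∀ p ∈ (largePlaces k δ I P).1, p.space ∈ spaces P ∨
      (P.length ≤ p.bin ∧ p.bin < (largePlaces k δ I P).2 ∧ p.y = 0)) ∧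
    (largePlaces k δ I P).1.Pairwise fun p q => p.space.Sep q.space :=
  reuseT_places (largeShelves k δ I P) (spaces P) P.length (pairwise_spaces_sep hP hδ)
    fun s hs => by
      obtain ⟨o, ho, e, -⟩ := spaces_openBin hP hδ s hs
      exact e ▸ openBins_bin_lt hP hδ o ho

theorem largePlaces_ht (hk : 3 ≤ k) (hd : 2 ≤ d) (hI : ∀ i j, 0 < I i j ∧ I i j ≤ 1)
    (hP : P.IsShelfBased δ (round k I)) (hδ : 0 < δ) :
    ∀ p ∈ (largePlaces k δ I P).1, p.rep.ht ≤ 1 := by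
  intro p hp
  have h : p.rep ∈ (largeShelves k δ I P).map TightShelf.rep :=
    rep_reuseT (largeShelves k δ I P) (spaces P) P.length ▸ List.mem_map_of_mem hp
  obtain ⟨s, hs, e⟩ := List.mem_map.1 h
  obtain ⟨-, -, t, ht, e'⟩ := (largeSlices_mem hk hd hI).1 _ (largeShelves_rep k δ I P s hs)
  rw [← e, ← e']
  exact (spaces_ht hP hδ t ht).2

theorem smallPlaces_spec (hk : 3 ≤ k) (hd : 2 ≤ d) (hI : ∀ i j, 0 < I i j ∧ I i j ≤ 1)
    (hP : P.IsShelfBased δ (round k I)) (hδ : 0 < δ) :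
    (largePlaces k δ I P).2 ≤ (smallPlaces k δ I P).2 ∧
    (∀ p ∈ (smallPlaces k δ I P).1,
      ((∃ o ∈ (stackBinsT P 0).val.2, o.bin = p.bin ∧ o.top ≤ p.y) ∨
      ((largePlaces k δ I P).2 ≤ p.bin ∧ p.bin < (smallPlaces k δ I P).2 ∧ 0 ≤ p.y)) ∧
      p.y + p.rep.ht ≤ 1) ∧
    (smallPlaces k δ I P).1.Pairwise fun p q => p.space.Sep q.space :=
  nextFitT_places (smallShelves k δ I) (stackBinsT P 0).val.2 (largePlaces k δ I P).2
    (fun s hs => by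
      have := items_bounds hk hd hI _ (mem_smallItems.1 (smallShelves_rep k δ I s hs)).1
      exact ⟨this.2.1.le, this.2.2⟩)
    (pairwise_openBins hP hδ)
    fun o ho => (openBins_bin_lt hP hδ o ho).trans_le (largePlaces_spec hP hδ).1

/-- The bins are filled from the base. -/
theorem openBins_top_nonneg (hP : P.IsShelfBased δ (round k I)) (hδ : 0 < δ) :
    ∀ o ∈ (stackBinsT P 0).val.2, 0 ≤ o.top := by
  intro o ho
  have h : o.top ∈ P.map fun B => (B.shelves.map Shelf.ht).sum :=
    (hP.stackBinsT_spec hδ).2.1 ▸ List.mem_map_of_mem ho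
  obtain ⟨B, hB, e⟩ := List.mem_map.1 h
  rw [← e]
  refine List.sum_nonneg fun x hx => ?_
  obtain ⟨s, hs, rfl⟩ := List.mem_map.1 hx
  exact hδ.le.trans (hP.shelf_ht B hB s hs).le

/-- In a bin of `P`, the large shelves stay below the `top` of the pushed-down shelves, and the
small ones lie above it. The new bins of the two stages have disjoint ranges of numbers, because the
second stage starts counting where the first has stopped. -/
theorem placedShelves_spec (hk : 3 ≤ k) (hd : 2 ≤ d) (hI : ∀ i j, 0 < I i j ∧ I i j ≤ 1)
    (hP : P.IsShelfBased δ (round k I)) (hδ : 0 < δ) :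
    (∀ t ∈ placedShelves k δ I P,
      t.bin < (smallPlaces k δ I P).2 ∧ 0 ≤ t.y ∧ t.y + t.rep.ht ≤ 1) ∧
    (placedShelves k δ I P).Pairwise fun p q => p.space.Sep q.space := by
  obtain ⟨a1, a2, a3⟩ := largePlaces_spec hP hδ
  obtain ⟨b1, b2, b3⟩ := smallPlaces_spec hk hd hI hP hδ
  have hbin := openBins_bin_lt hP hδ
  have hsp := spaces_openBin hP hδ
  constructor
  · intro t ht
    rcases List.mem_append.1 ((perm_sortT _ _).mem_iff.1 ht) with ht | ht
    · rcases a2 t ht with h | ⟨h1, h2, h3⟩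
      · obtain ⟨o, ho, e, h4, h5⟩ := hsp _ h
        have h6 := openBins_top hk hd hI hP hδ o ho
        have h7 := hbin o ho
        simp only [PlacedShelf.space] at e h4 h5
        exact ⟨by omega, h4, by linarith⟩
      · refine ⟨by omega, h3.ge, ?_⟩
        rw [h3, zero_add]
        exact largePlaces_ht hk hd hI hP hδ t ht
    · obtain ⟨⟨o, ho, e, h1⟩ | ⟨h1, h2, h3⟩, h4⟩ := b2 t ht
      · have h5 := openBins_top_nonneg hP hδ o ho
        have h7 := hbin o ho
        exact ⟨by omega, by linarith, h4⟩
      · exact ⟨h2, h3, h4⟩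
  · refine ((perm_sortT _ _).pairwise_iff fun h => Space.Sep.symm h).2 ?_
    refine List.pairwise_append.2 ⟨a3, b3, fun p hp q hq e => ?_⟩
    simp only [PlacedShelf.space] at e ⊢
    rcases a2 p hp with h | ⟨h1, h2, h3⟩
    · obtain ⟨o, ho, e1, -, h5⟩ := hsp _ h
      simp only [PlacedShelf.space] at e1 h5
      have h7 := hbin o ho
      obtain ⟨⟨o', ho', e', h1⟩ | ⟨h1, h2, h3⟩, -⟩ := b2 q hq
      · have : o = o' := List.inj_on_of_nodup_map
          (List.pairwise_map.2 (pairwise_openBins hP hδ)) ho ho' (by omega)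
        subst this
        exact Or.inl (h5.trans h1)
      · omega
    · obtain ⟨⟨o', ho', e', h4⟩ | ⟨h4, h5, h6⟩, -⟩ := b2 q hq
      · have := hbin o' ho'
        omega
      · omega

/-- The result of `inflate` is a packing. -/
theorem isPackingOf_inflate (hk : 3 ≤ k) (hd : 2 ≤ d) (hI : ∀ i j, 0 < I i j ∧ I i j ≤ 1)
    (hδ : 0 < δ) (hP : P.IsShelfBased δ (round k I)) :
    (inflate k δ I P).val.IsPackingOf I := by
  rcases le_or_gt n P.length with h | h
  · rw [val_inflate_of_le k δ I P h]
    exact isPackingOf_onePerBinT hI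
  rw [val_inflate_of_lt k δ I P h]
  have hsort := sortedTypeHt_sortT (d - 1) (items k I)
  have hmem : ∀ a ∈ sortedItems k I, ∃ i, a = pieceOf k I i := fun a ha => by
    obtain ⟨i, e⟩ := mem_items.1 ((perm_sortT _ _).mem_iff.1 ha)
    exact ⟨i, e.symm⟩
  have hitems : (allShelves k I).flatMap TightShelf.items = sortedItems k I :=
    items_shelveT (sameTypeT_iff (d - 1)) _
  obtain ⟨ts, h1, h2, h3⟩ := packShelvesT_spec (k := k) (allShelves k I) (placedShelves k δ I P)
    (List.pairwise_map.2 (pairwise_rep_shelveT (sameTypeT_iff (d - 1)) _ hsort))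
    (List.pairwise_map.2 ((pairwise_sortT _
      (fun a b c => leTypeHtT_trans (d - 1) a.rep b.rep c.rep)
      (fun a b => leTypeHtT_total (d - 1) a.rep b.rep) _).imp
        fun h => (val_leTypeHtT (d - 1) _ _).1 h))
    (cnt_allShelves_le hk hd hI hδ hP)
  obtain ⟨h4, h5⟩ := placedShelves_spec hk hd hI hP hδ
  rw [h3]
  refine isPackingOf_of_forall₂ hk hd hI _ _ _ (fun s hs a ha => hmem a ?_)
    (good_shelveT (sameTypeT_iff (d - 1)) (ht_le_of_key (d - 1)) _ hsort fun a ha =>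
      (items_bounds hk hd hI a ((perm_sortT _ _).mem_iff.1 ha)).1) ?_ (h2.imp fun _ _ h => h.2)
    (fun t ht => h4 t (h1.subset ht)) (h5.sublist h1)
  · rw [← hitems]
    exact List.mem_flatMap.2 ⟨s, hs, ha⟩
  · rw [hitems]
    refine ((perm_sortT (leTypeHtT (d - 1)) (items k I)).map _).trans ?_
    rw [items, List.map_map]
    exact List.Perm.of_eq (List.map_id _)

/-- The total height of the shelves for the small items. -/
theorem sum_ht_smallShelves_le (hk : 3 ≤ k) (hd : 2 ≤ d) (hI : ∀ i j, 0 < I i j ∧ I i j ≤ 1)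
    (hδ : 0 < δ) :
    ((smallShelves k δ I).map fun s => s.rep.ht).sum ≤
      ∑ i, (if (round k I i).h ≤ δ then (round k I i).w * (round k I i).h else 0) +
        δ * numBaseTypes k I := by
  classical
  have hmem : ∀ a ∈ sortedSmall k δ I, a ∈ items k I ∧ a.ht ≤ δ :=
    fun a ha => mem_smallItems.1 ((perm_sortT _ _).mem_iff.1 ha)
  refine (sum_ht_shelveT (sameTypeT_iff (d - 1)) (key_between (d - 1)) (ht_le_of_key (d - 1))
    (sortedSmall k δ I) (sortedTypeHt_sortT _ _)
    (fun a ha => (items_bounds hk hd hI a (hmem a ha).1).1) δ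
    fun a ha => ⟨(items_bounds hk hd hI a (hmem a ha).1).2.1, (hmem a ha).2⟩).trans ?_
  refine add_le_add (le_of_eq ?_) (mul_le_mul_of_nonneg_left (Nat.cast_le.2 ?_) hδ.le)
  · have e1 : ((sortedSmall k δ I).map fun a => a.wd * a.ht).sum =
        ((smallItems k δ I).map fun a => a.wd * a.ht).sum := ((perm_sortT _ _).map _).sum_eq
    have e2 : ((smallItems k δ I).map fun a => a.wd * a.ht).sum =
        wt (fun a : Piece n => a.wd * a.ht) (fun a => a.ht ≤ δ) (items k I) := by
      rw [← wt_true, smallItems, wt_filter]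
      exact wt_congr fun a _ => by simp
    rw [e1, e2, items, wt_finRange]
    refine Finset.sum_congr rfl fun i _ => ?_
    rw [wd_pieceOf hk hI, ht_pieceOf]
  · refine le_trans (Finset.card_le_card fun κ hκ => ?_) (card_baseKeys_le hk hI)
    obtain ⟨a, ha, rfl⟩ := List.mem_map.1 ((@List.mem_toFinset _ (_) _ _).1 hκ)
    exact key_mem_baseKeys (hmem a ha).1

/-- The number of bins that `inflate` uses. -/
theorem numBins_inflate_lt (hk : 3 ≤ k) (hd : 2 ≤ d) (hI : ∀ i j, 0 < I i j ∧ I i j ≤ 1)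
    (hδ : 0 < δ) (hδ1 : δ < 1) (hn : 1 ≤ n) (hP : P.IsShelfBased δ (round k I)) :
    ((inflate k δ I P).val.numBins : ℝ) < P.length / (1 - δ) +
      P.numShelfHeights * ((numBaseTypes k I : ℝ) - 1) + 1 +
      δ * numBaseTypes k I / (1 - δ) := by
  have hQ : (1 : ℝ) ≤ numBaseTypes k I := by exact_mod_cast one_le_numBaseTypes (k := k) (I := I) hn
  have h1δ : 0 < 1 - δ := by linarith
  have hm : (P.length : ℝ) ≤ P.length / (1 - δ) := by
    rw [le_div_iff₀ h1δ]
    nlinarith [Nat.cast_nonneg (α := ℝ) P.length]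
  have ht : 0 ≤ (P.numShelfHeights : ℝ) * ((numBaseTypes k I : ℝ) - 1) :=
    mul_nonneg (Nat.cast_nonneg _) (by linarith)
  have hδQ : 0 ≤ δ * numBaseTypes k I / (1 - δ) :=
    div_nonneg (mul_nonneg hδ.le (by linarith)) h1δ.le
  -- With one bin per item, `n ≤ |P| ≤ |P| / (1 - δ)`, and the summand `1` makes the bound strict.
  rcases le_or_gt n P.length with h | h
  · rw [val_inflate_of_le k δ I P h]
    have : (n : ℝ) ≤ P.length := by exact_mod_cast h
    simp only
    linarith
  rw [val_inflate_of_lt k δ I P h]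
  simp only
  have hL : ((largePlaces k δ I P).2 : ℝ) ≤
      P.length + P.numShelfHeights * ((numBaseTypes k I : ℝ) - 1) := by
    have := Nat.cast_le (α := ℝ) |>.2 (largePlaces_bins (P := P) hk hd hI hδ hn hP)
    rwa [Nat.cast_add, Nat.cast_mul, Nat.cast_sub (one_le_numBaseTypes hn), Nat.cast_one] at this
  have hN : (smallPlaces k δ I P).2 = (largePlaces k δ I P).2 ∨
      (((stackBinsT P 0).val.2.length : ℝ) + (smallPlaces k δ I P).2 -
        (largePlaces k δ I P).2 - 1) * (1 - δ) <
      ((stackBinsT P 0).val.2.map OpenBin.top).sum +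
        ((smallShelves k δ I).map fun s => s.rep.ht).sum :=
    nextFitT_bins (smallShelves k δ I) (stackBinsT P 0).val.2 (largePlaces k δ I P).2 δ
      fun s hs => by
        obtain ⟨g1, g2⟩ := mem_smallItems.1 (smallShelves_rep k δ I s hs)
        exact ⟨(items_bounds hk hd hI _ g1).2.1, g2⟩
  -- If Next-Fit opens no bin, the bound on the first stage suffices, as `|P| ≤ |P| / (1 - δ)`.
  rcases hN with hN | hN
  · rw [hN]
    linarith
  rw [length_openBins hP hδ, (hP.stackBinsT_spec hδ).2.1] at hN
  have h1 := sum_ht_smallShelves_le hk hd hI hδ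
  have h2 := hP.sum_area_le hδ (round_pos hk hd hI)
  -- Shelf heights of `P` plus small area are at most `|P|`. All bins of `P` occur on the left, so
  -- their number cancels against the one in `hL`.
  have h3 : (P.length : ℝ) + (smallPlaces k δ I P).2 - (largePlaces k δ I P).2 - 1 <
      (P.length + δ * numBaseTypes k I) / (1 - δ) := by
    rw [lt_div_iff₀ h1δ]
    linarith
  rw [add_div] at h3
  linarith

end Correct

/-! ## The number of steps -/

section Steps

variable {k : ℕ} {δ : ℝ} {n d : ℕ} {I : Fin n → Fin d → ℝ} {P : FracPacking n}

theorem length_items (k : ℕ) (I : Fin n → Fin d → ℝ) : (items k I).length = n := by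
  simp [items]

theorem length_largeItems_le : (largeItems k δ I).length ≤ n :=
  (List.length_filter_le _ _).trans (length_items k I).le

theorem length_smallItems_le : (smallItems k δ I).length ≤ n :=
  (List.length_filter_le _ _).trans (length_items k I).le

theorem length_largeShelves_le (hk : 3 ≤ k) (hd : 2 ≤ d) (hI : ∀ i j, 0 < I i j ∧ I i j ≤ 1) :
    (largeSlices k δ I P).length ≤ 2 * n ∧
    (shelveT (sameTypeHtT (d - 1)) (sortedSlices k δ I P)).val.length ≤ 2 * n ∧
    (largeShelves k δ I P).length ≤ 2 * n ∧ (largePlaces k δ I P).1.length ≤ 2 * n := by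
  have h1 : (largeSlices k δ I P).length ≤ 2 * n :=
    (largeSlices_mem hk hd hI).2.trans (Nat.mul_le_mul_left 2 length_largeItems_le)
  have h2 : (shelveT (sameTypeHtT (d - 1)) (sortedSlices k δ I P)).val.length ≤ 2 * n :=
    (length_shelveT (sameTypeHtT_iff (d - 1)) _).trans ((perm_sortT _ _).length_eq.trans_le h1)
  have h3 : (largeShelves k δ I P).length ≤ 2 * n := (perm_sortT _ _).length_eq.trans_le h2
  refine ⟨h1, h2, h3, ?_⟩
  have := congrArg List.length (rep_reuseT (largeShelves k δ I P) (spaces P) P.length)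
  rw [List.length_map, List.length_map] at this
  exact this.trans_le h3

theorem length_smallShelves_le :
    (smallShelves k δ I).length ≤ n ∧ (smallPlaces k δ I P).1.length ≤ n := by
  have h1 : (smallShelves k δ I).length ≤ n := (length_shelveT (sameTypeT_iff (d - 1)) _).trans
    ((perm_sortT _ _).length_eq.trans_le length_smallItems_le)
  refine ⟨h1, ?_⟩
  have := congrArg List.length
    (rep_nextFitT (smallShelves k δ I) (stackBinsT P 0).val.2 (largePlaces k δ I P).2)
  rw [List.length_map, List.length_map] at this
  exact this.trans_le h1

/-- The early exit of `inflate` provides the hypothesis `P.length < n`; without it, the number of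
shelves would not be bounded in terms of the items. -/
theorem length_shelves_le_mul (hk : 3 ≤ k) (hd : 2 ≤ d) (hI : ∀ i j, 0 < I i j ∧ I i j ≤ 1)
    (hδ : 0 < δ) (hP : P.IsShelfBased δ (round k I)) (h : P.length < n) :
    (P.flatMap Bin.shelves).length ≤ ⌈1 / δ⌉₊ * n := by
  have h1 := hP.length_shelves_le hδ (round_pos hk hd hI)
  have h2 : (P.length : ℝ) / δ ≤ ⌈1 / δ⌉₊ * n := by
    rw [div_eq_mul_one_div, mul_comm]
    exact mul_le_mul (Nat.le_ceil _) (by exact_mod_cast h.le) (Nat.cast_nonneg _)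
      (Nat.cast_nonneg _)
  exact_mod_cast h1.trans h2

/-- Sorting with comparisons that take `O(d)` steps. -/
theorem steps_sortT_le {α : Type} (le : α → α → Timed Bool) (N : ℕ) (hd : 2 ≤ d) (hN : 1 ≤ N)
    (hle : ∀ a b, (le a b).steps ≤ 5 * d) (l : List α) (hl : l.length ≤ N) :
    (sortT le l).steps ≤ 7 * (d * N * (Nat.clog 2 N + 1)) := by
  refine (steps_sortT le _ hle l).trans ?_
  have h1 : l.length * Nat.clog 2 l.length ≤ N * Nat.clog 2 N :=
    Nat.mul_le_mul hl (Nat.clog_mono_right 2 hl)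
  have h2 : (5 * d + 4) * (l.length * Nat.clog 2 l.length) ≤ 7 * d * (N * Nat.clog 2 N) :=
    Nat.mul_le_mul (by omega) h1
  have h3 : 2 * N ≤ d * N := Nat.mul_le_mul_right N hd
  calc _ ≤ 7 * d * (N * Nat.clog 2 N) + 7 * (d * N) := by omega
    _ = _ := by ring

/-- Shelving with comparisons that take `O(d)` steps. -/
theorem steps_shelveT_le (same : Piece n → Piece n → Timed Bool) (N : ℕ) (hd : 2 ≤ d)
    (hN : 1 ≤ N) (hs : ∀ a b, (same a b).steps ≤ 5 * d) (l : List (Piece n)) (hl : l.length ≤ N) :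
    (shelveT same l).steps ≤ 9 * (d * N * (Nat.clog 2 N + 1)) := by
  refine (steps_shelveT _ hs l).trans ?_
  have h1 : (5 * d + 5) * l.length ≤ 8 * d * N := Nat.mul_le_mul (by omega) hl
  have h2 : 2 * N ≤ d * N := Nat.mul_le_mul_right N hd
  calc _ ≤ 9 * (d * N) := by nlinarith
    _ ≤ _ := Nat.mul_le_mul_left 9 (Nat.le_mul_of_pos_right _ (Nat.succ_pos _))

/-- Preparing the items. -/
theorem steps_prepT_le (k N : ℕ) (hd : 2 ≤ d) (hN : 1 ≤ N) (I : Fin n → Fin d → ℝ)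
    (l : List (Fin n)) (hl : l.length ≤ N) :
    (prepT k I l).steps ≤ (4 * k + 13) * (d * N * (Nat.clog 2 N + 1)) := by
  refine (steps_prepT I l).trans ?_
  have h1 : ((4 * k + 11) * (d - 1 + 1) + 3) * l.length ≤ ((4 * k + 11) * d + 3) * N :=
    Nat.mul_le_mul (Nat.add_le_add_right (Nat.mul_le_mul_left _ (by omega)) 3) hl
  have h2 : 2 * N ≤ d * N := Nat.mul_le_mul_right N hd
  calc _ ≤ ((4 * k + 11) * d + 3) * N + 1 := Nat.add_le_add_right h1 1
    _ = (4 * k + 11) * (d * N) + (3 * N + 1) := by ring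
    _ ≤ (4 * k + 11) * (d * N) + 2 * (d * N) := by omega
    _ = (4 * k + 13) * (d * N) := by ring
    _ ≤ _ := Nat.mul_le_mul_left _ (Nat.le_mul_of_pos_right _ (Nat.succ_pos _))

/-- Packing the items of the shelves. -/
theorem steps_packShelvesT_le (k N : ℕ) (hd : 2 ≤ d) (hN : 1 ≤ N) (l : List (TightShelf n))
    (ps : List (PlacedShelf n)) (h1 : l.length ≤ N) (h2 : ps.length ≤ N)
    (h3 : (l.flatMap TightShelf.items).length ≤ N) :
    (packShelvesT k d l ps).steps ≤ 60 * (d * N * (Nat.clog 2 N + 1)) := by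
  refine (steps_packShelvesT k N d hd l ps h3).trans ?_
  have g1 : (5 * (d - 1) + 2) * ps.length ≤ 5 * d * N := Nat.mul_le_mul (by omega) h2
  have g2 : (5 * (d - 1) + 13) * l.length ≤ 10 * d * N := Nat.mul_le_mul (by omega) h1
  have g3 : (7 * Nat.clog 2 N + 21) * (d - 1) ≤ (7 * Nat.clog 2 N + 21) * d :=
    Nat.mul_le_mul_left _ (by omega)
  have g4 : ((7 * Nat.clog 2 N + 21) * (d - 1) + d + 2) * (l.flatMap TightShelf.items).length ≤
      ((7 * Nat.clog 2 N + 21) * d + d + d) * N := Nat.mul_le_mul (by omega) h3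
  have g5 : 2 * N ≤ d * N := Nat.mul_le_mul_right N hd
  have g6 : d * N ≤ d * N * (Nat.clog 2 N + 1) := Nat.le_mul_of_pos_right _ (Nat.succ_pos _)
  calc _ ≤ 5 * d * N + 10 * d * N + ((7 * Nat.clog 2 N + 21) * d + d + d) * N + 1 := by omega
    _ = 7 * (d * N * (Nat.clog 2 N + 1)) + 31 * (d * N) + 1 := by ring
    _ ≤ _ := by omega

/-- The number `N` bounds every list that is sorted, shelved or packed: at most `⌈1 / δ⌉ n` spaces,
at most `2 n` slices or shelves for large items, and at most `3 n` placed shelves. Each stage is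
then at most a constant times `X`, where only the preparation has a constant depending on `k`. -/
theorem steps_inflate_le (hk : 3 ≤ k) (hd : 2 ≤ d) (hn : 1 ≤ n)
    (hI : ∀ i j, 0 < I i j ∧ I i j ≤ 1)
    (hδ : 0 < δ) (hP : P.IsShelfBased δ (round k I)) (N : ℕ) (hN : N = (⌈1 / δ⌉₊ + 3) * n) :
    (inflate k δ I P).steps ≤ (4 * k + 200) * (d * N * (Nat.clog 2 N + 1)) := by
  have hNn : 3 * n ≤ N := hN ▸ Nat.mul_le_mul_right n (by omega)
  have hnN : n ≤ N := by omega
  have h2nN : 2 * n ≤ N := by omega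
  have hN1 : 1 ≤ N := by omega
  set X := d * N * (Nat.clog 2 N + 1) with hX
  have hX1 : d * N ≤ X := Nat.le_mul_of_pos_right _ (Nat.succ_pos _)
  have hX2 : 2 * N ≤ X := (Nat.mul_le_mul_right N hd).trans hX1
  have hkX : (4 * k + 200) * X = (4 * k + 13) * X + 187 * X := by ring
  rcases le_or_gt n P.length with h | h
  · rw [steps_inflate_of_le k δ I P h, (onePerBinT_spec (List.finRange n) 0).2.2.2]
    have h1 := steps_longT P n
    have h2 : d * n ≤ d * N := Nat.mul_le_mul_left d (by omega)
    have h3 : (2 + d) * n = 2 * n + d * n := by ring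
    simp only [List.length_finRange, h3]
    omega
  obtain ⟨l1, l2, l3, l4⟩ := length_largeShelves_le (δ := δ) (P := P) hk hd hI
  obtain ⟨l5, l6⟩ := length_smallShelves_le (k := k) (δ := δ) (I := I) (P := P)
  have l7 : (P.flatMap Bin.shelves).length ≤ N :=
    (length_shelves_le_mul hk hd hI hδ hP h).trans (hN ▸ Nat.mul_le_mul_right n (by omega))
  have l8 : (stackBinsT P 0).val.1.length ≤ N := by
    have := congrArg List.length (hP.stackBinsT_spec hδ).1
    rw [List.length_map, List.length_map] at this
    omega
  have l9 : (spaces P).length ≤ N := (perm_sortT _ _).length_eq.trans_le l8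
  have l10 : (allShelves k I).length ≤ n := (length_shelveT (sameTypeT_iff (d - 1)) _).trans
    ((perm_sortT _ _).length_eq.trans_le (length_items k I).le)
  have l11 : ((allShelves k I).flatMap TightShelf.items).length = n := by
    have : (allShelves k I).flatMap TightShelf.items = sortedItems k I :=
      items_shelveT (sameTypeT_iff (d - 1)) _
    rw [this]
    exact (perm_sortT _ _).length_eq.trans (length_items k I)
  have l12 := length_largeItems_le (k := k) (δ := δ) (I := I)
  have l13 := length_smallItems_le (k := k) (δ := δ) (I := I)
  have l14 : (sortT leHtT (largeItems k δ I)).val.length ≤ n :=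
    (perm_sortT _ _).length_eq.trans_le l12
  have l15 : (placedShelves k δ I P).length ≤ 3 * n := by
    have := (perm_sortT (fun s t => leTypeHtT (d - 1) s.rep t.rep)
      ((largePlaces k δ I P).1 ++ (smallPlaces k δ I P).1)).length_eq
    rw [List.length_append] at this
    unfold placedShelves
    omega
  have l16 := length_items k I
  have l17 : (sortedSlices k δ I P).length ≤ 2 * n := (perm_sortT _ _).length_eq.trans_le l1
  have l18 : (sortedSmall k δ I).length ≤ n := (perm_sortT _ _).length_eq.trans_le l13
  have l19 : (sortedItems k I).length ≤ n := (perm_sortT _ _).length_eq.trans_le l16.le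
  have l20 := length_openBins hP hδ
  have hle : ∀ a b : Piece n, (leTypeHtT (d - 1) a b).steps ≤ 5 * d := fun a b =>
    (steps_leTypeHtT (d - 1) a b).trans (by omega)
  have hsame : ∀ a b : Piece n, (sameTypeT (d - 1) a b).steps ≤ 5 * d := fun a b =>
    (steps_sameTypeT (d - 1) a b).trans (by omega)
  have hsameHt : ∀ a b : Piece n, (sameTypeHtT (d - 1) a b).steps ≤ 5 * d := fun a b =>
    (steps_sameTypeHtT (d - 1) a b).trans (by omega)
  have hht : ∀ a b : Piece n, (leHtT a b).steps ≤ 5 * d := fun a b =>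
    le_trans (b := 1) le_rfl (by omega)
  have s1 := steps_longT P n
  have s2 := steps_lengthT P
  have s3 := steps_prepT_le k N hd hN1 I (List.finRange n) (List.length_finRange.trans_le hnN)
  have s4 := steps_filterT (fun a : Piece n => ltT δ a.ht) 1 (fun _ => le_rfl) (items k I)
  have s5 := steps_filterT (fun a : Piece n => leT a.ht δ) 1 (fun _ => le_rfl) (items k I)
  have s6 := steps_stackBinsT P 0
  have s7 := steps_sortT_le (fun s t : Space => leT t.ht s.ht) N hd hN1
    (fun _ _ => le_trans (b := 1) le_rfl (by omega)) _ l8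
  have s8 := steps_sortT_le leHtT N hd hN1 hht (largeItems k δ I) (l12.trans hnN)
  have s9 := steps_fillT (sortT leHtT (largeItems k δ I)).val (spaces P) 1
  have s10 := steps_sortT_le _ N hd hN1 hle (largeSlices k δ I P) (l1.trans h2nN)
  have s11 := steps_shelveT_le _ N hd hN1 hsameHt (sortedSlices k δ I P) (l17.trans h2nN)
  have s12 := steps_sortT_le (fun s t : TightShelf n => leHtT s.rep t.rep) N hd hN1
    (fun _ _ => hht _ _) (shelveT (sameTypeHtT (d - 1)) (sortedSlices k δ I P)).val
    (l2.trans h2nN)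
  have s13 := steps_reuseT (largeShelves k δ I P) (spaces P) P.length
  have s14 := steps_sortT_le _ N hd hN1 hle (smallItems k δ I) (l13.trans hnN)
  have s15 := steps_shelveT_le _ N hd hN1 hsame (sortedSmall k δ I) (l18.trans hnN)
  have s16 := steps_nextFitT (smallShelves k δ I) (stackBinsT P 0).val.2 (largePlaces k δ I P).2
  have s17 := steps_appendT (largePlaces k δ I P).1 (smallPlaces k δ I P).1
  have s18 := steps_sortT_le (fun s t : PlacedShelf n => leTypeHtT (d - 1) s.rep t.rep) N hd hN1
    (fun _ _ => hle _ _) ((largePlaces k δ I P).1 ++ (smallPlaces k δ I P).1)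
    (((perm_sortT _ _).length_eq.symm.trans_le l15).trans hNn)
  have s19 := steps_sortT_le _ N hd hN1 hle (items k I) (l16.trans_le hnN)
  have s20 := steps_shelveT_le _ N hd hN1 hsame (sortedItems k I) (l19.trans hnN)
  have s21 := steps_packShelvesT_le k N hd hN1 (allShelves k I) (placedShelves k δ I P)
    (l10.trans hnN) (l15.trans hNn) (l11.trans_le hnN)
  rw [← hX] at s3 s7 s8 s10 s11 s12 s14 s15 s18 s19 s20 s21
  rw [steps_inflate_of_lt k δ I P h, hkX]
  linarith

/-! ### From integer to real logarithms -/

theorem clog_mul_le (a b : ℕ) : Nat.clog 2 (a * b) ≤ Nat.clog 2 a + Nat.clog 2 b := by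
  refine Nat.clog_le_of_le_pow ?_
  rw [pow_add]
  exact Nat.mul_le_mul (Nat.le_pow_clog one_lt_two a) (Nat.le_pow_clog one_lt_two b)

theorem clog_le_log (hn : 1 ≤ n) :
    (Nat.clog 2 n : ℝ) ≤ 1 + Real.log (n + 1) / Real.log 2 := by
  have h1 : (1 : ℝ) ≤ n := by exact_mod_cast hn
  have h2 : 0 ≤ Real.logb 2 n := Real.logb_nonneg one_lt_two h1
  have h3 := Nat.ceil_lt_add_one h2
  have h4 := Real.natCeil_logb_natCast 2 n
  rw [Nat.cast_ofNat] at h4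
  rw [h4] at h3
  have h5 : Real.logb 2 n ≤ Real.log (n + 1) / Real.log 2 :=
    div_le_div_of_nonneg_right (Real.log_le_log (by linarith) (by linarith))
      (Real.log_pos one_lt_two).le
  linarith

/-- For `n ≥ 1` the quotient `log (n + 1) / log 2` is at least `1`, so it absorbs all additive
constants: `clog E` from the factor `E`, one from rounding the logarithm up, and the explicit `+ 1`;
together with the quotient itself this makes `clog E + 3`. -/
theorem mul_clog_le (E : ℕ) (hn : 1 ≤ n) :
    ((d * (E * n) * (Nat.clog 2 (E * n) + 1) : ℕ) : ℝ) ≤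
      (E * (Nat.clog 2 E + 3) / Real.log 2) * (n * d * Real.log (n + 1)) := by
  have hlog : 0 < Real.log 2 := Real.log_pos one_lt_two
  have h1 : (1 : ℝ) ≤ n := by exact_mod_cast hn
  have h2 : 1 ≤ Real.log (n + 1) / Real.log 2 := by
    rw [le_div_iff₀ hlog, one_mul]
    exact Real.log_le_log two_pos (by linarith)
  have h3 : (Nat.clog 2 (E * n) : ℝ) ≤ Nat.clog 2 E + Nat.clog 2 n := by
    exact_mod_cast clog_mul_le E n
  have h4 := clog_le_log hn
  have h5 : (Nat.clog 2 (E * n) : ℝ) + 1 ≤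
      (Nat.clog 2 E + 3) * (Real.log (n + 1) / Real.log 2) := by
    nlinarith [Nat.cast_nonneg (α := ℝ) (Nat.clog 2 E)]
  push_cast
  calc (d * (E * n) * (Nat.clog 2 (E * n) + 1) : ℝ) ≤
      d * (E * n) * ((Nat.clog 2 E + 3) * (Real.log (n + 1) / Real.log 2)) :=
        mul_le_mul_of_nonneg_left h5 (by positivity)
    _ = _ := by ring

end Steps

end HarmonicPacking

theorem mainTheorem8 (k : ℕ) (hk : 3 ≤ k) (δ : ℝ) (hδ0 : 0 < δ) (hδ1 : δ < 1) :
    ∃ C : ℝ, ∀ (d n : ℕ) (I : Fin n → Fin d → ℝ) (P : HarmonicPacking.FracPacking n),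
      2 ≤ d → 1 ≤ n → (∀ i j, 0 < I i j ∧ I i j ≤ 1) →
      P.IsShelfBased δ (HarmonicPacking.round k I) →
        (HarmonicPacking.inflate k δ I P).val.IsPackingOf I ∧
        ((HarmonicPacking.inflate k δ I P).val.numBins : ℝ) <
          (P.length : ℝ) / (1 - δ)
            + (P.numShelfHeights : ℝ) * ((HarmonicPacking.numBaseTypes k I : ℝ) - 1)
            + 1 + δ * (HarmonicPacking.numBaseTypes k I : ℝ) / (1 - δ) ∧
        ((HarmonicPacking.inflate k δ I P).steps : ℝ) ≤
          C * ((n : ℝ) * (d : ℝ) * Real.log ((n : ℝ) + 1)) := by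
  -- The constant combines the factor of `steps_inflate_le` with that of `mul_clog_le` for `E = ⌈1 /
  -- δ⌉ + 3`, so it depends only on `k` and `δ`.
  refine ⟨(4 * k + 200 : ℕ) * ((⌈1 / δ⌉₊ + 3 : ℕ) * (Nat.clog 2 (⌈1 / δ⌉₊ + 3) + 3) /
    Real.log 2), fun d n I P hd hn hI hP =>
    ⟨HarmonicPacking.isPackingOf_inflate hk hd hI hδ0 hP,
      HarmonicPacking.numBins_inflate_lt hk hd hI hδ0 hδ1 hn hP, ?_⟩⟩
  refine (Nat.cast_le.2 (HarmonicPacking.steps_inflate_le hk hd hn hI hδ0 hP _ rfl)).trans ?_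
  rw [Nat.cast_mul]
  refine (mul_le_mul_of_nonneg_left (HarmonicPacking.mul_clog_le _ hn)
    (Nat.cast_nonneg _)).trans_eq ?_
  ring
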